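/- Let $0<\alpha\le 1$ and let $(\lambda_j)_{j\in\mathbb Z}$ be real numbers with $\lambda_j=0$ for $j<0$, $\lambda_0>0$, $\lambda_j\ge 0$ and $\lambda_{j+1}\le\lambda_j$ for $j\ge 0$, and $\lim_{j\to\infty}\lambda_{j+1}/\lambda_j<1$ (the quotient being read as $0$ if $\lambda_j=0$). For $\beta>0$ and $n=\lceil\beta\rceil$ let $\partial_t^\beta$ be the Dzhrbashyan--Caputo derivative: $\partial_t^\beta f=f^{(n)}$ if $\beta=n$, and $\partial_t^\beta f(t)=\frac1{\Gamma(n-\beta)}\int_0^t(t-s)^{n-\beta-1}f^{(n)}(s)\,ds$ otherwise, for $f\in C^{n-1}[0,\infty)$ with $f^{(n-1)}$ absolutely continuous on bounded intervals. A convoluted fractional Poisson process (CFPP) of order $\alpha$ is a process $\{\mathcal N_c^\alpha(t)\}_{t\ge0}$ with values in $\{0,1,2,\dots\}$ whose state probabilities $p(n,t)=\Pr\{\mathcal N_c^\alpha(t)=n\}$, $n\in\mathbb Z$, satisfy $p(0,0)=1$, $p(n,0)=0$ for $n\ge1$ and $$\partial_t^\alpha p(n,t)=-\sum_{j\in\mathbb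 Z}\lambda_j\,p(n-j,t)+\sum_{j\in\mathbb Z}\lambda_j\,p(n-1-j,t),\qquad n\ge0,\ t>0 .$$ A convoluted Poisson process (CPP) $\{\mathcal N_c(t)\}_{t\ge0}$ is such a process for $\alpha=1$, with the same $\lambda_j$ and with right-continuous paths. A solution of the fractional diffusion equation $\partial_t^{2\alpha}u=u_{xx}$ on $\mathbb R\times(0,\infty)$ with $u(\cdot,0)=\delta_0$, and $\partial_tu(\cdot,0)=0$ if $1/2<\alpha\le1$, is a family of probability measures $(u_t)_{t\ge0}$ on $\mathbb R$ that satisfies these relations when paired with test functions $\varphi\in C_c^\infty(\mathbb R)$ in $x$. Its folded solution is the family of images $\bar u_t$ of $u_t$ under $x\mapsto|x|$ (if $u_t$ has an even density $u(\cdot,t)$, then $\bar u_t$ has density $2u(\cdot,t)$ on $(0,\infty)$). Let $\{T_{2\alpha}(t)\}_{t>0}$ denote a process with values in $[0,\infty)$ such that, for some such solution, $T_{2\alpha}(t)$ has law $\bar u_t$ for all $t>0$. An inverse $\alpha$-stable subordinator is a process $H^\alpha(t)=\inf\{x\ge0:D(x)>t\}$ (almost surely, for each $t$), where $D$ is a nondecreasing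 right-continuous Lévy process with $\mathbb E\,e^{-sD(x)}=e^{-xs^\alpha}$ for $s>0$. Then: 1. If $\{T_{2\alpha}(t)\}_{t>0}$ is independent of the CPP, then $\mathcal N_c^\alpha(t)\overset{d}{=}\mathcal N_c(T_{2\alpha}(t))$ for every $t>0$. 2. The Laplace transform in time of the folded solution is $s^{\alpha-1}e^{-xs^\alpha}$, $x>0$: for all $s>0$ and all Borel sets $A\subseteq\mathbb R$, $$\int_0^\infty e^{-st}\,\bar u_t(A)\,dt=\int_{A\cap(0,\infty)}s^{\alpha-1}e^{-xs^\alpha}\,dx .$$ If $\alpha<1$, then for $t>0$ the measure $\bar u_t$ has a density $f_{T_{2\alpha}}(\cdot,t)\ge0$ on $(0,\infty)$, with $f_{T_{2\alpha}}$ continuous on $(0,\infty)^2$, and $$\int_0^\infty e^{-st}f_{T_{2\alpha}}(x,t)\,dt=s^{\alpha-1}e^{-xs^\alpha}\qquad\text{for all }x>0,\ s>0 .$$ 3. For any inverse $\alpha$-stable subordinator $H^\alpha$, the law of $H^\alpha(t)$ is $\bar u_t$ for every $t>0$; and if $\{H^\alpha(t)\}_{t>0}$ is independent of the CPP, then $\mathcal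 N_c^\alpha(t)\overset{d}{=}\mathcal N_c(H^\alpha(t))$ for every $t>0$. -/

import Mathlib

open MeasureTheory ProbabilityTheory Set Filter Topology
open scoped NNReal ENNReal

/-- The regularity under which the Dzhrbashyan--Caputo derivative of order `β > 0` is defined
(the class `AC^n` with `n = ⌈β⌉`): `f` is `C^(n-1)` on `[0, ∞)` and its derivative of order `n - 1`
is absolutely continuous on every `[0, τ]`. Only the values of `f` on `[0, ∞)` matter. -/
def CaputoRegular (β : ℝ) (f : ℝ → ℝ) : Prop :=
  ContDiffOn ℝ ((⌈β⌉₊ - 1 : ℕ) : ℕ∞) f (Ici 0) ∧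
    ∀ τ : ℝ, 0 < τ →
      AbsolutelyContinuousOnInterval (iteratedDerivWithin (⌈β⌉₊ - 1) f (Ici 0)) 0 τ

/-- The Dzhrbashyan--Caputo derivative of order `β > 0` of `f` exists at `t` and equals `v`.
With `n = ⌈β⌉` it is the ordinary derivative `f^(n) (t)` if `β = n`, and otherwise
`1 / Γ(n - β) * ∫_0^t (t - s)^(n - β - 1) f^(n) (s) ds`. -/
def HasCaputoDerivAt (β : ℝ) (f : ℝ → ℝ) (v t : ℝ) : Prop :=
  ((⌈β⌉₊ : ℝ) = β →
    HasDerivWithinAt (iteratedDerivWithin (⌈β⌉₊ - 1) f (Ici 0)) v (Ici 0) t) ∧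
  ((⌈β⌉₊ : ℝ) ≠ β →
    IntervalIntegrable
      (fun s => (t - s) ^ ((⌈β⌉₊ : ℝ) - β - 1) * iteratedDerivWithin ⌈β⌉₊ f (Ici 0) s)
      volume 0 t ∧
    (Real.Gamma ((⌈β⌉₊ : ℝ) - β))⁻¹ *
      ∫ s in (0 : ℝ)..t,
        (t - s) ^ ((⌈β⌉₊ : ℝ) - β - 1) * iteratedDerivWithin ⌈β⌉₊ f (Ici 0) s = v)

/-- Discrete convolution of two functions on the integers. -/
noncomputable def discreteConv (f g : ℤ → ℝ) (n : ℤ) : ℝ := ∑' j : ℤ, f j * g (n - j)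

/-- The admissible intensity sequences `(λ_j)`, `j ∈ ℤ`. In `ratio` the quotient is read as `0` when
`λ_j = 0`, so that sequences with finitely many nonzero terms are admissible. -/
structure IsIntensitySeq (lam : ℤ → ℝ) : Prop where
  neg : ∀ j : ℤ, j < 0 → lam j = 0
  zero_pos : 0 < lam 0
  nonneg : ∀ j : ℤ, 0 < j → 0 ≤ lam j
  anti : ∀ j : ℤ, 0 ≤ j → lam (j + 1) ≤ lam j
  ratio : ∃ l : ℝ, l < 1 ∧ Tendsto (fun j : ℕ => lam ((j : ℤ) + 1) / lam (j : ℤ)) atTop (𝓝 l)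

section Processes

variable {Ω : Type*} [MeasurableSpace Ω]

/-- The state probability `p(n, t) = P (N(t) = n)`, for `n ∈ ℤ` (it vanishes for `n < 0`) and
`t ≥ 0`. -/
noncomputable def stateProb (P : Measure Ω) (N : ℝ≥0 → Ω → ℕ) (n : ℤ) (t : ℝ) : ℝ :=
  P.real {ω | (N t.toNNReal ω : ℤ) = n}

/-- `N` is a convoluted fractional Poisson process of order `α` with intensities `lam`. -/
structure IsCFPP (lam : ℤ → ℝ) (α : ℝ) (P : Measure Ω) (N : ℝ≥0 → Ω → ℕ) : Prop where
  measurable : ∀ t, Measurable (N t)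
  init_zero : stateProb P N 0 0 = 1
  init_pos : ∀ n : ℕ, 1 ≤ n → stateProb P N n 0 = 0
  regular : ∀ n : ℕ, CaputoRegular α (stateProb P N n)
  equation : ∀ (n : ℕ) (t : ℝ), 0 < t →
    HasCaputoDerivAt α (stateProb P N n)
      (-discreteConv lam (fun k => stateProb P N k t) n +
        discreteConv lam (fun k => stateProb P N k t) ((n : ℤ) - 1)) t

/-- `N` is a convoluted Poisson process with intensities `lam`: the case `α = 1` (where the Caputo
derivative is `d/dt`), with right-continuous paths as for every counting process. -/
structure IsCPP (lam : ℤ → ℝ) (P : Measure Ω) (N : ℝ≥0 → Ω → ℕ) : Prop where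
  cfpp : IsCFPP lam 1 P N
  rightContinuous : ∀ᵐ ω ∂P, ∀ t : ℝ≥0, ContinuousWithinAt (fun s => N s ω) (Ici t) t

/-- The probability measures `u t`, `t ≥ 0`, on `ℝ` form a solution of the fractional diffusion
equation `∂_t^{2α} u = u_xx` with `u(·, 0) = δ`, and `∂_t u(·, 0) = 0` if `1/2 < α`, in the sense of
distributions in `x`: the conditions hold after pairing with test functions of `x`. -/
structure IsFracDiffusionSolution (α : ℝ) (u : ℝ≥0 → Measure ℝ) : Prop where
  isProb : ∀ t, IsProbabilityMeasure (u t)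
  init : u 0 = Measure.dirac 0
  init_deriv : 1 / 2 < α → ∀ φ : ℝ → ℝ, ContDiff ℝ (⊤ : ℕ∞) φ → HasCompactSupport φ →
    HasDerivWithinAt (fun t : ℝ => ∫ x, φ x ∂(u t.toNNReal)) 0 (Ici 0) 0
  regular : ∀ φ : ℝ → ℝ, ContDiff ℝ (⊤ : ℕ∞) φ → HasCompactSupport φ →
    CaputoRegular (2 * α) (fun t : ℝ => ∫ x, φ x ∂(u t.toNNReal))
  equation : ∀ φ : ℝ → ℝ, ContDiff ℝ (⊤ : ℕ∞) φ → HasCompactSupport φ → ∀ t : ℝ, 0 < t →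
    HasCaputoDerivAt (2 * α) (fun t : ℝ => ∫ x, φ x ∂(u t.toNNReal))
      (∫ x, iteratedDeriv 2 φ x ∂(u t.toNNReal)) t

/-- Folding at the origin: the image of `ν` under `x ↦ |x|`. If `ν` has an even density `u`, the
folded measure has density `2 u` on `(0, ∞)`. -/
noncomputable def foldedLaw (ν : Measure ℝ) : Measure ℝ := ν.map (fun x => |x|)

/-- `T` is a process `(T_{2α}(t))_{t > 0}`: the law of `T(t)` is the folded solution at time `t` of
the fractional diffusion equation of order `2α`. -/
def IsFoldedDiffusionTime (α : ℝ) (P : Measure Ω) (T : ℝ≥0 → Ω → ℝ≥0) : Prop :=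
  ∃ u : ℝ≥0 → Measure ℝ, IsFracDiffusionSolution α u ∧
    ∀ t : ℝ≥0, 0 < t → HasLaw (fun ω => (T t ω : ℝ)) (foldedLaw (u t)) P

/-- `D` is an `α`-stable subordinator, normalised by `E e^{-s D(x)} = e^{-x s^α}`: a Lévy process
with nondecreasing right-continuous paths and this Laplace transform. -/
structure IsStableSubordinator (α : ℝ) (P : Measure Ω) (D : ℝ≥0 → Ω → ℝ) : Prop where
  measurable : ∀ x, Measurable (D x)
  start : ∀ᵐ ω ∂P, D 0 ω = 0
  monotone : ∀ᵐ ω ∂P, Monotone (fun x => D x ω)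
  rightContinuous : ∀ᵐ ω ∂P, ∀ x : ℝ≥0, ContinuousWithinAt (fun y => D y ω) (Ici x) x
  indepIncrements : HasIndepIncrements D P
  stationary : ∀ x h : ℝ≥0, IdentDistrib (fun ω => D (x + h) ω - D x ω) (D h) P P
  laplace : ∀ (x : ℝ≥0) (s : ℝ), 0 < s →
    ∫ ω, Real.exp (-(s * D x ω)) ∂P = Real.exp (-((x : ℝ) * s ^ α))

/-- `H` is an inverse `α`-stable subordinator: `H(t) = inf {x ≥ 0 : D(x) > t}` for an `α`-stable
subordinator `D`. -/
def IsInverseStableSubordinator (α : ℝ) (P : Measure Ω) (H : ℝ≥0 → Ω → ℝ≥0) : Prop :=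
  ∃ D : ℝ≥0 → Ω → ℝ, IsStableSubordinator α P D ∧
    ∀ t : ℝ≥0, ∀ᵐ ω ∂P, H t ω = sInf {x : ℝ≥0 | (t : ℝ) < D x ω}

end Processes

/-!
Everything is compared through Laplace transforms in time. A function on `(0, ∞)` with absolutely
convergent Laplace integrals is determined almost everywhere by its transform, hence at each point
where it is right-continuous (`eq_of_laplace_eq`); and a Caputo equation `∂^β f = h` with `0 < β ≤ 2`
becomes, with `f'(0) = 0` if `1 < β`, the algebraic relation `f̂(s) = f(0) / s + s^{-β} ĥ(s)`
(`laplace_of_hasCaputoDerivAt`), because the Riemann--Liouville integral inverts the Caputo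
derivative.

*The folded solution.* For the measure `U = ∫_0^∞ e^{-st} u_t dt` the fractional diffusion equation
becomes the resolvent equation `s^{2α} U - s^{2α-1} δ_0 = U''`. Testing it with `cos (ξ x)` and
`sin (ξ x)` gives the characteristic function of `U`, so `U` has density
`(1/2) s^{α-1} e^{-s^α |x|}` (`IsFracDiffusionSolution.laplaceMix_eq`). Folding at the origin gives
the density `s^{α-1} e^{-x s^α}` on `(0, ∞)`.

*The inverse subordinator.* From `{H(t) > x} ⊆ {D(x) ≤ t} ⊆ {H(t) ≥ x}` and
`E e^{-sD(x)} = e^{-x s^α}`, the laws of `H(t)` have the same transform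
(`isInverseStableFamily_firstPassage`). Both families of laws are weakly right-continuous in `t`, so
they agree at every `t > 0` (`IsInverseStableFamily.eq`).

*The time change.* The transforms of the state probabilities of a convoluted fractional Poisson
process solve a triangular recursion which has a unique solution since `1 + s^{-α} λ_0 ≠ 0`. If
`q̂_n` are the transforms for order `1`, then `s^{α-1} q̂_n(s^α)` solves the recursion for order `α`,
and it is the transform of `t ↦ ∫ q_n dm_t` for a family `m` of laws as above
(`IsCFPP.stateProb_eq_integral`). By independence this integral is the state probability of the
convoluted Poisson process at the random time.

*The density.* For `α < 1` the transform `s^{α-1} e^{-x s^α}` is inverted by the integral of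
`π⁻¹ Im (z^{α-1} e^{tz - x z^α} dz)` along a ray `arg z = θ` with `π/2 < θ < π` and `α θ < π/2`, on
which the integrand decays exponentially. That this is the inverse transform is a residue
computation (`im_integral_exp_div`). Uniqueness of Laplace transforms, now against test functions
in `x`, identifies the integral as the density, and in particular shows that it is nonnegative.
-/

/-! ### Uniqueness of Laplace transforms -/

/-- The Laplace transform `∫_0^∞ e^{-st} f(t) dt` of a function on the half line. -/
noncomputable def laplace (f : ℝ → ℝ) (s : ℝ) : ℝ := ∫ t in Ioi (0 : ℝ), Real.exp (-(s * t)) * f t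

/-- The Laplace integral of `f` converges absolutely at every `s > 0`. -/
def LaplaceIntegrable (f : ℝ → ℝ) : Prop :=
  ∀ s : ℝ, 0 < s → IntegrableOn (fun t => Real.exp (-(s * t)) * f t) (Ioi 0)

/-- The moment generating functions extend analytically to a strip containing the imaginary axis,
so that agreement on a left half line forces the characteristic functions to agree. -/
lemma MeasureTheory.Measure.ext_of_mgf_eqOn_Iio {μ ν : Measure ℝ} [IsFiniteMeasure μ]
    [IsFiniteMeasure ν] {c : ℝ} (hc : 0 < c)
    (hμ : ∀ x < c, Integrable (fun t => Real.exp (x * t)) μ)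
    (hν : ∀ x < c, Integrable (fun t => Real.exp (x * t)) ν)
    (h : ∀ x < c, ∫ t, Real.exp (x * t) ∂μ = ∫ t, Real.exp (x * t) ∂ν) : μ = ν := by
  have key : ∀ ρ : Measure ℝ, (∀ x < c, Integrable (fun t => Real.exp (x * t)) ρ) →
      AnalyticOnNhd ℂ (complexMGF id ρ) {z | z.re ∈ Iio c} := by
    intro ρ hρ
    refine (analyticOnNhd_complexMGF (X := id) (μ := ρ)).mono fun z hz => ?_
    exact interior_maximal (fun x hx => hρ x hx) isOpen_Iio hz
  have heq : EqOn (complexMGF id μ) (complexMGF id ν) {z | z.re ∈ Iio c} := by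
    refine AnalyticOnNhd.eqOn_of_preconnected_of_frequently_eq (key μ hμ) (key ν hν)
      ((convex_Iio c).linear_preimage Complex.reLm).isPreconnected (z₀ := ((0 : ℝ) : ℂ))
      (by simpa using hc) ?_
    have hreal : ∀ x : ℝ, x < c → complexMGF id μ x = complexMGF id ν x := by
      intro x hx
      rw [complexMGF_ofReal, complexMGF_ofReal]
      simp only [mgf, id]
      rw [h x hx]
    have h1 : ∃ᶠ x : ℝ in 𝓝[≠] 0, complexMGF id μ x = complexMGF id ν x := by
      refine Eventually.frequently (eventually_nhdsWithin_of_eventually_nhds ?_)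
      filter_upwards [Iio_mem_nhds hc] with x hx using hreal x hx
    refine Tendsto.frequently (f := fun x : ℝ => (x : ℂ)) ?_ h1
    refine tendsto_nhdsWithin_iff.2 ⟨(Complex.continuous_ofReal.tendsto _).mono_left
      nhdsWithin_le_nhds, ?_⟩
    filter_upwards [self_mem_nhdsWithin] with x hx
    simpa using hx
  refine Measure.ext_of_charFun (funext fun t => ?_)
  rw [← complexMGF_id_mul_I, ← complexMGF_id_mul_I]
  exact heq (by simpa using hc)

/-- The positive and negative parts of `e^{-t} f(t)` are densities of finite measures with the same
moment generating function on `(-∞, 1)`. -/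
lemma ae_eq_zero_of_laplace_eq_zero {f : ℝ → ℝ} (hf : LaplaceIntegrable f)
    (h : ∀ s, 0 < s → laplace f s = 0) : f =ᵐ[volume.restrict (Ioi 0)] 0 := by
  set w : ℝ → ℝ := fun t => Real.exp (-t) * f t with hw
  have hwi : Integrable w (volume.restrict (Ioi 0)) := by
    simpa [IntegrableOn, hw] using hf 1 one_pos
  have hexp : ∀ x t : ℝ, Real.exp (x * t) * w t = Real.exp (-((1 - x) * t)) * f t := by
    intro x t
    rw [hw, ← mul_assoc, ← Real.exp_add]; ring_nf
  have hxi : ∀ x < 1, Integrable (fun t => Real.exp (x * t) * w t) (volume.restrict (Ioi 0)) := by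
    intro x hx
    simp_rw [hexp]
    exact hf _ (by linarith)
  have hx0 : ∀ x < 1, ∫ t in Ioi (0 : ℝ), Real.exp (x * t) * w t = 0 := by
    intro x hx
    simp_rw [hexp]
    exact h _ (by linarith)
  have hfin : ∀ v : ℝ → ℝ, Integrable v (volume.restrict (Ioi 0)) →
      IsFiniteMeasure ((volume.restrict (Ioi 0)).withDensity fun t => ENNReal.ofReal (v t)) :=
    fun v hv => isFiniteMeasure_withDensity_ofReal hv.2
  have hint : ∀ v : ℝ → ℝ, Integrable v (volume.restrict (Ioi 0)) →
      ∀ x, Integrable (fun t => Real.exp (x * t) * v t) (volume.restrict (Ioi 0)) →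
      Integrable (fun t => Real.exp (x * t))
        ((volume.restrict (Ioi 0)).withDensity fun t => ENNReal.ofReal (v t)) ∧
      ∫ t, Real.exp (x * t)
        ∂((volume.restrict (Ioi 0)).withDensity fun t => ENNReal.ofReal (v t)) =
        ∫ t in Ioi (0 : ℝ), Real.exp (x * t) * max (v t) 0 := by
    intro v hv x hx
    have hm : AEMeasurable (fun t => (v t).toNNReal) (volume.restrict (Ioi 0)) :=
      hv.aemeasurable.real_toNNReal
    have e : (fun t => (v t).toNNReal • Real.exp (x * t)) =
        fun t => Real.exp (x * t) * max (v t) 0 := by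
      funext t
      rw [NNReal.smul_def, smul_eq_mul, Real.coe_toNNReal', mul_comm]
    constructor
    · refine (integrable_withDensity_iff_integrable_smul₀ (f := fun t => (v t).toNNReal) hm).2 ?_
      rw [e]
      have := hx.pos_part
      refine this.congr (ae_of_all _ fun t => ?_)
      simp only
      rw [mul_max_of_nonneg _ _ (Real.exp_pos _).le, mul_zero]
    · have := integral_withDensity_eq_integral_smul₀ hm (fun t => Real.exp (x * t))
      rw [e] at this
      exact this
  have := hfin w hwi
  have := hfin _ hwi.neg
  have hneg : ∀ x < 1, Integrable (fun t => Real.exp (x * t) * (-w) t)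
      (volume.restrict (Ioi 0)) := by
    intro x hx
    simpa using (hxi x hx).neg
  have heq := Measure.ext_of_mgf_eqOn_Iio one_pos
    (fun x hx => (hint w hwi x (hxi x hx)).1)
    (fun x hx => (hint (-w) hwi.neg x (hneg x hx)).1) (by
      intro x hx
      have i1 : ∀ v : ℝ → ℝ, Integrable (fun t => Real.exp (x * t) * v t)
          (volume.restrict (Ioi 0)) →
          Integrable (fun t => Real.exp (x * t) * max (v t) 0) (volume.restrict (Ioi 0)) := by
        intro v hv
        refine hv.pos_part.congr (ae_of_all _ fun t => ?_)
        simp only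
        rw [mul_max_of_nonneg _ _ (Real.exp_pos _).le, mul_zero]
      rw [(hint w hwi x (hxi x hx)).2, (hint (-w) hwi.neg x (hneg x hx)).2, ← sub_eq_zero,
        ← integral_sub (i1 _ (hxi x hx)) (i1 _ (hneg x hx))]
      refine Eq.trans ?_ (hx0 x hx)
      refine integral_congr_ae (ae_of_all _ fun t => ?_)
      simp only [Pi.neg_apply]
      rw [← mul_sub]
      congr 1
      rcases le_total (w t) 0 with h | h
      · rw [max_eq_right h, max_eq_left (by linarith)]; ring
      · rw [max_eq_left h, max_eq_right (by linarith)]; ring)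
  have hae := (withDensity_eq_iff hwi.aemeasurable.ennreal_ofReal
    hwi.neg.aemeasurable.ennreal_ofReal
    (by
      have := measure_ne_top
        ((volume.restrict (Ioi 0)).withDensity fun t => ENNReal.ofReal (w t)) univ
      rwa [withDensity_apply _ MeasurableSet.univ, Measure.restrict_univ] at this)).1 heq
  filter_upwards [hae] with t ht
  have hw0 : w t = 0 := by
    simp only [Pi.neg_apply] at ht
    rcases lt_trichotomy (w t) 0 with h | h | h
    · rw [ENNReal.ofReal_of_nonpos h.le, eq_comm, ENNReal.ofReal_eq_zero] at ht
      linarith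
    · exact h
    · rw [ENNReal.ofReal_of_nonpos (by linarith : -w t ≤ 0), ENNReal.ofReal_eq_zero] at ht
      linarith
  simpa [hw, (Real.exp_pos _).ne'] using hw0

lemma ae_eq_of_laplace_eq {f g : ℝ → ℝ} (hf : LaplaceIntegrable f) (hg : LaplaceIntegrable g)
    (h : ∀ s, 0 < s → laplace f s = laplace g s) : f =ᵐ[volume.restrict (Ioi 0)] g := by
  have h0 := ae_eq_zero_of_laplace_eq_zero (f := fun t => f t - g t)
    (fun s hs => by
      refine ((hf s hs).sub (hg s hs)).congr (ae_of_all _ fun t => ?_)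
      simp only [Pi.sub_apply]
      ring)
    (fun s hs => by
      have := integral_sub (f := fun t => Real.exp (-(s * t)) * f t)
        (g := fun t => Real.exp (-(s * t)) * g t) (hf s hs) (hg s hs)
      have hfg := h s hs
      simp only [laplace] at hfg ⊢
      rw [hfg, sub_self] at this
      refine Eq.trans ?_ this
      refine integral_congr_ae (ae_of_all _ fun t => ?_)
      simp only
      ring)
  filter_upwards [h0] with t ht
  simpa [sub_eq_zero] using ht

/-- A property that holds almost everywhere on `(0, ∞)` holds on a sequence decreasing to `t`. -/
lemma frequently_nhdsGT_of_ae {p : ℝ → Prop} (h : ∀ᵐ r ∂volume.restrict (Ioi (0 : ℝ)), p r) {t : ℝ}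
    (ht : 0 ≤ t) : ∃ᶠ r in 𝓝[>] t, p r := by
  intro hn
  obtain ⟨b, hb, hsub⟩ := (mem_nhdsGT_iff_exists_Ioo_subset).1 hn
  rw [ae_restrict_iff' measurableSet_Ioi, ae_iff] at h
  have hle : volume (Ioo t b) ≤ 0 := by
    rw [← h]
    refine measure_mono fun r hr hp => hsub hr (hp (lt_of_le_of_lt ht hr.1))
  rw [Real.volume_Ioo, nonpos_iff_eq_zero, ENNReal.ofReal_eq_zero] at hle
  have := mem_Ioi.1 hb
  linarith

lemma eq_of_ae_eq_of_rightContinuous {f g : ℝ → ℝ}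
    (h : f =ᵐ[volume.restrict (Ioi 0)] g) {t : ℝ} (ht : 0 ≤ t)
    (hf : ContinuousWithinAt f (Ioi t) t) (hg : ContinuousWithinAt g (Ioi t) t) : f t = g t := by
  by_contra hne
  have h1 := (hf.tendsto.sub hg.tendsto).eventually_ne (sub_ne_zero.2 hne)
  refine frequently_nhdsGT_of_ae h ht ?_
  filter_upwards [h1] with r hr he
  exact hr (by rw [he, sub_self])

lemma eq_of_laplace_eq {f g : ℝ → ℝ} (hf : LaplaceIntegrable f) (hg : LaplaceIntegrable g)
    (h : ∀ s, 0 < s → laplace f s = laplace g s) {t : ℝ} (ht : 0 ≤ t)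
    (hfc : ContinuousWithinAt f (Ioi t) t) (hgc : ContinuousWithinAt g (Ioi t) t) : f t = g t :=
  eq_of_ae_eq_of_rightContinuous (ae_eq_of_laplace_eq hf hg h) ht hfc hgc

lemma integrableOn_exp_neg_mul_Ioi {s : ℝ} (hs : 0 < s) :
    IntegrableOn (fun t => Real.exp (-(s * t))) (Ioi 0) := by
  simpa using integrableOn_exp_mul_Ioi (neg_lt_zero.2 hs) 0

lemma laplaceIntegrable_of_bounded {f : ℝ → ℝ} {C : ℝ}
    (hf : AEStronglyMeasurable f (volume.restrict (Ioi 0))) (hC : ∀ t, 0 < t → |f t| ≤ C) :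
    LaplaceIntegrable f := by
  intro s hs
  refine Integrable.mul_bdd (c := C) (integrableOn_exp_neg_mul_Ioi hs) hf ?_
  filter_upwards [ae_restrict_mem measurableSet_Ioi] with t ht using hC t ht

/-! ### Caputo equations under the Laplace transform -/

/-- The kernel `t^(γ-1) / Γ(γ)` of the Riemann--Liouville integral of order `γ`. -/
noncomputable def fracKernel (γ t : ℝ) : ℝ := t ^ (γ - 1) / Real.Gamma γ

/-- The Riemann--Liouville integral of order `γ` of `h`. -/
noncomputable def fracIntegral (γ : ℝ) (h : ℝ → ℝ) (t : ℝ) : ℝ :=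
  ∫ r in (0 : ℝ)..t, fracKernel γ r * h (t - r)

lemma measurable_fracKernel (γ : ℝ) : Measurable (fracKernel γ) := by
  unfold fracKernel; fun_prop

lemma laplaceIntegrable_fracKernel {γ : ℝ} (hγ : 0 < γ) : LaplaceIntegrable (fracKernel γ) := by
  intro s hs
  have h := (integrable_of_integral_eq_one (μ := volume.restrict (Ioi 0))
    (f := fun t => ((1 / s) ^ γ * Real.Gamma γ)⁻¹ * (t ^ (γ - 1) * Real.exp (-(s * t)))) (by
      rw [integral_const_mul, Real.integral_rpow_mul_exp_neg_mul_Ioi hγ hs, inv_mul_cancel₀]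
      have := Real.Gamma_pos_of_pos hγ
      positivity)).const_mul ((1 / s) ^ γ)
  refine h.congr (ae_of_all _ fun t => ?_)
  have := (Real.Gamma_pos_of_pos hγ).ne'
  have : (1 / s) ^ γ ≠ 0 := by positivity
  simp only [fracKernel]
  field_simp

lemma laplace_fracKernel {γ s : ℝ} (hγ : 0 < γ) (hs : 0 < s) :
    laplace (fracKernel γ) s = s ^ (-γ) := by
  have h := Real.integral_rpow_mul_exp_neg_mul_Ioi hγ hs
  have hG := (Real.Gamma_pos_of_pos hγ).ne'
  have e : ∀ t : ℝ, Real.exp (-(s * t)) * fracKernel γ t =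
      t ^ (γ - 1) * Real.exp (-(s * t)) / Real.Gamma γ := by
    intro t; simp only [fracKernel]; ring
  simp only [laplace, e]
  rw [integral_div, h, mul_div_cancel_right₀ _ hG, one_div, Real.inv_rpow hs.le,
    Real.rpow_neg hs.le]

lemma laplace_fracIntegral {γ : ℝ} {h : ℝ → ℝ} (hγ : 0 < γ) (hh : LaplaceIntegrable h) :
    LaplaceIntegrable (fracIntegral γ h) ∧
      ∀ s, 0 < s → laplace (fracIntegral γ h) s = s ^ (-γ) * laplace h s := by
  have e : ∀ s t : ℝ, Real.exp (-(s * t)) * fracIntegral γ h t = ∫ r in (0 : ℝ)..t,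
      ContinuousLinearMap.mul ℝ ℝ (Real.exp (-(s * r)) * fracKernel γ r)
        (Real.exp (-(s * (t - r))) * h (t - r)) := by
    intro s t
    rw [fracIntegral, ← intervalIntegral.integral_const_mul]
    congr 1
    funext r
    have : Real.exp (-(s * t)) = Real.exp (-(s * r)) * Real.exp (-(s * (t - r))) := by
      rw [← Real.exp_add]; ring_nf
    rw [this, ContinuousLinearMap.mul_apply']
    ring
  constructor
  · intro s hs
    have h1 := integrable_posConvolution (laplaceIntegrable_fracKernel hγ s hs) (hh s hs)
      (ContinuousLinearMap.mul ℝ ℝ)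
    refine (h1.integrableOn (s := Ioi 0)).congr_fun (fun t ht => ?_) measurableSet_Ioi
    rw [posConvolution, indicator_of_mem ht]
    exact (e s t).symm
  · intro s hs
    simp only [laplace, e]
    rw [integral_posConvolution (laplaceIntegrable_fracKernel hγ s hs) (hh s hs),
      ContinuousLinearMap.mul_apply', ← laplace_fracKernel hγ hs]
    rfl

lemma laplace_const_add_fracIntegral {γ c : ℝ} {F h : ℝ → ℝ} (hγ : 0 < γ)
    (hh : LaplaceIntegrable h) (hF : ∀ t, 0 < t → F t = c + fracIntegral γ h t) :
    LaplaceIntegrable F ∧ ∀ s, 0 < s → laplace F s = c / s + s ^ (-γ) * laplace h s := by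
  obtain ⟨h1, h2⟩ := laplace_fracIntegral hγ hh
  have e : ∀ s t : ℝ, 0 < t → Real.exp (-(s * t)) * c + Real.exp (-(s * t)) * fracIntegral γ h t =
      Real.exp (-(s * t)) * F t := by
    intro s t ht
    rw [hF t ht]; ring
  constructor
  · intro s hs
    refine IntegrableOn.congr_fun (IntegrableOn.add
      (Integrable.mul_const (integrableOn_exp_neg_mul_Ioi hs) c) (h1 s hs))
      (fun t ht => e s t ht) measurableSet_Ioi
  · intro s hs
    rw [← h2 s hs]
    have := integral_add ((integrableOn_exp_neg_mul_Ioi hs).mul_const c) (h1 s hs)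
    rw [integral_mul_const] at this
    have h3 : ∫ t in Ioi (0 : ℝ), Real.exp (-(s * t)) = 1 / s := by
      have := integral_exp_mul_Ioi (neg_lt_zero.2 hs) 0
      simpa [neg_div_neg_eq] using this
    rw [h3] at this
    rw [laplace, laplace, div_eq_mul_one_div c s, mul_comm c, ← this]
    exact setIntegral_congr_fun measurableSet_Ioi fun t ht => (e s t ht).symm

/-- The semigroup relation `k_γ * k_{1-γ} = 1` between the Riemann--Liouville kernels, which is
the Beta integral. -/
lemma integral_fracKernel_mul_fracKernel {γ s t : ℝ} (h0 : 0 < γ) (h1 : γ < 1) (hst : s < t) :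
    ∫ r in s..t, fracKernel γ (t - r) * fracKernel (1 - γ) (r - s) = 1 := by
  have hG : Real.Gamma γ * Real.Gamma (1 - γ) ≠ 0 :=
    (mul_pos (Real.Gamma_pos_of_pos h0) (Real.Gamma_pos_of_pos (by linarith))).ne'
  have ha : 0 < t - s := by linarith
  have hB := Complex.betaIntegral_scaled ((1 - γ : ℝ) : ℂ) ((γ : ℝ) : ℂ) ha
  have hGG := Complex.Gamma_mul_Gamma_eq_betaIntegral (s := ((1 - γ : ℝ) : ℂ)) (t := ((γ : ℝ) : ℂ))
    (by simpa using h1) (by simpa using h0)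
  have e1 : ((1 - γ : ℝ) : ℂ) + (γ : ℂ) = 1 := by push_cast; ring
  rw [e1, Complex.Gamma_one, one_mul] at hGG
  rw [e1, sub_self, Complex.cpow_zero, one_mul, ← hGG, Complex.Gamma_ofReal,
    Complex.Gamma_ofReal] at hB
  have hR : ∫ x in (0 : ℝ)..(t - s), x ^ ((1 - γ) - 1) * ((t - s) - x) ^ (γ - 1) =
      Real.Gamma (1 - γ) * Real.Gamma γ := by
    have : ((∫ x in (0 : ℝ)..(t - s), x ^ ((1 - γ) - 1) * ((t - s) - x) ^ (γ - 1) : ℝ) : ℂ) =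
        ((Real.Gamma (1 - γ) * Real.Gamma γ : ℝ) : ℂ) := by
      rw [← intervalIntegral.integral_ofReal, Complex.ofReal_mul, ← hB]
      refine intervalIntegral.integral_congr fun x hx => ?_
      rw [uIcc_of_le ha.le] at hx
      rw [Complex.ofReal_mul, Complex.ofReal_cpow hx.1, Complex.ofReal_cpow (by linarith [hx.2])]
      push_cast
      rfl
    exact_mod_cast this
  have hsub := intervalIntegral.integral_comp_sub_right (a := s) (b := t)
    (fun x => x ^ ((1 - γ) - 1) * ((t - s) - x) ^ (γ - 1)) s
  rw [sub_self, hR] at hsub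
  have e2 : ∀ r : ℝ, fracKernel γ (t - r) * fracKernel (1 - γ) (r - s) =
      ((r - s) ^ ((1 - γ) - 1) * ((t - s) - (r - s)) ^ (γ - 1)) /
        (Real.Gamma γ * Real.Gamma (1 - γ)) := by
    intro r
    have : (t - s) - (r - s) = t - r := by ring
    rw [this]
    simp only [fracKernel]
    ring
  simp only [e2]
  rw [intervalIntegral.integral_div, hsub, mul_comm, div_self hG]

/-- The fractional integral of order `γ` inverts the Caputo-type convolution `k_{1-γ} * G`, by
Fubini on the triangle `0 < s < r < t`. -/
lemma fracIntegral_of_caputo {γ t : ℝ} {G h : ℝ → ℝ} (h0 : 0 < γ) (h1 : γ < 1) (ht : 0 < t)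
    (hG : IntervalIntegrable G volume 0 t)
    (hh : ∀ r, 0 < r → ∫ s in (0 : ℝ)..r, fracKernel (1 - γ) (r - s) * G s = h r) :
    fracIntegral γ h t = ∫ s in (0 : ℝ)..t, G s := by
  have hGi : Integrable G (volume.restrict (Ioc 0 t)) :=
    (intervalIntegrable_iff_integrableOn_Ioc_of_le ht.le).1 hG
  have hkp : ∀ γ' : ℝ, 0 < γ' → ∀ x : ℝ, 0 ≤ x → 0 ≤ fracKernel γ' x := fun γ' hγ' x hx =>
    div_nonneg (Real.rpow_nonneg hx _) (Real.Gamma_pos_of_pos hγ').le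
  set K : ℝ → ℝ → ℝ := fun s r =>
    (Ioi s).indicator (fun r => fracKernel γ (t - r) * fracKernel (1 - γ) (r - s)) r with hK
  have hKmeas : Measurable (fun p : ℝ × ℝ => K p.1 p.2) := by
    have : (fun p : ℝ × ℝ => K p.1 p.2) = {p : ℝ × ℝ | p.1 < p.2}.indicator
        (fun p => fracKernel γ (t - p.2) * fracKernel (1 - γ) (p.2 - p.1)) := by
      funext p
      by_cases hp : p.1 < p.2
      · rw [indicator_of_mem (show p ∈ {p : ℝ × ℝ | p.1 < p.2} from hp), hK]
        exact indicator_of_mem (s := Ioi p.1) hp _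
      · rw [indicator_of_notMem (show p ∉ {p : ℝ × ℝ | p.1 < p.2} from hp), hK]
        exact indicator_of_notMem (s := Ioi p.1) hp _
    rw [this]
    refine Measurable.indicator ?_ (measurableSet_lt measurable_fst measurable_snd)
    exact ((measurable_fracKernel γ).comp (by fun_prop)).mul
      ((measurable_fracKernel _).comp (by fun_prop))
  have hKnn : ∀ s, ∀ r ∈ Ioc 0 t, 0 ≤ K s r := by
    intro s r hr
    refine indicator_apply_nonneg fun hsr => ?_
    exact mul_nonneg (hkp γ h0 _ (by linarith [hr.2])) (hkp _ (by linarith) _ (by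
      have := mem_Ioi.1 hsr; linarith))
  have hKint : ∀ s ∈ Ico 0 t, ∫ r in Ioc 0 t, K s r = 1 := by
    intro s hs
    rw [hK, setIntegral_indicator measurableSet_Ioi,
      show Ioc 0 t ∩ Ioi s = Ioc s t by
        ext r; simp only [mem_inter_iff, mem_Ioc, mem_Ioi]
        exact ⟨fun h => ⟨h.2, h.1.2⟩, fun h => ⟨⟨by linarith [hs.1], h.2⟩, h.1⟩⟩,
      ← intervalIntegral.integral_of_le hs.2.le]
    exact integral_fracKernel_mul_fracKernel h0 h1 hs.2
  have hae : ∀ᵐ s ∂volume.restrict (Ioc 0 t), s ∈ Ico 0 t := by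
    have : ∀ᵐ s ∂(volume : Measure ℝ), s ≠ t := by simp [ae_iff, measure_singleton]
    filter_upwards [ae_restrict_mem measurableSet_Ioc, ae_restrict_of_ae this] with s hs hst
    exact ⟨hs.1.le, lt_of_le_of_ne hs.2 hst⟩
  have hprod : Integrable (fun p : ℝ × ℝ => K p.1 p.2 * G p.1)
      ((volume.restrict (Ioc 0 t)).prod (volume.restrict (Ioc 0 t))) := by
    have hm : AEStronglyMeasurable (fun p : ℝ × ℝ => K p.1 p.2 * G p.1)
        ((volume.restrict (Ioc 0 t)).prod (volume.restrict (Ioc 0 t))) :=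
      hKmeas.aestronglyMeasurable.mul hGi.aestronglyMeasurable.comp_fst
    refine (integrable_prod_iff hm).2 ⟨?_, ?_⟩
    · filter_upwards [hae] with s hs
      exact (integrable_of_integral_eq_one (hKint s hs)).mul_const _
    · refine hGi.norm.congr ?_
      filter_upwards [hae] with s hs
      have : ∀ r ∈ Ioc 0 t, ‖K s r * G s‖ = K s r * ‖G s‖ := fun r hr => by
        rw [norm_mul, Real.norm_of_nonneg (hKnn s r hr)]
      rw [setIntegral_congr_fun measurableSet_Ioc this, integral_mul_const, hKint s hs, one_mul]
  have hswap := integral_integral_swap (f := fun s r => K s r * G s) hprod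
  have hL : ∫ s in Ioc 0 t, ∫ r in Ioc 0 t, K s r * G s = ∫ s in (0 : ℝ)..t, G s := by
    rw [intervalIntegral.integral_of_le ht.le]
    refine integral_congr_ae ?_
    filter_upwards [hae] with s hs
    rw [integral_mul_const, hKint s hs, one_mul]
  rw [← hL, hswap, fracIntegral]
  have hflip := intervalIntegral.integral_comp_sub_left (a := 0) (b := t)
    (fun r => fracKernel γ r * h (t - r)) t
  rw [sub_self, sub_zero] at hflip
  rw [← hflip, intervalIntegral.integral_of_le ht.le]
  refine setIntegral_congr_fun measurableSet_Ioc fun r hr => ?_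
  simp only [sub_sub_cancel]
  rw [← hh r hr.1, ← intervalIntegral.integral_const_mul, intervalIntegral.integral_of_le hr.1.le]
  have e3 : ∀ s, K s r * G s = (Iio r).indicator
      (fun s => fracKernel γ (t - r) * (fracKernel (1 - γ) (r - s) * G s)) s := by
    intro s
    by_cases hs : s < r
    · rw [indicator_of_mem (mem_Iio.2 hs), hK]
      simp only
      rw [indicator_of_mem (mem_Ioi.2 hs)]
      ring
    · rw [indicator_of_notMem (by simpa using hs), hK]
      simp only
      rw [indicator_of_notMem (by simpa using hs), zero_mul]
  simp only [e3]
  rw [setIntegral_indicator measurableSet_Iio, integral_Ioc_eq_integral_Ioo]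
  congr 2
  ext s
  simp only [mem_inter_iff, mem_Ioc, mem_Iio, mem_Ioo]
  exact ⟨fun h => ⟨⟨h.1, by linarith [hr.2, h.2]⟩, h.2⟩, fun h => ⟨h.1.1, h.2⟩⟩

lemma eq_add_fracIntegral_one {F h : ℝ → ℝ} (hF : ContinuousOn F (Ici 0))
    (hh : ContinuousOn h (Ici 0)) (hd : ∀ t, 0 < t → HasDerivAt F (h t) t) {t : ℝ} (ht : 0 < t) :
    F t = F 0 + fracIntegral 1 h t := by
  have h1 := intervalIntegral.integral_eq_sub_of_hasDerivAt_of_le ht.le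
    (hF.mono Icc_subset_Ici_self) (fun x hx => hd x hx.1)
    ((hh.mono (by rw [uIcc_of_le ht.le]; exact Icc_subset_Ici_self)).intervalIntegrable)
  have h2 : fracIntegral 1 h t = ∫ r in (0 : ℝ)..t, h (t - r) := by
    simp [fracIntegral, fracKernel]
  rw [h2, intervalIntegral.integral_comp_sub_left (fun x => h x) t, sub_self, sub_zero, h1]
  ring

/-- One fractional step of order `γ = β - k ∈ (0, 1]`, where `k + 1 = ⌈β⌉`: the Caputo equation
for `f` expresses `f^(k)` through the Riemann--Liouville integral of its right-hand side. -/
lemma iteratedDerivWithin_eq_fracIntegral {β : ℝ} {k : ℕ} {f h : ℝ → ℝ} (hk : ⌈β⌉₊ = k + 1)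
    (hreg : CaputoRegular β f) (hder : ∀ t, 0 < t → HasCaputoDerivAt β f (h t) t)
    (hh : ContinuousOn h (Ici 0)) {t : ℝ} (ht : 0 < t) :
    iteratedDerivWithin k f (Ici 0) t =
      iteratedDerivWithin k f (Ici 0) 0 + fracIntegral (β - k) h t := by
  have hβ : (k : ℝ) < β ∧ β ≤ k + 1 := by
    have h1 := Nat.le_ceil β
    have h2 := (Nat.lt_ceil (n := k) (a := β)).1 (by omega)
    rw [hk] at h1
    push_cast at h1
    exact ⟨h2, h1⟩
  obtain ⟨-, hac⟩ := hreg
  simp only [HasCaputoDerivAt, hk, Nat.add_sub_cancel] at hac hder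
  set F := iteratedDerivWithin k f (Ici 0) with hFdef
  rcases eq_or_lt_of_le hβ.2 with heq | hlt
  · have e : β - k = 1 := by rw [heq]; ring
    rw [e]
    refine eq_add_fracIntegral_one ?_ hh (fun r hr => ?_) ht
    · intro r hr
      have hr : (0 : ℝ) ≤ r := hr
      have h3 := (hac (r + 1) (by linarith)).continuousOn
      rw [uIcc_of_le (by linarith : (0 : ℝ) ≤ r + 1)] at h3
      refine (h3 r ⟨hr, by linarith⟩).mono_of_mem_nhdsWithin ?_
      rw [← Ici_inter_Iic]
      exact inter_mem self_mem_nhdsWithin (mem_nhdsWithin_of_mem_nhds (Iic_mem_nhds (by linarith)))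
    · exact ((hder r hr).1 (by rw [heq]; push_cast; ring)).hasDerivAt (Ici_mem_nhds hr)
  · have hne : ((k + 1 : ℕ) : ℝ) ≠ β := by push_cast; exact hlt.ne'
    have hac' := hac t ht
    rw [← sub_eq_iff_eq_add', ← hac'.integral_deriv_eq_sub]
    refine (fracIntegral_of_caputo (by linarith [hβ.1]) (by linarith) ht
      hac'.intervalIntegrable_deriv fun r hr => ?_).symm
    rw [← ((hder r hr).2 hne).2, ← intervalIntegral.integral_const_mul,
      intervalIntegral.integral_of_le hr.le, intervalIntegral.integral_of_le hr.le]
    refine setIntegral_congr_fun measurableSet_Ioc fun s hs => ?_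
    rw [iteratedDerivWithin_succ, ← hFdef, derivWithin_of_mem_nhds (Ici_mem_nhds hs.1), fracKernel]
    push_cast
    rw [show 1 - (β - (k : ℝ)) = k + 1 - β by ring]
    ring

/-- The Laplace transform turns a Caputo equation of order `β ∈ (0, 2]` into an algebraic one. -/
theorem laplace_of_hasCaputoDerivAt {β : ℝ} {f h : ℝ → ℝ} (hβ0 : 0 < β) (hβ2 : β ≤ 2)
    (hreg : CaputoRegular β f) (hder : ∀ t, 0 < t → HasCaputoDerivAt β f (h t) t)
    (hder0 : 1 < β → HasDerivWithinAt f 0 (Ici 0) 0)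
    (hh : ContinuousOn h (Ici 0)) (hhL : LaplaceIntegrable h) {s : ℝ} (hs : 0 < s) :
    laplace f s = f 0 / s + s ^ (-β) * laplace h s := by
  rcases le_or_gt β 1 with h1 | h1
  · have hk : ⌈β⌉₊ = 0 + 1 := by
      rw [Nat.ceil_eq_iff (by norm_num)]; simpa using ⟨hβ0, h1⟩
    refine (laplace_const_add_fracIntegral hβ0 hhL fun t ht => ?_).2 s hs
    simpa using iteratedDerivWithin_eq_fracIntegral hk hreg hder hh ht
  · have hk : ⌈β⌉₊ = 1 + 1 := by
      rw [Nat.ceil_eq_iff (by norm_num)]; simpa using ⟨h1, by linarith⟩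
    have hC1 : ContDiffOn ℝ 1 f (Ici 0) := by
      have := hreg.1
      rw [hk] at this
      exact this
    have hd0 : iteratedDerivWithin 1 f (Ici 0) 0 = 0 := by
      rw [iteratedDerivWithin_one]
      exact (hder0 h1).derivWithin (uniqueDiffOn_Ici 0 0 self_mem_Ici)
    have hstep := laplace_const_add_fracIntegral (γ := β - (1 : ℕ)) (by push_cast; linarith) hhL
      (fun t ht => iteratedDerivWithin_eq_fracIntegral hk hreg hder hh ht)
    rw [hd0] at hstep
    have hc : ContinuousOn (iteratedDerivWithin 1 f (Ici 0)) (Ici 0) :=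
      hC1.continuousOn_iteratedDerivWithin (by norm_num) (uniqueDiffOn_Ici 0)
    have hlast := laplace_const_add_fracIntegral one_pos hstep.1
      (fun t ht => eq_add_fracIntegral_one hC1.continuousOn hc (fun r hr => by
        rw [iteratedDerivWithin_one]
        exact ((hC1.differentiableOn (by norm_num) r hr.le).hasDerivWithinAt).hasDerivAt
          (Ici_mem_nhds hr)) ht)
    rw [hlast.2 s hs, hstep.2 s hs]
    have : s ^ (-β) = s ^ (-1 : ℝ) * s ^ (-(β - (1 : ℕ))) := by
      rw [← Real.rpow_add hs]; congr 1; push_cast; ring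
    rw [this]
    ring

/-! ### Families of laws and their Laplace transforms in time -/

/-- The finite measure `∫_0^∞ e^{-st} m_t dt`, the Laplace transform in time of a family of
measures. -/
noncomputable def laplaceMix (s : ℝ) (m : ℝ → Measure ℝ) : Measure ℝ :=
  ((volume.restrict (Ioi (0 : ℝ))).withDensity fun t => ENNReal.ofReal (Real.exp (-(s * t)))).bind m

lemma isFiniteMeasure_expDensity {s : ℝ} (hs : 0 < s) :
    IsFiniteMeasure ((volume.restrict (Ioi (0 : ℝ))).withDensity fun t =>
      ENNReal.ofReal (Real.exp (-(s * t)))) :=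
  isFiniteMeasure_withDensity_ofReal (integrableOn_exp_neg_mul_Ioi hs).2

lemma laplaceMix_apply {m : ℝ → Measure ℝ} (hm : Measurable m) (s : ℝ) {A : Set ℝ}
    (hA : MeasurableSet A) :
    laplaceMix s m A = ∫⁻ t in Ioi (0 : ℝ), ENNReal.ofReal (Real.exp (-(s * t))) * m t A := by
  rw [laplaceMix, Measure.bind_apply hA hm.aemeasurable,
    lintegral_withDensity_eq_lintegral_mul _ (by fun_prop) (g := fun t => m t A)
      ((Measure.measurable_coe hA).comp hm)]
  rfl

lemma isFiniteMeasure_laplaceMix {m : ℝ → Measure ℝ} (hm : Measurable m)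
    (hp : ∀ t, IsProbabilityMeasure (m t)) {s : ℝ} (hs : 0 < s) :
    IsFiniteMeasure (laplaceMix s m) := by
  refine ⟨?_⟩
  rw [laplaceMix_apply hm s MeasurableSet.univ]
  simp only [measure_univ, mul_one]
  have := (isFiniteMeasure_expDensity hs).measure_univ_lt_top
  rwa [withDensity_apply _ MeasurableSet.univ, Measure.restrict_univ] at this

lemma integral_expDensity (s : ℝ) (g : ℝ → ℝ) :
    ∫ t, g t ∂((volume.restrict (Ioi (0 : ℝ))).withDensity fun t =>
      ENNReal.ofReal (Real.exp (-(s * t)))) = laplace g s := by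
  rw [laplace]
  have := integral_withDensity_eq_integral_smul (μ := volume.restrict (Ioi (0 : ℝ)))
    (f := fun t => (Real.exp (-(s * t))).toNNReal) (by fun_prop) g
  refine Eq.trans this (integral_congr_ae (ae_of_all _ fun t => ?_))
  simp only [NNReal.smul_def, smul_eq_mul, Real.coe_toNNReal _ (Real.exp_pos _).le]

lemma integrable_of_bounded_measurable {X : Type*} [MeasurableSpace X] {μ : Measure X}
    [IsFiniteMeasure μ] {ψ : X → ℝ} (hψ : Measurable ψ) {C : ℝ} (hC : ∀ x, |ψ x| ≤ C) :
    Integrable ψ μ :=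
  Integrable.of_bound hψ.aestronglyMeasurable C (ae_of_all _ hC)

lemma integral_laplaceMix {m : ℝ → Measure ℝ} (hm : Measurable m)
    (hp : ∀ t, IsProbabilityMeasure (m t)) {s : ℝ} (hs : 0 < s) {ψ : ℝ → ℝ} (hψ : Measurable ψ)
    {C : ℝ} (hC : ∀ x, |ψ x| ≤ C) :
    ∫ x, ψ x ∂(laplaceMix s m) = laplace (fun t => ∫ x, ψ x ∂(m t)) s := by
  have := isFiniteMeasure_laplaceMix hm hp hs
  have := isFiniteMeasure_expDensity hs
  let η : Kernel ℝ ℝ := ⟨m, hm⟩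
  have hη : IsMarkovKernel η := ⟨fun t => hp t⟩
  have he : (η ∘ₖ Kernel.const Unit ((volume.restrict (Ioi (0 : ℝ))).withDensity fun t =>
      ENNReal.ofReal (Real.exp (-(s * t))))) () = laplaceMix s m := by
    rw [Kernel.comp_apply, Kernel.const_apply]; rfl
  have hi : Integrable ψ ((η ∘ₖ Kernel.const Unit ((volume.restrict (Ioi (0 : ℝ))).withDensity
      fun t => ENNReal.ofReal (Real.exp (-(s * t))))) ()) := by
    rw [he]; exact integrable_of_bounded_measurable hψ hC
  have := Kernel.integral_comp hi
  rw [he, Kernel.const_apply, integral_expDensity] at this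
  exact this

lemma abs_integral_le_of_bounded {X : Type*} [MeasurableSpace X] {μ : Measure X}
    [IsProbabilityMeasure μ] {ψ : X → ℝ} {C : ℝ} (hC : ∀ x, |ψ x| ≤ C) : |∫ x, ψ x ∂μ| ≤ C := by
  have := norm_integral_le_of_norm_le_const (μ := μ) (f := ψ) (C := C) (ae_of_all _ hC)
  simpa using this

lemma laplaceIntegrable_integral {m : ℝ → Measure ℝ} (hm : Measurable m)
    (hp : ∀ t, IsProbabilityMeasure (m t)) {ψ : ℝ → ℝ} (hψ : Measurable ψ)
    {C : ℝ} (hC : ∀ x, |ψ x| ≤ C) : LaplaceIntegrable fun t => ∫ x, ψ x ∂(m t) := by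
  let η : Kernel ℝ ℝ := ⟨m, hm⟩
  have hη : IsMarkovKernel η := ⟨fun t => hp t⟩
  refine laplaceIntegrable_of_bounded (C := C) ?_ fun t _ => abs_integral_le_of_bounded hC
  exact (StronglyMeasurable.integral_kernel (κ := η) hψ.stronglyMeasurable).aestronglyMeasurable

/-- The one-dimensional laws of an inverse `α`-stable subordinator, characterised by their Laplace
transform in time together with right-continuity of `t ↦ m_t` in the weak topology. -/
structure IsInverseStableFamily (α : ℝ) (m : ℝ → Measure ℝ) : Prop where
  isProb : ∀ t, IsProbabilityMeasure (m t)
  measurable : Measurable m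
  rightContinuous : ∀ ψ : ℝ → ℝ, Continuous ψ → (∃ C, ∀ x, |ψ x| ≤ C) → ∀ t, 0 < t →
    ContinuousWithinAt (fun t => ∫ x, ψ x ∂(m t)) (Ioi t) t
  laplace : ∀ s, 0 < s → laplaceMix s m = (volume.restrict (Ioi 0)).withDensity
    fun x => ENNReal.ofReal (s ^ (α - 1) * Real.exp (-(x * s ^ α)))

namespace IsInverseStableFamily

variable {α : ℝ} {m m' : ℝ → Measure ℝ}

lemma laplace_integral (hm : IsInverseStableFamily α m) {ψ : ℝ → ℝ} (hψ : Measurable ψ) {C : ℝ}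
    (hC : ∀ x, |ψ x| ≤ C) {s : ℝ} (hs : 0 < s) :
    _root_.laplace (fun t => ∫ x, ψ x ∂(m t)) s =
      s ^ (α - 1) * _root_.laplace ψ (s ^ α) := by
  rw [← integral_laplaceMix hm.measurable hm.isProb hs hψ hC, hm.laplace s hs, _root_.laplace,
    ← integral_const_mul]
  have := integral_withDensity_eq_integral_smul (μ := volume.restrict (Ioi (0 : ℝ)))
    (f := fun x => (s ^ (α - 1) * Real.exp (-(x * s ^ α))).toNNReal) (by fun_prop) ψ
  refine Eq.trans this (integral_congr_ae (ae_of_all _ fun t => ?_))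
  have h0 : 0 ≤ s ^ (α - 1) * Real.exp (-(t * s ^ α)) := by positivity
  simp only [NNReal.smul_def, smul_eq_mul, Real.coe_toNNReal _ h0]
  rw [mul_comm t, mul_assoc]

/-- Inverse stable families of the same order have the same laws at every positive time. -/
lemma eq (hm : IsInverseStableFamily α m) (hm' : IsInverseStableFamily α m') {t : ℝ}
    (ht : 0 < t) : m t = m' t := by
  have := hm.isProb t
  have := hm'.isProb t
  refine ext_of_forall_integral_eq_of_IsFiniteMeasure fun ψ => ?_
  have hb : ∀ x, |ψ x| ≤ ‖ψ‖ := fun x => ψ.norm_coe_le_norm x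
  have hmeas := ψ.continuous.measurable
  exact eq_of_laplace_eq (f := fun t => ∫ x, ψ x ∂(m t)) (g := fun t => ∫ x, ψ x ∂(m' t))
    (laplaceIntegrable_integral hm.measurable hm.isProb hmeas hb)
    (laplaceIntegrable_integral hm'.measurable hm'.isProb hmeas hb)
    (fun s hs => by rw [hm.laplace_integral hmeas hb hs, hm'.laplace_integral hmeas hb hs])
    ht.le (hm.rightContinuous ψ ψ.continuous ⟨_, hb⟩ t ht)
    (hm'.rightContinuous ψ ψ.continuous ⟨_, hb⟩ t ht)

end IsInverseStableFamily

/-- Smooth cutoffs: a test function between the indicators of a compact set and of a given open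
neighbourhood. -/
lemma exists_testFunction_one_on_compact {K G : Set ℝ} (hK : IsCompact K) (hG : IsOpen G)
    (hKG : K ⊆ G) : ∃ φ : ℝ → ℝ, ContDiff ℝ (⊤ : ℕ∞) φ ∧ HasCompactSupport φ ∧
      (∀ x ∈ K, φ x = 1) ∧ (∀ x, x ∉ G → φ x = 0) ∧ ∀ x, φ x ∈ Icc (0 : ℝ) 1 := by
  obtain ⟨L, hL, hKL, hLG⟩ := exists_compact_between hK hG hKG
  obtain ⟨f, h1, h0, h01⟩ := exists_contMDiffMap_one_nhds_of_subset_interior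
    (n := (⊤ : ℕ∞)) (modelWithCornersSelf ℝ ℝ) hK.isClosed hKL
  exact ⟨f, f.contMDiff.contDiff, HasCompactSupport.intro hL h0,
    fun x hx => h1.self_of_nhdsSet x hx, fun x hx => h0 x fun h => hx (hLG h), h01⟩

/-- The mass of an open set is a supremum of integrals of test functions. -/
lemma lowerSemicontinuous_apply_of_vague {v : ℝ → Measure ℝ} (hp : ∀ t, IsProbabilityMeasure (v t))
    (hv : ∀ φ : ℝ → ℝ, ContDiff ℝ (⊤ : ℕ∞) φ → HasCompactSupport φ →
      Continuous fun t => ∫ x, φ x ∂(v t))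
    {G : Set ℝ} (hG : IsOpen G) :
    LowerSemicontinuous fun t => v t G := by
  intro t₀ r hr
  obtain ⟨K, hKG, hK, hrK⟩ := hG.exists_lt_isCompact (μ := v t₀) hr
  obtain ⟨φ, hφ, hφc, h1, h0, h01⟩ := exists_testFunction_one_on_compact hK hG hKG
  have hbd : ∀ x, |φ x| ≤ 1 := fun x => abs_le.2 ⟨by linarith [(h01 x).1], (h01 x).2⟩
  have hm := hφ.continuous.measurable
  have hlow : v t₀ K ≤ ENNReal.ofReal (∫ x, φ x ∂(v t₀)) := by
    rw [ofReal_integral_eq_lintegral_ofReal (integrable_of_bounded_measurable hm hbd)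
      (ae_of_all _ fun x => (h01 x).1), ← lintegral_indicator_one hK.measurableSet]
    refine lintegral_mono fun x => ?_
    by_cases hx : x ∈ K
    · simp [hx, h1 x hx]
    · simp [hx]
  have hup : ∀ t, ENNReal.ofReal (∫ x, φ x ∂(v t)) ≤ v t G := by
    intro t
    rw [ofReal_integral_eq_lintegral_ofReal (integrable_of_bounded_measurable hm hbd)
      (ae_of_all _ fun x => (h01 x).1), ← lintegral_indicator_one hG.measurableSet]
    refine lintegral_mono fun x => ?_
    by_cases hx : x ∈ G
    · simpa [hx] using (h01 x).2
    · simp [hx, h0 x hx]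
  have hc : Continuous fun t => ENNReal.ofReal (∫ x, φ x ∂(v t)) :=
    ENNReal.continuous_ofReal.comp (hv φ hφ hφc)
  filter_upwards [hc.continuousAt.eventually (lt_mem_nhds (hrK.trans_le hlow))] with t ht
  exact ht.trans_le (hup t)

lemma measurable_of_vague {v : ℝ → Measure ℝ} (hp : ∀ t, IsProbabilityMeasure (v t))
    (hv : ∀ φ : ℝ → ℝ, ContDiff ℝ (⊤ : ℕ∞) φ → HasCompactSupport φ →
      Continuous fun t => ∫ x, φ x ∂(v t)) : Measurable v := by
  refine .measure_of_isPiSystem_of_isProbabilityMeasure (S := {s : Set ℝ | IsOpen s})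
    BorelSpace.measurable_eq isPiSystem_isOpen fun G hG => ?_
  exact (lowerSemicontinuous_apply_of_vague hp hv hG).measurable

/-- No mass escapes to infinity, so continuity against test functions upgrades to weak
continuity. -/
lemma continuous_integral_of_vague {v : ℝ → Measure ℝ} (hp : ∀ t, IsProbabilityMeasure (v t))
    (hv : ∀ φ : ℝ → ℝ, ContDiff ℝ (⊤ : ℕ∞) φ → HasCompactSupport φ →
      Continuous fun t => ∫ x, φ x ∂(v t))
    {ψ : ℝ → ℝ} (hψ : Continuous ψ) {C : ℝ}
    (hC : ∀ x, |ψ x| ≤ C) : Continuous fun t => ∫ x, ψ x ∂(v t) := by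
  refine continuous_iff_continuousAt.2 fun t₀ => ?_
  let μ : ℝ → ProbabilityMeasure ℝ := fun t => ⟨v t, hp t⟩
  have hμ : Tendsto μ (𝓝 t₀) (𝓝 (μ t₀)) := by
    refine tendsto_of_forall_isOpen_le_liminf' fun G hG => ?_
    exact lowerSemicontinuousAt_iff_le_liminf.1 (lowerSemicontinuous_apply_of_vague hp hv hG t₀)
  exact ProbabilityMeasure.tendsto_iff_forall_integral_tendsto.1 hμ
    (BoundedContinuousFunction.ofNormedAddCommGroup ψ hψ C hC)

/-! ### The resolvent equation on the line -/

/-- A resolvent equation `∫ φ dU = c φ(0) + κ ∫ φ'' dU` for test functions extends, by smooth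
cutoffs, to smooth functions that are bounded together with their first two derivatives. -/
lemma resolvent_eq_of_bounded {U : Measure ℝ} [IsFiniteMeasure U] {c κ : ℝ}
    (hU : ∀ φ : ℝ → ℝ, ContDiff ℝ (⊤ : ℕ∞) φ → HasCompactSupport φ →
      ∫ x, φ x ∂U = c * φ 0 + κ * ∫ x, iteratedDeriv 2 φ x ∂U)
    {ψ ψ₁ ψ₂ : ℝ → ℝ} (hψ : ContDiff ℝ (⊤ : ℕ∞) ψ) (h1 : ∀ x, HasDerivAt ψ (ψ₁ x) x)
    (h2 : ∀ x, HasDerivAt ψ₁ (ψ₂ x) x) (hc2 : Continuous ψ₂) {C : ℝ} (hC : ∀ x, |ψ x| ≤ C)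
    (hC1 : ∀ x, |ψ₁ x| ≤ C) (hC2 : ∀ x, |ψ₂ x| ≤ C) :
    ∫ x, ψ x ∂U = c * ψ 0 + κ * ∫ x, ψ₂ x ∂U := by
  obtain ⟨χ, hχ, hχc, hχ1, -, hχ01⟩ := exists_testFunction_one_on_compact
    (isCompact_Icc (a := (-1 : ℝ)) (b := 1)) isOpen_univ (subset_univ _)
  have hd1 : ∀ x, HasDerivAt χ (deriv χ x) x := fun x =>
    (hχ.differentiable (by simp) x).hasDerivAt
  have hχ' : ContDiff ℝ (⊤ : ℕ∞) (deriv χ) := hχ.iterate_deriv 1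
  have hd2 : ∀ x, HasDerivAt (deriv χ) (deriv (deriv χ) x) x := fun x =>
    (hχ'.differentiable (by simp) x).hasDerivAt
  have hχ'' : ContDiff ℝ (⊤ : ℕ∞) (deriv (deriv χ)) := hχ.iterate_deriv 2
  obtain ⟨B1, hB1⟩ := hχ'.continuous.bounded_above_of_compact_support hχc.deriv
  obtain ⟨B2, hB2⟩ := hχ''.continuous.bounded_above_of_compact_support hχc.deriv.deriv
  -- apply the equation to `ψ x * χ (ε n * x)` and let `ε n` tend to `0`; `D n` is the second
  -- derivative of this product
  set ε : ℕ → ℝ := fun n => 1 / ((n : ℝ) + 1) with hε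
  have hε0 : Tendsto ε atTop (𝓝 0) := tendsto_one_div_add_atTop_nhds_zero_nat
  have hεpos : ∀ n, 0 < ε n := fun n => by rw [hε]; positivity
  have hε1 : ∀ n, ε n ≤ 1 := fun n => by
    rw [hε]
    exact (div_le_one (by positivity)).2 (by linarith [n.cast_nonneg (α := ℝ)])
  set D : ℕ → ℝ → ℝ := fun n x => ψ₂ x * χ (ε n * x) + 2 * (ψ₁ x * (ε n * deriv χ (ε n * x))) +
    ψ x * (ε n ^ 2 * deriv (deriv χ) (ε n * x)) with hD
  have hscale : ∀ (g g' : ℝ → ℝ) (n : ℕ), (∀ x, HasDerivAt g (g' x) x) →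
      ∀ x, HasDerivAt (fun x => g (ε n * x)) (ε n * g' (ε n * x)) x := by
    intro g g' n hg x
    have := (hg (ε n * x)).comp x ((hasDerivAt_id x).const_mul (ε n))
    simpa [mul_comm, Function.comp_def] using this
  have hD2 : ∀ n x, iteratedDeriv 2 (fun x => ψ x * χ (ε n * x)) x = D n x := by
    intro n x
    have e1 : deriv (fun x => ψ x * χ (ε n * x)) =
        fun x => ψ₁ x * χ (ε n * x) + ψ x * (ε n * deriv χ (ε n * x)) :=
      funext fun x => ((h1 x).mul (hscale χ _ n hd1 x)).deriv
    rw [iteratedDeriv_succ, iteratedDeriv_one, e1]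
    have := ((h2 x).mul (hscale χ _ n hd1 x)).add
      ((h1 x).mul ((hscale (deriv χ) _ n hd2 x).const_mul (ε n)))
    refine this.deriv.trans ?_
    simp only [hD]
    ring
  have heq : ∀ n, ∫ x, ψ x * χ (ε n * x) ∂U = c * ψ 0 + κ * ∫ x, D n x ∂U := by
    intro n
    have hsm : ContDiff ℝ (⊤ : ℕ∞) fun x => ψ x * χ (ε n * x) :=
      hψ.mul (hχ.comp (contDiff_const.mul contDiff_id))
    have hcs : HasCompactSupport fun x => ψ x * χ (ε n * x) :=
      HasCompactSupport.mul_left (f := ψ)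
        (hχc.comp_homeomorph (Homeomorph.mulLeft₀ (ε n) (hεpos n).ne'))
    have := hU _ hsm hcs
    simp only [hD2] at this
    rw [this, mul_zero, hχ1 0 (by simp), mul_one]
  have hχlim : ∀ x, ∀ᶠ n in atTop, χ (ε n * x) = 1 := by
    intro x
    have : Tendsto (fun n => ε n * x) atTop (𝓝 0) := by simpa using hε0.mul_const x
    filter_upwards [this.eventually (Icc_mem_nhds (by norm_num : (-1 : ℝ) < 0) one_pos)] with n hn
    exact hχ1 _ hn
  have hχle : ∀ x, |χ x| ≤ 1 := fun x => abs_le.2 ⟨by linarith [(hχ01 x).1], (hχ01 x).2⟩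
  have hC0 : 0 ≤ C := (abs_nonneg _).trans (hC 0)
  have hψ1c : Continuous ψ₁ := continuous_iff_continuousAt.2 fun x => (h2 x).continuousAt
  have hψc := hψ.continuous
  have hχcont := hχ.continuous
  have hχ'cont := hχ'.continuous
  have hχ''cont := hχ''.continuous
  have hlim1 : Tendsto (fun n => ∫ x, ψ x * χ (ε n * x) ∂U) atTop (𝓝 (∫ x, ψ x ∂U)) := by
    refine tendsto_integral_of_dominated_convergence (fun _ => C)
      (fun n => (by fun_prop : Continuous fun x => ψ x * χ (ε n * x)).aestronglyMeasurable)
      (integrable_const _) (fun n => ae_of_all _ fun x => ?_) (ae_of_all _ fun x => ?_)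
    · rw [norm_mul, Real.norm_eq_abs, Real.norm_eq_abs]
      simpa using mul_le_mul (hC x) (hχle (ε n * x)) (abs_nonneg _) hC0
    · refine tendsto_const_nhds.congr' ?_
      filter_upwards [hχlim x] with n hn
      rw [hn, mul_one]
  have hlim2 : Tendsto (fun n => ∫ x, D n x ∂U) atTop (𝓝 (∫ x, ψ₂ x ∂U)) := by
    have hbd : ∀ (g : ℝ → ℝ) (B : ℝ), (∀ x, ‖g x‖ ≤ B) → ∀ (n : ℕ) (y : ℝ) (e : ℝ), |y| ≤ C →
        |e| ≤ 1 → ∀ x, |y * (e * g x)| ≤ C * B := by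
      intro g B hg n y e hy he x
      rw [abs_mul, abs_mul]
      refine mul_le_mul hy ?_ (by positivity) hC0
      calc |e| * |g x| ≤ 1 * B := mul_le_mul he (hg x) (abs_nonneg _) zero_le_one
        _ = B := one_mul B
    refine tendsto_integral_of_dominated_convergence (fun _ => C + 2 * (C * B1) + C * B2)
      (fun n => (by simp only [hD]; fun_prop : Continuous (D n)).aestronglyMeasurable)
      (integrable_const _) (fun n => ae_of_all _ fun x => ?_) (ae_of_all _ fun x => ?_)
    · have b1 : |ψ₂ x * χ (ε n * x)| ≤ C := by
        rw [abs_mul]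
        simpa using mul_le_mul (hC2 x) (hχle (ε n * x)) (abs_nonneg _) hC0
      have b2 := hbd _ B1 hB1 n (ψ₁ x) (ε n) (hC1 x)
        (by rw [abs_of_pos (hεpos n)]; exact hε1 n) (ε n * x)
      have b3 := hbd _ B2 hB2 n (ψ x) (ε n ^ 2) (hC x)
        (by rw [abs_of_pos (by have := hεpos n; positivity)]
            exact pow_le_one₀ (hεpos n).le (hε1 n)) (ε n * x)
      rw [Real.norm_eq_abs]
      simp only [hD]
      refine (abs_add_three _ _ _).trans ?_
      rw [abs_mul 2, abs_two]
      linarith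
    · have hz : ∀ (g : ℝ → ℝ) (B : ℝ), (∀ x, ‖g x‖ ≤ B) → ∀ (e : ℕ → ℝ), Tendsto e atTop (𝓝 0) →
          Tendsto (fun n => e n * g (ε n * x)) atTop (𝓝 0) := by
        intro g B hg e he
        refine squeeze_zero_norm (a := fun n => |e n| * B) (fun n => ?_) ?_
        · rw [norm_mul]
          exact mul_le_mul_of_nonneg_left (hg _) (norm_nonneg _)
        · simpa using he.abs.mul_const B
      have t1 : Tendsto (fun n => ψ₂ x * χ (ε n * x)) atTop (𝓝 (ψ₂ x)) := by
        refine tendsto_const_nhds.congr' ?_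
        filter_upwards [hχlim x] with n hn
        rw [hn, mul_one]
      have t2 := ((hz _ B1 hB1 ε hε0).const_mul (ψ₁ x)).const_mul 2
      have t3 := (hz _ B2 hB2 (fun n => ε n ^ 2) (by simpa using hε0.pow 2)).const_mul (ψ x)
      simpa using (t1.add t2).add t3
  refine tendsto_nhds_unique hlim1 ?_
  simp only [heq]
  exact tendsto_const_nhds.add (hlim2.const_mul κ)

/-- The measure on `ℝ` with two-sided exponential density `(c/2) e^{-a|x|}`; its mass is `c/a`. -/
noncomputable def bilateralExp (c a : ℝ) : Measure ℝ :=
  volume.withDensity fun x => ENNReal.ofReal (c / 2 * Real.exp (-(a * |x|)))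

lemma integrable_exp_neg_mul_abs {a : ℝ} (ha : 0 < a) :
    Integrable fun x : ℝ => Real.exp (-(a * |x|)) := by
  rw [← integrableOn_univ, ← Iic_union_Ioi (a := (0 : ℝ))]
  refine IntegrableOn.union ?_ ?_
  · have := integrableOn_exp_mul_Iic ha 0
    refine this.congr_fun (fun x hx => ?_) measurableSet_Iic
    simp only [abs_of_nonpos (mem_Iic.1 hx)]
    ring_nf
  · refine (integrableOn_exp_neg_mul_Ioi ha).congr_fun (fun x hx => ?_) measurableSet_Ioi
    simp only [abs_of_pos (mem_Ioi.1 hx)]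

lemma isFiniteMeasure_bilateralExp {c a : ℝ} (ha : 0 < a) : IsFiniteMeasure (bilateralExp c a) :=
  isFiniteMeasure_withDensity_ofReal ((integrable_exp_neg_mul_abs ha).const_mul (c / 2)).2

lemma charFun_bilateralExp {c a : ℝ} (hc : 0 ≤ c) (ha : 0 < a) (ξ : ℝ) :
    charFun (bilateralExp c a) ξ = ((c * a / (a ^ 2 + ξ ^ 2) : ℝ) : ℂ) := by
  rw [charFun_apply_real, bilateralExp]
  have h1 := integral_withDensity_eq_integral_smul (μ := (volume : Measure ℝ))
    (f := fun x => (c / 2 * Real.exp (-(a * |x|))).toNNReal) (by fun_prop)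
    (fun x : ℝ => Complex.exp (ξ * x * Complex.I))
  refine Eq.trans h1 ?_
  have e0 : ∀ x : ℝ, (c / 2 * Real.exp (-(a * |x|))).toNNReal • Complex.exp (ξ * x * Complex.I) =
      (c / 2 : ℂ) * ((Real.exp (-(a * |x|)) : ℂ) * Complex.exp (ξ * x * Complex.I)) := by
    intro x
    rw [NNReal.smul_def, Real.coe_toNNReal _ (by positivity), Complex.real_smul]
    push_cast
    ring
  simp only [e0]
  rw [integral_const_mul]
  have hi : Integrable fun x : ℝ => (Real.exp (-(a * |x|)) : ℂ) * Complex.exp (ξ * x * Complex.I) := by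
    refine Integrable.mul_bdd (c := 1) (integrable_exp_neg_mul_abs ha).ofReal
      (by fun_prop) (ae_of_all _ fun x => ?_)
    rw [← Complex.ofReal_mul, Complex.norm_exp_ofReal_mul_I]
  have n1 : ((a : ℂ) - ξ * Complex.I) ≠ 0 := fun h => by
    have := congrArg Complex.re h
    simp at this
    exact ha.ne' this
  have n2 : ((a : ℂ) + ξ * Complex.I) ≠ 0 := fun h => by
    have := congrArg Complex.re h
    simp at this
    exact ha.ne' this
  have hp : ∫ x : ℝ in Ioi 0, (Real.exp (-(a * |x|)) : ℂ) * Complex.exp (ξ * x * Complex.I) =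
      1 / (a - ξ * Complex.I) := by
    have := integral_exp_mul_complex_Ioi (a := -(a - ξ * Complex.I)) (by simpa using ha) 0
    rw [Complex.ofReal_zero, mul_zero, Complex.exp_zero, neg_div_neg_eq] at this
    rw [← this]
    refine setIntegral_congr_fun measurableSet_Ioi fun x hx => ?_
    simp only [abs_of_pos (mem_Ioi.1 hx)]
    push_cast
    rw [← Complex.exp_add]
    ring_nf
  have hn : ∫ x : ℝ in Iic 0, (Real.exp (-(a * |x|)) : ℂ) * Complex.exp (ξ * x * Complex.I) =
      1 / (a + ξ * Complex.I) := by
    have := integral_exp_mul_complex_Iic (a := a + ξ * Complex.I) (by simpa using ha) 0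
    rw [Complex.ofReal_zero, mul_zero, Complex.exp_zero] at this
    rw [← this]
    refine setIntegral_congr_fun measurableSet_Iic fun x hx => ?_
    simp only [abs_of_nonpos (mem_Iic.1 hx)]
    push_cast
    rw [← Complex.exp_add]
    ring_nf
  rw [← intervalIntegral.integral_Iic_add_Ioi hi.integrableOn hi.integrableOn (b := (0 : ℝ)), hp, hn]
  have n3 : ((a : ℂ) ^ 2 + ξ ^ 2) ≠ 0 := by
    have : (0 : ℝ) < a ^ 2 + ξ ^ 2 := by positivity
    exact_mod_cast this.ne'
  have hI : (Complex.I) ^ 2 = -1 := Complex.I_sq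
  push_cast
  have e3 : (a : ℂ) ^ 2 + ξ ^ 2 = (a + ξ * Complex.I) * (a - ξ * Complex.I) := by
    linear_combination (ξ : ℂ) ^ 2 * hI
  rw [e3]
  field_simp
  ring

/-- The resolvent equation determines `U`: testing with `cos (ξ x)` and `sin (ξ x)` gives the
characteristic function of a two-sided exponential law. -/
lemma eq_bilateralExp_of_resolvent {U : Measure ℝ} [IsFiniteMeasure U] {c a : ℝ} (hc : 0 ≤ c)
    (ha : 0 < a) (hU : ∀ φ : ℝ → ℝ, ContDiff ℝ (⊤ : ℕ∞) φ → HasCompactSupport φ →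
      ∫ x, φ x ∂U = c / a * φ 0 + (a ^ 2)⁻¹ * ∫ x, iteratedDeriv 2 φ x ∂U) :
    U = bilateralExp c a := by
  have := isFiniteMeasure_bilateralExp (c := c) ha
  refine Measure.ext_of_charFun (funext fun ξ => ?_)
  rw [charFun_bilateralExp hc ha, charFun_apply_real]
  have hid : ∀ x : ℝ, HasDerivAt (fun x => ξ * x) ξ x := fun x => by
    simpa using (hasDerivAt_id x).const_mul ξ
  set C := 1 + |ξ| + ξ ^ 2 with hC
  have hcos := resolvent_eq_of_bounded hU (ψ := fun x => Real.cos (ξ * x))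
    (ψ₁ := fun x => -Real.sin (ξ * x) * ξ) (ψ₂ := fun x => -(Real.cos (ξ * x) * ξ) * ξ) (C := C)
    (Real.contDiff_cos.comp (contDiff_const.mul contDiff_id)) (fun x => (hid x).cos)
    (fun x => ((hid x).sin.neg).mul_const ξ) (by fun_prop)
    (fun x => (Real.abs_cos_le_one _).trans (by rw [hC]; nlinarith [abs_nonneg ξ, sq_nonneg ξ]))
    (fun x => by
      rw [abs_mul, abs_neg]
      have := mul_le_mul_of_nonneg_right (Real.abs_sin_le_one (ξ * x)) (abs_nonneg ξ)
      rw [hC]; nlinarith [sq_nonneg ξ])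
    (fun x => by
      rw [show -(Real.cos (ξ * x) * ξ) * ξ = -(Real.cos (ξ * x) * ξ ^ 2) by ring, abs_neg, abs_mul,
        abs_of_nonneg (sq_nonneg ξ)]
      have := mul_le_mul_of_nonneg_right (Real.abs_cos_le_one (ξ * x)) (sq_nonneg ξ)
      rw [hC]; nlinarith [abs_nonneg ξ])
  have hsin := resolvent_eq_of_bounded hU (ψ := fun x => Real.sin (ξ * x))
    (ψ₁ := fun x => Real.cos (ξ * x) * ξ) (ψ₂ := fun x => (-Real.sin (ξ * x) * ξ) * ξ) (C := C)
    (Real.contDiff_sin.comp (contDiff_const.mul contDiff_id)) (fun x => (hid x).sin)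
    (fun x => ((hid x).cos).mul_const ξ) (by fun_prop)
    (fun x => (Real.abs_sin_le_one _).trans (by rw [hC]; nlinarith [abs_nonneg ξ, sq_nonneg ξ]))
    (fun x => by
      rw [abs_mul]
      have := mul_le_mul_of_nonneg_right (Real.abs_cos_le_one (ξ * x)) (abs_nonneg ξ)
      rw [hC]; nlinarith [sq_nonneg ξ])
    (fun x => by
      rw [show (-Real.sin (ξ * x) * ξ) * ξ = -(Real.sin (ξ * x) * ξ ^ 2) by ring, abs_neg, abs_mul,
        abs_of_nonneg (sq_nonneg ξ)]
      have := mul_le_mul_of_nonneg_right (Real.abs_sin_le_one (ξ * x)) (sq_nonneg ξ)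
      rw [hC]; nlinarith [abs_nonneg ξ])
  simp only [neg_mul, mul_assoc, integral_neg, integral_mul_const, mul_zero, Real.cos_zero,
    Real.sin_zero] at hcos hsin
  have hpos : 0 < a ^ 2 + ξ ^ 2 := by positivity
  have hcos' : ∫ x, Real.cos (ξ * x) ∂U = c * a / (a ^ 2 + ξ ^ 2) := by
    rw [eq_div_iff hpos.ne']
    field_simp at hcos
    linear_combination hcos
  have hsin' : ∫ x, Real.sin (ξ * x) ∂U = 0 := by
    have : (∫ x, Real.sin (ξ * x) ∂U) * (a ^ 2 + ξ ^ 2) = 0 := by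
      field_simp at hsin
      linear_combination hsin
    exact (mul_eq_zero.1 this).resolve_right hpos.ne'
  have hexp : ∀ x : ℝ, Complex.exp (ξ * x * Complex.I) =
      (Real.cos (ξ * x) : ℂ) + (Real.sin (ξ * x) : ℂ) * Complex.I := by
    intro x
    rw [Complex.exp_mul_I]; push_cast; rfl
  simp only [hexp]
  rw [integral_add, integral_mul_const, integral_complex_ofReal, integral_complex_ofReal, hcos', hsin']
  · simp
  · exact (integrable_of_bounded_measurable (by fun_prop)
      (fun x => Real.abs_cos_le_one (ξ * x))).ofReal
  · exact (integrable_of_bounded_measurable (by fun_prop)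
      (fun x => Real.abs_sin_le_one (ξ * x))).ofReal.mul_const _

lemma lintegral_comp_abs_eq {f : ℝ → ℝ≥0∞} (hf : Measurable f) :
    ∫⁻ x, f |x| = 2 * ∫⁻ x in Ioi (0 : ℝ), f x := by
  have h1 : ∫⁻ x in Ioi (0 : ℝ), f |x| = ∫⁻ x in Ioi (0 : ℝ), f x :=
    setLIntegral_congr_fun measurableSet_Ioi fun x hx => by simp only [abs_of_pos (mem_Ioi.1 hx)]
  have h2 : ∫⁻ x in Iic (0 : ℝ), f |x| = ∫⁻ x in Ioi (0 : ℝ), f x := by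
    rw [← h1, setLIntegral_congr (Ioi_ae_eq_Ici (a := (0 : ℝ)) (μ := volume)),
      ← (Measure.measurePreserving_neg (volume : Measure ℝ)).setLIntegral_comp_preimage
        measurableSet_Iic (f := fun x => f |x|) (hf.comp measurable_id.abs)]
    simp
  rw [← lintegral_add_compl _ (measurableSet_Iic (a := (0 : ℝ))), compl_Iic, h1, h2, two_mul]

/-- Folding a measure with even density `g |x|` doubles the density on `(0, ∞)`. -/
lemma map_abs_withDensity_comp_abs {g : ℝ → ℝ≥0∞} (hg : Measurable g) :
    (volume.withDensity fun x => g |x|).map (fun x => |x|) =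
      (volume.restrict (Ioi 0)).withDensity fun x => 2 * g x := by
  ext A hA
  have hm : Measurable fun x : ℝ => |x| := measurable_id.abs
  rw [Measure.map_apply hm hA, withDensity_apply _ (hm hA), withDensity_apply _ hA,
    ← lintegral_indicator (hm hA), ← lintegral_indicator hA]
  have e : ∀ x : ℝ, ((fun x => |x|) ⁻¹' A).indicator (fun x => g |x|) x = A.indicator g |x| :=
    fun x => rfl
  simp only [e]
  rw [lintegral_comp_abs_eq (hg.indicator hA), ← lintegral_const_mul _ (hg.indicator hA)]
  refine lintegral_congr fun x => ?_
  by_cases hx : x ∈ A <;> simp [indicator, hx]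

lemma map_abs_bilateralExp {c a : ℝ} :
    (bilateralExp c a).map (fun x => |x|) = (volume.restrict (Ioi 0)).withDensity
      fun x => ENNReal.ofReal (c * Real.exp (-(x * a))) := by
  refine (map_abs_withDensity_comp_abs
    (g := fun y => ENNReal.ofReal (c / 2 * Real.exp (-(a * y)))) (by fun_prop)).trans ?_
  congr 1
  funext x
  rw [← ENNReal.ofReal_ofNat, ← ENNReal.ofReal_mul (by norm_num)]
  congr 1
  ring_nf

/-! ### Solutions of the fractional diffusion equation -/

namespace IsFracDiffusionSolution

variable {α : ℝ} {u : ℝ≥0 → Measure ℝ}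

lemma continuous_integral_testFunction (hu : IsFracDiffusionSolution α u) {φ : ℝ → ℝ}
    (hφ : ContDiff ℝ (⊤ : ℕ∞) φ) (hφc : HasCompactSupport φ) :
    Continuous fun t : ℝ => ∫ x, φ x ∂(u t.toNNReal) := by
  have h := (hu.regular φ hφ hφc).1.continuousOn
  have h2 : (fun t : ℝ => ∫ x, φ x ∂(u t.toNNReal)) =
      (fun t : ℝ => ∫ x, φ x ∂(u t.toNNReal)) ∘ fun t => max t 0 := by
    funext t
    have : (max t 0).toNNReal = t.toNNReal := NNReal.eq (by simp)
    simp only [Function.comp, this]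
  rw [h2]
  exact h.comp_continuous (by fun_prop) fun t => mem_Ici.2 (le_max_right t 0)

lemma measurable (hu : IsFracDiffusionSolution α u) : Measurable fun t : ℝ => u t.toNNReal :=
  measurable_of_vague (fun _ => hu.isProb _) fun _ hφ hφc =>
    hu.continuous_integral_testFunction hφ hφc

/-- The Laplace transform in time of the fractional diffusion equation is the resolvent equation
`s^{2α} U - s^{2α-1} δ = U''`, so `U` is two-sided exponential. -/
lemma laplaceMix_eq (hu : IsFracDiffusionSolution α u) (hα0 : 0 < α) (hα1 : α ≤ 1) {s : ℝ}
    (hs : 0 < s) :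
    laplaceMix s (fun t => u t.toNNReal) = bilateralExp (s ^ (α - 1)) (s ^ α) := by
  have hp : ∀ t : ℝ, IsProbabilityMeasure (u t.toNNReal) := fun t => hu.isProb _
  have := isFiniteMeasure_laplaceMix hu.measurable hp hs
  refine eq_bilateralExp_of_resolvent (by positivity) (by positivity) fun φ hφ hφc => ?_
  have hφ2 : ContDiff ℝ (⊤ : ℕ∞) (iteratedDeriv 2 φ) := by
    rw [iteratedDeriv_eq_iterate]; exact hφ.iterate_deriv 2
  have hφ2c : HasCompactSupport (iteratedDeriv 2 φ) := by
    rw [iteratedDeriv_succ, iteratedDeriv_one]; exact hφc.deriv.deriv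
  obtain ⟨B, hB⟩ := hφ.continuous.bounded_above_of_compact_support hφc
  obtain ⟨B2, hB2⟩ := hφ2.continuous.bounded_above_of_compact_support hφ2c
  rw [integral_laplaceMix hu.measurable hp hs hφ.continuous.measurable hB,
    integral_laplaceMix hu.measurable hp hs hφ2.continuous.measurable hB2,
    laplace_of_hasCaputoDerivAt (β := 2 * α) (by linarith) (by linarith) (hu.regular φ hφ hφc)
      (hu.equation φ hφ hφc) (fun h => hu.init_deriv (by linarith) φ hφ hφc)
      (hu.continuous_integral_testFunction hφ2 hφ2c).continuousOn
      (laplaceIntegrable_integral hu.measurable hp hφ2.continuous.measurable hB2) hs]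
  simp only [Real.toNNReal_zero, hu.init, integral_dirac]
  rw [Real.rpow_sub hs, Real.rpow_one, Real.rpow_neg hs.le, mul_comm 2 α, Real.rpow_mul hs.le,
    Real.rpow_two]
  have : s ^ α ≠ 0 := by positivity
  field_simp

lemma isInverseStableFamily (hu : IsFracDiffusionSolution α u) (hα0 : 0 < α) (hα1 : α ≤ 1) :
    IsInverseStableFamily α fun t => foldedLaw (u t.toNNReal) := by
  have habs : Measurable fun x : ℝ => |x| := measurable_id.abs
  have hm : Measurable fun t : ℝ => foldedLaw (u t.toNNReal) :=
    (Measure.measurable_map _ habs).comp hu.measurable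
  refine ⟨fun t => ?_, hm, ?_, fun s hs => ?_⟩
  · have := hu.isProb t.toNNReal
    exact Measure.isProbabilityMeasure_map habs.aemeasurable
  · rintro ψ hψ ⟨C, hC⟩ t -
    have : (fun t : ℝ => ∫ x, ψ x ∂foldedLaw (u t.toNNReal)) =
        fun t : ℝ => ∫ x, ψ |x| ∂(u t.toNNReal) := by
      funext t
      exact integral_map habs.aemeasurable hψ.aestronglyMeasurable
    rw [this]
    exact (continuous_integral_of_vague (v := fun t : ℝ => u t.toNNReal) (fun t => hu.isProb _)
      (fun _ hφ hφc => hu.continuous_integral_testFunction hφ hφc) (hψ.comp continuous_abs)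
      fun x => hC |x|).continuousWithinAt
  · rw [← map_abs_bilateralExp, ← hu.laplaceMix_eq hα0 hα1 hs]
    ext A hA
    rw [laplaceMix_apply hm s hA, Measure.map_apply habs hA,
      laplaceMix_apply hu.measurable s (habs hA)]
    simp only [foldedLaw, Measure.map_apply habs hA]

lemma lintegral_exp_mul_foldedLaw (hu : IsFracDiffusionSolution α u) (hα0 : 0 < α) (hα1 : α ≤ 1)
    {s : ℝ} (hs : 0 < s) {A : Set ℝ} (hA : MeasurableSet A) :
    ∫⁻ t in Ioi (0 : ℝ), ENNReal.ofReal (Real.exp (-(s * t))) * foldedLaw (u t.toNNReal) A =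
      ∫⁻ x in A ∩ Ioi 0, ENNReal.ofReal (s ^ (α - 1) * Real.exp (-(x * s ^ α))) := by
  have h := hu.isInverseStableFamily hα0 hα1
  rw [← laplaceMix_apply h.measurable s hA, h.laplace s hs, withDensity_apply _ hA,
    Measure.restrict_restrict hA]

end IsFracDiffusionSolution

/-! ### Inverse stable subordinators -/

/-- The first passage time `inf {x ≥ 0 : d(x) > t}` of a path `d` above the level `t`. -/
noncomputable def firstPassage (d : ℝ≥0 → ℝ) (t : ℝ) : ℝ≥0 := sInf {x : ℝ≥0 | t < d x}

section FirstPassage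

variable {d : ℝ≥0 → ℝ}

lemma firstPassage_le {x : ℝ≥0} {t : ℝ} (h : t < d x) : firstPassage d t ≤ x :=
  csInf_le (OrderBot.bddBelow _) h

lemma le_firstPassage (hd : Monotone d) (hu : ∀ t, ∃ x, t < d x) {x : ℝ≥0} {t : ℝ}
    (h : d x ≤ t) : x ≤ firstPassage d t :=
  le_csInf (hu t) fun y hy => by
    by_contra hlt
    have h1 := hd (not_le.1 hlt).le
    have h2 : t < d y := hy
    linarith

lemma firstPassage_lt_iff (hu : ∀ t, ∃ x, t < d x) {a : ℝ≥0} {t : ℝ} :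
    firstPassage d t < a ↔ ∃ x < a, t < d x := by
  constructor
  · intro h
    obtain ⟨x, hx, hxa⟩ := exists_lt_of_csInf_lt (hu t) h
    exact ⟨x, hxa, hx⟩
  · rintro ⟨x, hxa, hx⟩
    exact (firstPassage_le hx).trans_lt hxa

lemma firstPassage_mono (hu : ∀ t, ∃ x, t < d x) : Monotone (firstPassage d) := fun _ t hst =>
  csInf_le_csInf (OrderBot.bddBelow _) (hu t) fun _ hx => lt_of_le_of_lt hst hx

lemma continuousWithinAt_firstPassage (hu : ∀ t, ∃ x, t < d x) (t : ℝ) :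
    ContinuousWithinAt (firstPassage d) (Ioi t) t := by
  refine tendsto_order.2 ⟨fun a ha => ?_, fun a ha => ?_⟩
  · filter_upwards [self_mem_nhdsWithin] with r hr
    exact ha.trans_le (firstPassage_mono hu (mem_Ioi.1 hr).le)
  · obtain ⟨x, hxa, hx⟩ := (firstPassage_lt_iff hu).1 ha
    filter_upwards [mem_nhdsWithin_of_mem_nhds (Iio_mem_nhds hx)] with r hr
    exact (firstPassage_lt_iff hu).2 ⟨x, hxa, hr⟩

end FirstPassage

section Subordinator

variable {Ω : Type*} [MeasurableSpace Ω] {P : Measure Ω} {α : ℝ} {D : ℝ≥0 → Ω → ℝ}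

lemma IsStableSubordinator.ae_nonneg (hD : IsStableSubordinator α P D) :
    ∀ᵐ ω ∂P, ∀ x, 0 ≤ D x ω := by
  filter_upwards [hD.start, hD.monotone] with ω h0 hm x
  rw [← h0]
  exact hm (zero_le (a := x))

variable [IsProbabilityMeasure P]

/-- The bound `P (D(n) ≤ k) ≤ e^{k-n}` shows that the paths are unbounded. -/
lemma IsStableSubordinator.ae_unbounded (hD : IsStableSubordinator α P D) :
    ∀ᵐ ω ∂P, ∀ t : ℝ, ∃ x, t < D x ω := by
  have key : ∀ k : ℕ, ∀ᵐ ω ∂P, ∃ x, (k : ℝ) < D x ω := by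
    intro k
    have hle : ∀ n : ℕ, P.real {ω | ∀ x, D x ω ≤ k} ≤ Real.exp k * Real.exp (-(n : ℝ)) := by
      intro n
      have hint : Integrable (fun ω => Real.exp (-(1 * D n ω))) P := by
        refine Integrable.of_bound
          ((hD.measurable n).const_mul 1).neg.exp.aestronglyMeasurable 1 ?_
        filter_upwards [hD.ae_nonneg] with ω h
        rw [Real.norm_of_nonneg (Real.exp_pos _).le]
        exact Real.exp_le_one_iff.2 (by linarith [h n])
      have h1 := mul_meas_ge_le_integral_of_nonneg (ae_of_all _ fun ω => (Real.exp_pos _).le) hint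
        (Real.exp (-(k : ℝ)))
      rw [hD.laplace n 1 one_pos, Real.one_rpow, mul_one] at h1
      have h2 : P.real {ω | ∀ x, D x ω ≤ k} ≤
          P.real {ω | Real.exp (-(k : ℝ)) ≤ Real.exp (-(1 * D n ω))} := by
        refine measureReal_mono fun ω hω => ?_
        have := hω n
        exact Real.exp_le_exp.2 (by linarith)
      have h3 : Real.exp k * Real.exp (-(k : ℝ)) = 1 := by rw [← Real.exp_add]; simp
      calc _ ≤ P.real {ω | Real.exp (-(k : ℝ)) ≤ Real.exp (-(1 * D n ω))} := h2
        _ = Real.exp k * (Real.exp (-(k : ℝ)) *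
            P.real {ω | Real.exp (-(k : ℝ)) ≤ Real.exp (-(1 * D n ω))}) := by
          rw [← mul_assoc, h3, one_mul]
        _ ≤ _ := mul_le_mul_of_nonneg_left (by simpa using h1) (Real.exp_pos _).le
    have hlim : Tendsto (fun n : ℕ => Real.exp k * Real.exp (-(n : ℝ))) atTop (𝓝 0) := by
      have := (Real.tendsto_exp_neg_atTop_nhds_zero.comp
        (tendsto_natCast_atTop_atTop (R := ℝ))).const_mul (Real.exp k)
      simpa using this
    have h0 : P.real {ω | ∀ x, D x ω ≤ k} = 0 :=
      le_antisymm (ge_of_tendsto' hlim hle) measureReal_nonneg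
    rw [measureReal_eq_zero_iff] at h0
    rw [ae_iff]
    simpa using h0
  filter_upwards [ae_all_iff.2 key] with ω h t
  obtain ⟨k, hk⟩ := exists_nat_gt t
  obtain ⟨x, hx⟩ := h k
  exact ⟨x, hk.trans hx⟩

/-- A version of the subordinator all of whose paths are nonnegative, nondecreasing and
unbounded. -/
lemma IsStableSubordinator.exists_version (hD : IsStableSubordinator α P D) :
    ∃ D' : ℝ≥0 → Ω → ℝ, (∀ x, Measurable (D' x)) ∧ (∀ᵐ ω ∂P, ∀ x, D' x ω = D x ω) ∧
      ∀ ω, Monotone (fun x => D' x ω) ∧ (∀ x, 0 ≤ D' x ω) ∧ ∀ t : ℝ, ∃ x, t < D' x ω := by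
  classical
  have hgood := hD.monotone.and (hD.ae_nonneg.and hD.ae_unbounded)
  set G := (toMeasurable P {ω | ¬(Monotone (fun x => D x ω) ∧ (∀ x, 0 ≤ D x ω) ∧
    ∀ t : ℝ, ∃ x, t < D x ω)})ᶜ with hG
  have hGm : MeasurableSet G := (measurableSet_toMeasurable _ _).compl
  have hG1 : ∀ᵐ ω ∂P, ω ∈ G := by
    rw [ae_iff]
    simp only [hG, mem_compl_iff, not_not]
    exact (measure_toMeasurable _).trans (ae_iff.1 hgood)
  have hG2 : ∀ ω ∈ G, Monotone (fun x => D x ω) ∧ (∀ x, 0 ≤ D x ω) ∧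
      ∀ t : ℝ, ∃ x, t < D x ω := by
    intro ω hω
    by_contra h
    exact hω (subset_toMeasurable _ _ h)
  refine ⟨fun x ω => if ω ∈ G then D x ω else (x : ℝ),
    fun x => Measurable.ite hGm (hD.measurable x) measurable_const, ?_, fun ω => ?_⟩
  · filter_upwards [hG1] with ω hω x
    simp [hω]
  · by_cases hω : ω ∈ G
    · simpa [hω] using hG2 ω hω
    · simp only [hω, if_false]
      refine ⟨fun x y hxy => by exact_mod_cast hxy, fun x => x.2, fun t => ?_⟩
      obtain ⟨k, hk⟩ := exists_nat_gt t
      exact ⟨k, by simpa using hk⟩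

lemma lintegral_exp_Ici {s y : ℝ} (hs : 0 < s) :
    ∫⁻ t in Ici y, ENNReal.ofReal (Real.exp (-(s * t))) =
      ENNReal.ofReal (1 / s * Real.exp (-(s * y))) := by
  have h1 := integral_exp_mul_Ioi (neg_lt_zero.2 hs) y
  have h2 := integrableOn_exp_mul_Ioi (neg_lt_zero.2 hs) y
  simp only [neg_mul] at h1 h2
  rw [setLIntegral_congr (Ioi_ae_eq_Ici (a := y) (μ := volume)).symm,
    ← ofReal_integral_eq_lintegral_ofReal h2 (ae_of_all _ fun t => (Real.exp_pos _).le), h1]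
  congr 1
  rw [neg_div_neg_eq]
  ring

/-- The Laplace transform of `t ↦ P (Y ≤ t)` for a nonnegative random variable `Y`. -/
lemma lintegral_exp_mul_measure_le {Y : Ω → ℝ} (hY : Measurable Y) (hY0 : ∀ ω, 0 ≤ Y ω) {s : ℝ}
    (hs : 0 < s) :
    ∫⁻ t in Ioi (0 : ℝ), ENNReal.ofReal (Real.exp (-(s * t))) * P {ω | Y ω ≤ t} =
      ENNReal.ofReal (1 / s * ∫ ω, Real.exp (-(s * Y ω)) ∂P) := by
  have hset : MeasurableSet {p : ℝ × Ω | Y p.2 ≤ p.1} :=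
    measurableSet_le (hY.comp measurable_snd) measurable_fst
  have hF : Measurable ({p : ℝ × Ω | Y p.2 ≤ p.1}.indicator
      fun p => ENNReal.ofReal (Real.exp (-(s * p.1)))) :=
    Measurable.indicator (by fun_prop) hset
  have e1 : ∀ t : ℝ, ENNReal.ofReal (Real.exp (-(s * t))) * P {ω | Y ω ≤ t} =
      ∫⁻ ω, {p : ℝ × Ω | Y p.2 ≤ p.1}.indicator
        (fun p => ENNReal.ofReal (Real.exp (-(s * p.1)))) (t, ω) ∂P := by
    intro t
    rw [← setLIntegral_const, ← lintegral_indicator (measurableSet_le hY measurable_const)]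
    rfl
  have e2 : ∀ ω, ∫⁻ t in Ioi (0 : ℝ), {p : ℝ × Ω | Y p.2 ≤ p.1}.indicator
      (fun p => ENNReal.ofReal (Real.exp (-(s * p.1)))) (t, ω) =
      ENNReal.ofReal (1 / s * Real.exp (-(s * Y ω))) := by
    intro ω
    have hind : ∀ t : ℝ, {p : ℝ × Ω | Y p.2 ≤ p.1}.indicator
        (fun p => ENNReal.ofReal (Real.exp (-(s * p.1)))) (t, ω) =
        (Ici (Y ω)).indicator (fun t => ENNReal.ofReal (Real.exp (-(s * t)))) t := fun t => rfl
    simp only [hind]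
    rw [← lintegral_exp_Ici hs, setLIntegral_congr (Ioi_ae_eq_Ici (a := (0 : ℝ)) (μ := volume)),
      setLIntegral_indicator measurableSet_Ici,
      inter_eq_self_of_subset_left (Ici_subset_Ici.2 (hY0 ω))]
  simp only [e1]
  rw [lintegral_lintegral_swap (f := fun t ω => {p : ℝ × Ω | Y p.2 ≤ p.1}.indicator
    (fun p => ENNReal.ofReal (Real.exp (-(s * p.1)))) (t, ω)) hF.aemeasurable]
  simp only [e2]
  rw [← integral_const_mul, ofReal_integral_eq_lintegral_ofReal]
  · refine (integrable_of_bounded_measurable (C := 1) (by fun_prop) fun ω => ?_).const_mul _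
    rw [abs_of_pos (Real.exp_pos _)]
    exact Real.exp_le_one_iff.2 (by have := mul_nonneg hs.le (hY0 ω); linarith)
  · exact ae_of_all _ fun ω => by positivity

/-- The law of the inverse subordinator is sandwiched between laws of the subordinator, through
`{H(t) > x} ⊆ {D(x) ≤ t} ⊆ {H(t) ≥ x}`. -/
lemma isInverseStableFamily_firstPassage (hD : ∀ x, Measurable (D x))
    (hmono : ∀ ω, Monotone fun x => D x ω) (hnn : ∀ ω x, 0 ≤ D x ω)
    (hub : ∀ ω, ∀ t : ℝ, ∃ x, t < D x ω)
    (hL : ∀ (x : ℝ≥0) (s : ℝ), 0 < s →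
      ∫ ω, Real.exp (-(s * D x ω)) ∂P = Real.exp (-((x : ℝ) * s ^ α))) :
    (∀ t, Measurable fun ω => (firstPassage (fun x => D x ω) t : ℝ)) ∧
      IsInverseStableFamily α fun t => P.map fun ω => (firstPassage (fun x => D x ω) t : ℝ) := by
  -- `{H(t) < a}` is the union of `{t < D(q)}` over a countable dense set of `q < a`
  have hXm : ∀ t, Measurable fun ω => firstPassage (fun x => D x ω) t := by
    intro t
    refine measurable_of_Iio fun a => ?_
    obtain ⟨S, hSc, hSd⟩ := TopologicalSpace.exists_countable_dense ℝ≥0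
    have : (fun ω => firstPassage (fun x => D x ω) t) ⁻¹' Iio a =
        ⋃ q ∈ S ∩ Iio a, {ω | t < D q ω} := by
      ext ω
      simp only [mem_preimage, mem_Iio, mem_iUnion, mem_inter_iff, exists_prop]
      rw [firstPassage_lt_iff (hub ω)]
      constructor
      · rintro ⟨x, hxa, hx⟩
        obtain ⟨q, hq, hxq⟩ := hSd.exists_between hxa
        exact ⟨q, ⟨hq, hxq.2⟩, hx.trans_le (hmono ω hxq.1.le)⟩
      · rintro ⟨q, hq, hx⟩
        exact ⟨q, hq.2, hx⟩
    rw [this]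
    exact MeasurableSet.biUnion (hSc.mono inter_subset_left)
      fun q _ => measurableSet_lt measurable_const (hD q)
  have hXm' : ∀ t, Measurable fun ω => (firstPassage (fun x => D x ω) t : ℝ) :=
    fun t => measurable_coe_nnreal_real.comp (hXm t)
  have hp : ∀ t, IsProbabilityMeasure
      (P.map fun ω => (firstPassage (fun x => D x ω) t : ℝ)) :=
    fun t => Measure.isProbabilityMeasure_map (hXm' t).aemeasurable
  have hmeas : Measurable fun t => P.map fun ω => (firstPassage (fun x => D x ω) t : ℝ) := by
    refine .measure_of_isPiSystem_of_isProbabilityMeasure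
      (BorelSpace.measurable_eq.trans (borel_eq_generateFrom_Ioi ℝ)) isPiSystem_Ioi ?_
    rintro _ ⟨a, rfl⟩
    refine Monotone.measurable fun t r htr => ?_
    rw [Measure.map_apply (hXm' t) measurableSet_Ioi, Measure.map_apply (hXm' r) measurableSet_Ioi]
    refine measure_mono fun ω hω => ?_
    have h1 : a < (firstPassage (fun x => D x ω) t : ℝ) := hω
    have h2 : (firstPassage (fun x => D x ω) t : ℝ) ≤ firstPassage (fun x => D x ω) r := by
      exact_mod_cast firstPassage_mono (hub ω) htr
    exact h1.trans_le h2
  refine ⟨hXm', hp, hmeas, ?_, fun s hs => ?_⟩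
  · rintro ψ hψ ⟨C, hC⟩ t -
    have e : ∀ r, ∫ x, ψ x ∂(P.map fun ω => (firstPassage (fun x => D x ω) r : ℝ)) =
        ∫ ω, ψ (firstPassage (fun x => D x ω) r) ∂P := fun r =>
      integral_map (hXm' r).aemeasurable hψ.aestronglyMeasurable
    simp only [e]
    refine tendsto_integral_filter_of_dominated_convergence (fun _ => C)
      (Eventually.of_forall fun r => (hψ.measurable.comp (hXm' r)).aestronglyMeasurable)
      (Eventually.of_forall fun r => ae_of_all _ fun ω => hC _) (integrable_const _)
      (ae_of_all _ fun ω => ?_)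
    exact (hψ.tendsto _).comp ((NNReal.continuous_coe.tendsto _).comp
      (continuousWithinAt_firstPassage (hub ω) t))
  · have := isFiniteMeasure_laplaceMix hmeas hp hs
    have hLT : ∀ x : ℝ≥0, ∫⁻ t in Ioi (0 : ℝ), ENNReal.ofReal (Real.exp (-(s * t))) *
        P {ω | D x ω ≤ t} = ENNReal.ofReal (1 / s * Real.exp (-((x : ℝ) * s ^ α))) := by
      intro x
      rw [lintegral_exp_mul_measure_le (hD x) (fun ω => hnn ω x) hs, hL x s hs]
    have hsα : 0 < s ^ α := by positivity
    have hR : ∀ a : ℝ, ((volume.restrict (Ioi 0)).withDensity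
        fun x => ENNReal.ofReal (s ^ (α - 1) * Real.exp (-(x * s ^ α)))) (Ici a) =
        ENNReal.ofReal (1 / s * Real.exp (-((a.toNNReal : ℝ) * s ^ α))) := by
      intro a
      rw [withDensity_apply _ measurableSet_Ici, Measure.restrict_congr_set
        (Ioi_ae_eq_Ici (a := (0 : ℝ)) (μ := volume)), Measure.restrict_restrict measurableSet_Ici,
        Ici_inter_Ici, ← Real.coe_toNNReal']
      have h1 := lintegral_exp_Ici (y := (a.toNNReal : ℝ)) hsα
      simp only [ENNReal.ofReal_mul (Real.rpow_nonneg hs.le (α - 1)), mul_comm _ (s ^ α)]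
      rw [lintegral_const_mul _ (by fun_prop)]
      change _ * ∫⁻ t in Ici ((a.toNNReal : ℝ)), _ = _
      rw [h1, ← ENNReal.ofReal_mul (Real.rpow_nonneg hs.le (α - 1)), ← mul_assoc]
      congr 2
      rw [Real.rpow_sub hs, Real.rpow_one]
      field_simp
    refine Measure.ext_of_Ici _ _ fun a => ?_
    rw [hR, laplaceMix_apply hmeas s measurableSet_Ici]
    simp only [Measure.map_apply (hXm' _) measurableSet_Ici]
    refine le_antisymm ?_ ?_
    · rcases le_or_gt a 0 with ha | ha
      · rw [Real.toNNReal_of_nonpos ha, NNReal.coe_zero, zero_mul, ← mul_zero s,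
          ← lintegral_exp_Ici hs, mul_zero, setLIntegral_congr
            (Ioi_ae_eq_Ici (a := (0 : ℝ)) (μ := volume))]
        exact lintegral_mono fun t => mul_le_of_le_one_right' prob_le_one
      -- `{a ≤ H(t)} ⊆ {D(b) ≤ t}` for `b < a`, and the transform of the latter is continuous in `b`
      · have hc : Tendsto (fun b : ℝ => ENNReal.ofReal (1 / s * Real.exp (-(b * s ^ α)))) (𝓝[<] a)
            (𝓝 (ENNReal.ofReal (1 / s * Real.exp (-(a * s ^ α))))) :=
          (ENNReal.continuous_ofReal.comp (by fun_prop :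
            Continuous fun b : ℝ => 1 / s * Real.exp (-(b * s ^ α)))).continuousWithinAt
        rw [Real.coe_toNNReal _ ha.le]
        refine ge_of_tendsto hc ?_
        filter_upwards [Ioo_mem_nhdsLT ha] with b hb
        have := hLT ⟨b, hb.1.le⟩
        refine le_trans ?_ this.le
        refine lintegral_mono fun t => mul_le_mul_right (measure_mono fun ω hω => ?_) _
        by_contra hcon
        have h1 : firstPassage (fun x => D x ω) t ≤ ⟨b, hb.1.le⟩ := firstPassage_le (not_le.1 hcon)
        have h2 : a ≤ (firstPassage (fun x => D x ω) t : ℝ) := hω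
        have h3 : (firstPassage (fun x => D x ω) t : ℝ) ≤ b := by exact_mod_cast h1
        linarith [hb.2]
    · rw [← hLT]
      refine lintegral_mono fun t => mul_le_mul_right (measure_mono fun ω hω => ?_) _
      have h1 := le_firstPassage (hmono ω) (hub ω) hω
      have h2 : (a.toNNReal : ℝ) ≤ (firstPassage (fun x => D x ω) t : ℝ) := by exact_mod_cast h1
      exact (Real.le_coe_toNNReal a).trans h2

lemma IsInverseStableSubordinator.exists_family {H : ℝ≥0 → Ω → ℝ≥0}
    (hH : IsInverseStableSubordinator α P H) :
    ∃ m : ℝ → Measure ℝ, IsInverseStableFamily α m ∧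
      ∀ t : ℝ≥0, HasLaw (fun ω => (H t ω : ℝ)) (m t) P := by
  obtain ⟨D, hD, hHD⟩ := hH
  obtain ⟨D', hD'm, hae, hD'⟩ := hD.exists_version
  obtain ⟨hm, hfam⟩ := isInverseStableFamily_firstPassage (α := α) hD'm (fun ω => (hD' ω).1)
    (fun ω => (hD' ω).2.1) (fun ω => (hD' ω).2.2) (P := P) (fun x s hs => by
      rw [← hD.laplace x s hs]
      refine integral_congr_ae ?_
      filter_upwards [hae] with ω h
      simp only [h])
  refine ⟨_, hfam, fun t => ?_⟩
  have heq : (fun ω => (H t ω : ℝ)) =ᵐ[P]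
      fun ω => (firstPassage (fun x => D' x ω) t : ℝ) := by
    filter_upwards [hae, hHD t] with ω h1 h2
    rw [h2, firstPassage]
    simp only [h1]
  exact ⟨(hm t).aemeasurable.congr heq.symm, Measure.map_congr heq⟩

end Subordinator

/-! ### Convoluted Poisson processes and random times -/

lemma discreteConv_eq_sum {lam p : ℤ → ℝ} (hlam : ∀ j < 0, lam j = 0) (hp : ∀ k < 0, p k = 0)
    {n : ℤ} {M : ℕ} (hn : n < M) :
    discreteConv lam p n = ∑ j ∈ Finset.range M, lam j * p (n - j) := by
  rw [discreteConv, tsum_eq_sum (s := (Finset.range M).map Nat.castEmbedding), Finset.sum_map]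
  · rfl
  · intro j hj
    rcases lt_or_ge j 0 with h | h
    · rw [hlam j h, zero_mul]
    · lift j to ℕ using h
      have : M ≤ j := by
        by_contra hlt
        exact hj (Finset.mem_map.2 ⟨j, Finset.mem_range.2 (not_le.1 hlt), rfl⟩)
      rw [hp _ (by omega), mul_zero]

/-- The triangular recursion satisfied by the Laplace transforms of the state probabilities has a
unique solution. -/
lemma eq_of_convolution_recursion {lam a b c : ℤ → ℝ} {κ : ℝ} (hκ : 0 < κ) (hlam : 0 ≤ lam 0)
    (ha0 : ∀ k < 0, a k = 0) (hb0 : ∀ k < 0, b k = 0)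
    (ha : ∀ n : ℕ, a n = c n +
      κ * ∑ j ∈ Finset.range (n + 1), lam j * (a ((n : ℤ) - 1 - j) - a ((n : ℤ) - j)))
    (hb : ∀ n : ℕ, b n = c n +
      κ * ∑ j ∈ Finset.range (n + 1), lam j * (b ((n : ℤ) - 1 - j) - b ((n : ℤ) - j)))
    (n : ℕ) : a n = b n := by
  induction n using Nat.strong_induction_on with
  | _ n ih =>
    have hlow : ∀ k : ℤ, k < n → a k = b k := by
      intro k hk
      rcases lt_or_ge k 0 with h | h
      · rw [ha0 k h, hb0 k h]
      · lift k to ℕ using h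
        exact ih k (by exact_mod_cast hk)
    have hsum : ∑ j ∈ Finset.range (n + 1), lam j * (a ((n : ℤ) - 1 - j) - a ((n : ℤ) - j)) -
        ∑ j ∈ Finset.range (n + 1), lam j * (b ((n : ℤ) - 1 - j) - b ((n : ℤ) - j)) =
        -(lam 0 * (a n - b n)) := by
      rw [← Finset.sum_sub_distrib, Finset.sum_eq_single 0]
      · rw [hlow _ (by simp)]
        simp only [Nat.cast_zero, sub_zero]
        ring
      · intro j _ hj
        rw [hlow _ (by omega), hlow ((n : ℤ) - j) (by omega), sub_self]
      · simp
    have hdiff : (a n - b n) * (1 + κ * lam 0) = 0 := by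
      rw [ha n, hb n] at *
      linear_combination κ * hsum
    have h1 : 1 + κ * lam 0 ≠ 0 := by positivity
    exact sub_eq_zero.1 ((mul_eq_zero.1 hdiff).resolve_right h1)

lemma laplace_sub {f g : ℝ → ℝ} (hf : LaplaceIntegrable f) (hg : LaplaceIntegrable g) :
    LaplaceIntegrable (fun t => f t - g t) ∧
      ∀ s, 0 < s → laplace (fun t => f t - g t) s = laplace f s - laplace g s := by
  constructor
  · intro s hs
    simp only [mul_sub]
    exact (hf s hs).sub (hg s hs)
  · intro s hs
    simp only [laplace, mul_sub]
    exact integral_sub (hf s hs) (hg s hs)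

lemma laplace_sum_mul {ι : Type*} (S : Finset ι) (c : ι → ℝ) {f : ι → ℝ → ℝ}
    (hf : ∀ i, LaplaceIntegrable (f i)) :
    LaplaceIntegrable (fun t => ∑ i ∈ S, c i * f i t) ∧
      ∀ s, 0 < s → laplace (fun t => ∑ i ∈ S, c i * f i t) s = ∑ i ∈ S, c i * laplace (f i) s := by
  have e : ∀ s t : ℝ, Real.exp (-(s * t)) * ∑ i ∈ S, c i * f i t =
      ∑ i ∈ S, c i * (Real.exp (-(s * t)) * f i t) := by
    intro s t
    rw [Finset.mul_sum]
    exact Finset.sum_congr rfl fun i _ => by ring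
  constructor
  · intro s hs
    simp only [e]
    exact integrable_finsetSum _ fun i _ => (hf i s hs).const_mul (c i)
  · intro s hs
    simp only [laplace, e]
    rw [integral_finsetSum _ fun i _ => (hf i s hs).const_mul (c i)]
    simp only [integral_const_mul]

section StateProb

variable {Ω : Type*} [MeasurableSpace Ω] {P : Measure Ω}
  {N : ℝ≥0 → Ω → ℕ} {lam : ℤ → ℝ} {α : ℝ}

lemma stateProb_of_neg {n : ℤ} (hn : n < 0) (t : ℝ) : stateProb P N n t = 0 := by
  have : {ω | (N t.toNNReal ω : ℤ) = n} = ∅ := by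
    ext ω
    simp only [mem_ofPred_eq, mem_empty_iff_false, iff_false]
    omega
  rw [stateProb, this, measureReal_empty]

lemma laplace_stateProb_of_neg {n : ℤ} (hn : n < 0) (s : ℝ) : laplace (stateProb P N n) s = 0 := by
  simp only [laplace, stateProb_of_neg hn, mul_zero, integral_zero]

lemma IsCFPP.continuous_stateProb (hN : IsCFPP lam α P N) (n : ℤ) :
    Continuous (stateProb P N n) := by
  rcases lt_or_ge n 0 with h | h
  · simp only [funext (stateProb_of_neg (P := P) (N := N) h)]
    exact continuous_const
  · lift n to ℕ using h
    have h1 := (hN.regular n).1.continuousOn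
    have h2 : stateProb P N n = stateProb P N n ∘ fun t => max t 0 := by
      funext t
      have : (max t 0).toNNReal = t.toNNReal := NNReal.eq (by simp)
      simp only [Function.comp, stateProb, this]
    rw [h2]
    exact h1.comp_continuous (by fun_prop) fun t => mem_Ici.2 (le_max_right t 0)

variable [IsProbabilityMeasure P]

lemma abs_stateProb_le_one (n : ℤ) (t : ℝ) : |stateProb P N n t| ≤ 1 := by
  rw [stateProb, abs_of_nonneg measureReal_nonneg]
  exact measureReal_le_one

lemma IsCFPP.laplaceIntegrable_stateProb (hN : IsCFPP lam α P N) (n : ℤ) :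
    LaplaceIntegrable (stateProb P N n) :=
  laplaceIntegrable_of_bounded (hN.continuous_stateProb n).aestronglyMeasurable
    fun t _ => abs_stateProb_le_one n t

/-- The equation of the process in the Laplace domain. The convolutions reduce to finite sums, since
both `λ_j` and `p(n, t)` vanish at negative indices. -/
lemma IsCFPP.laplace_stateProb (hN : IsCFPP lam α P N) (hlam : IsIntensitySeq lam) (hα0 : 0 < α)
    (hα1 : α ≤ 1) {s : ℝ} (hs : 0 < s) (n : ℕ) :
    laplace (stateProb P N n) s = (if (n : ℤ) = 0 then 1 else 0) / s +
      s ^ (-α) * ∑ j ∈ Finset.range (n + 1), lam j *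
        (laplace (stateProb P N ((n : ℤ) - 1 - j)) s - laplace (stateProb P N ((n : ℤ) - j)) s) := by
  have hL := fun k => hN.laplaceIntegrable_stateProb k
  have hrhs : ∀ t, -discreteConv lam (fun k => stateProb P N k t) n +
      discreteConv lam (fun k => stateProb P N k t) ((n : ℤ) - 1) =
      ∑ j ∈ Finset.range (n + 1), lam j *
        (stateProb P N ((n : ℤ) - 1 - j) t - stateProb P N ((n : ℤ) - j) t) := by
    intro t
    have hp : ∀ k < 0, stateProb P N k t = 0 := fun k hk => stateProb_of_neg hk t
    rw [discreteConv_eq_sum hlam.neg hp (M := n + 1) (by push_cast; omega),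
      discreteConv_eq_sum hlam.neg hp (M := n + 1) (by push_cast; omega), neg_add_eq_sub,
      ← Finset.sum_sub_distrib]
    exact Finset.sum_congr rfl fun j _ => by ring
  have hsum := laplace_sum_mul (Finset.range (n + 1)) (fun j => lam j)
    (f := fun j t => stateProb P N ((n : ℤ) - 1 - j) t - stateProb P N ((n : ℤ) - j) t)
    fun j => (laplace_sub (hL _) (hL _)).1
  have hcont : Continuous fun t => ∑ j ∈ Finset.range (n + 1), lam j *
      (stateProb P N ((n : ℤ) - 1 - j) t - stateProb P N ((n : ℤ) - j) t) :=
    continuous_finsetSum _ fun j _ => continuous_const.mul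
      ((hN.continuous_stateProb _).sub (hN.continuous_stateProb _))
  rw [laplace_of_hasCaputoDerivAt hα0 (by linarith) (hN.regular n)
    (fun t ht => by rw [← hrhs t]; exact hN.equation n t ht) (fun h => absurd hα1 (not_le.2 h))
    hcont.continuousOn hsum.1 hs, hsum.2 s hs]
  congr 2
  · rcases Nat.eq_zero_or_pos n with rfl | hn
    · simpa using hN.init_zero
    · rw [if_neg (by omega)]
      exact hN.init_pos n hn
  · exact Finset.sum_congr rfl fun j _ => by rw [(laplace_sub (hL _) (hL _)).2 s hs]

/-- In the Laplace domain the fractional process is obtained from the classical one by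
`s ↦ s^α`, and this substitution is averaging over an inverse stable family. -/
lemma IsCFPP.stateProb_eq_integral {Ω' : Type*} [MeasurableSpace Ω'] {P' : Measure Ω'}
    [IsProbabilityMeasure P'] {Nα : ℝ≥0 → Ω' → ℕ} (hNα : IsCFPP lam α P' Nα)
    (hN : IsCFPP lam 1 P N) (hlam : IsIntensitySeq lam) (hα0 : 0 < α) (hα1 : α ≤ 1)
    {m : ℝ → Measure ℝ} (hm : IsInverseStableFamily α m) (n : ℕ) {t : ℝ} (ht : 0 < t) :
    stateProb P' Nα n t = ∫ x, stateProb P N n x ∂(m t) := by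
  have hq := fun k => hN.continuous_stateProb k
  have hqb := fun k : ℤ => abs_stateProb_le_one (P := P) (N := N) k
  refine eq_of_laplace_eq (hNα.laplaceIntegrable_stateProb n)
    (laplaceIntegrable_integral hm.measurable hm.isProb (hq n).measurable (hqb n))
    (fun s hs => ?_) ht.le (hNα.continuous_stateProb n).continuousWithinAt
    (hm.rightContinuous _ (hq n) ⟨1, hqb n⟩ t ht)
  rw [hm.laplace_integral (hq n).measurable (hqb n) hs]
  have hsα : 0 < s ^ α := by positivity
  refine eq_of_convolution_recursion (lam := lam) (a := fun k => laplace (stateProb P' Nα k) s)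
    (b := fun k => s ^ (α - 1) * laplace (stateProb P N k) (s ^ α))
    (c := fun k => (if k = 0 then 1 else 0) / s) (κ := s ^ (-α)) (by positivity)
    hlam.zero_pos.le (fun k hk => laplace_stateProb_of_neg hk s)
    (fun k hk => by simp only [laplace_stateProb_of_neg hk, mul_zero])
    (fun k => hNα.laplace_stateProb hlam hα0 hα1 hs k) (fun k => ?_) n
  -- the recursion for order `1` at `s ^ α`, multiplied by `s ^ (α - 1)`, is the one for order `α`
  have h := hN.laplace_stateProb hlam one_pos le_rfl hsα k
  rw [h, mul_add, Real.rpow_neg_one, Real.rpow_neg hs.le]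
  congr 1
  · rw [Real.rpow_sub hs, Real.rpow_one]
    field_simp
  · rw [mul_left_comm, Finset.mul_sum]
    congr 1
    exact Finset.sum_congr rfl fun j _ => by ring

end StateProb

/-- The approximation `(⌊(k+1) x⌋ + 1) / (k+1)` of `x` from the right by points of the grid of mesh
`1 / (k+1)`. -/
noncomputable def gridAbove (k : ℕ) (x : ℝ≥0) : ℝ≥0 := (⌊(k + 1) * x⌋₊ + 1) / (k + 1)

lemma lt_gridAbove (k : ℕ) (x : ℝ≥0) : x < gridAbove k x := by
  rw [gridAbove, lt_div_iff₀ (by positivity), mul_comm]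
  exact Nat.lt_floor_add_one _

lemma gridAbove_le (k : ℕ) (x : ℝ≥0) : gridAbove k x ≤ x + 1 / (k + 1) := by
  have h : (0 : ℝ≥0) < k + 1 := by positivity
  have e : (x + 1 / ((k : ℝ≥0) + 1)) * (k + 1) = (k + 1) * x + 1 := by
    field_simp
  rw [gridAbove, div_le_iff₀ h, e]
  gcongr
  exact Nat.floor_le (by positivity)

lemma measurable_gridAbove (k : ℕ) : Measurable (gridAbove k) := by
  unfold gridAbove
  have : Measurable fun x : ℝ≥0 => ⌊((k : ℝ≥0) + 1) * x⌋₊ :=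
    Nat.measurable_floor.comp (measurable_const.mul measurable_id)
  exact ((measurable_from_nat (f := fun i : ℕ => (i : ℝ≥0))).comp this |>.add_const 1).div_const _

lemma tendsto_gridAbove (x : ℝ≥0) : Tendsto (fun k => gridAbove k x) atTop (𝓝[≥] x) := by
  refine tendsto_nhdsWithin_iff.2
    ⟨?_, Eventually.of_forall fun k => mem_Ici.2 (lt_gridAbove k x).le⟩
  refine tendsto_of_tendsto_of_tendsto_of_le_of_le tendsto_const_nhds ?_
    (fun k => (lt_gridAbove k x).le) fun k => gridAbove_le k x
  have : Tendsto (fun k : ℕ => 1 / ((k : ℝ≥0) + 1)) atTop (𝓝 0) :=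
    tendsto_one_div_add_atTop_nhds_zero_nat
  simpa using tendsto_const_nhds.add this

section TimeChange

variable {Ω : Type*} [MeasurableSpace Ω] {P : Measure Ω} [IsProbabilityMeasure P]
  {N : ℝ≥0 → Ω → ℕ} {T : Ω → ℝ≥0}

/-- Subordination at an independent random time. Along the grid approximation the time takes
countably many values, so independence applies directly; right-continuity passes to the limit. -/
lemma stateProb_timeChange (hN : ∀ s, Measurable (N s))
    (hrc : ∀ᵐ ω ∂P, ∀ t : ℝ≥0, ContinuousWithinAt (fun s => N s ω) (Ici t) t)
    (hq : ∀ n : ℤ, Continuous (stateProb P N n)) (hT : AEMeasurable T P)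
    (hind : IndepFun (fun ω s => N s ω) T P) :
    AEMeasurable (fun ω => N (T ω) ω) P ∧ ∀ n : ℕ, P.real {ω | N (T ω) ω = n} =
      ∫ ω, stateProb P N n (T ω) ∂P := by
  have hNm : Measurable fun ω s => N s ω := measurable_pi_iff.2 hN
  have heval : ∀ k, Measurable fun p : (ℝ≥0 → ℕ) × ℝ≥0 => p.1 (gridAbove k p.2) := by
    intro k
    have h1 : Measurable fun p : (ℝ≥0 → ℕ) × ℕ => p.1 (((p.2 : ℝ≥0) + 1) / (k + 1)) :=
      measurable_from_prod_countable_left fun i =>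
      show Measurable fun f : ℝ≥0 → ℕ => f (((i : ℝ≥0) + 1) / (k + 1)) from measurable_pi_apply _
    have h2 : Measurable fun x : ℝ≥0 => ⌊((k : ℝ≥0) + 1) * x⌋₊ :=
      Nat.measurable_floor.comp (measurable_const.mul measurable_id)
    exact h1.comp (measurable_fst.prodMk (h2.comp measurable_snd))
  have hae : ∀ k, AEMeasurable (fun ω => N (gridAbove k (T ω)) ω) P := fun k =>
    (heval k).comp_aemeasurable (hNm.aemeasurable.prodMk hT)
  have hev : ∀ᵐ ω ∂P, ∀ᶠ k in atTop, N (gridAbove k (T ω)) ω = N (T ω) ω := by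
    filter_upwards [hrc] with ω h
    have := (h (T ω)).tendsto.comp (tendsto_gridAbove (T ω))
    rw [nhds_discrete, tendsto_pure] at this
    exact this
  have hlimae : AEMeasurable (fun ω => N (T ω) ω) P := by
    refine aemeasurable_of_tendsto_metrizable_ae atTop hae ?_
    filter_upwards [hev] with ω h
    exact tendsto_const_nhds.congr' (h.mono fun k hk => hk.symm)
  refine ⟨hlimae, fun n => ?_⟩
  -- the law of the pair `(N, T)` is a product, and the grid value is a function of this pair
  have hprod := (indepFun_iff_map_prod_eq_prod_map_map hNm.aemeasurable hT).1 hind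
  have hk : ∀ k, P.real {ω | N (gridAbove k (T ω)) ω = n} =
      ∫ ω, stateProb P N n (gridAbove k (T ω)) ∂P := by
    intro k
    have hset : MeasurableSet {p : (ℝ≥0 → ℕ) × ℝ≥0 | p.1 (gridAbove k p.2) = n} :=
      heval k (measurableSet_singleton n)
    have := Measure.isProbabilityMeasure_map (μ := P) hNm.aemeasurable
    have := Measure.isProbabilityMeasure_map (μ := P) hT
    have h1 : P {ω | N (gridAbove k (T ω)) ω = n} =
        ∫⁻ x, P {ω | N (gridAbove k x) ω = n} ∂(P.map T) := by
      have h2 := Measure.map_apply_of_aemeasurable (hNm.aemeasurable.prodMk hT) hset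
      rw [hprod, Measure.prod_apply_symm hset] at h2
      refine h2.symm.trans (lintegral_congr fun x => ?_)
      exact Measure.map_apply hNm (measurable_prodMk_right hset)
    have h3 : ∀ x : ℝ≥0, P {ω | N x ω = n} = ENNReal.ofReal (stateProb P N n x) := by
      intro x
      simp [stateProb]
    have hqm : Measurable fun x : ℝ≥0 => stateProb P N n (gridAbove k x) :=
      (hq n).measurable.comp (measurable_coe_nnreal_real.comp (measurable_gridAbove k))
    have hq0 : ∀ x, 0 ≤ stateProb P N n x := fun x => measureReal_nonneg
    rw [measureReal_def, h1]
    simp only [h3]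
    rw [← integral_eq_lintegral_of_nonneg_ae (ae_of_all _ fun x => hq0 _)
      hqm.aestronglyMeasurable, integral_map hT hqm.aestronglyMeasurable]
  have hl1 : Tendsto (fun k => P.real {ω | N (gridAbove k (T ω)) ω = n}) atTop
      (𝓝 (P.real {ω | N (T ω) ω = n})) := by
    have hconv : ∀ f : Ω → ℕ, AEMeasurable f P → P.real {ω | f ω = n} =
        ∫ ω, ({n} : Set ℕ).indicator (fun _ => (1 : ℝ)) (f ω) ∂P := by
      intro f hf
      have : (fun ω => ({n} : Set ℕ).indicator (fun _ => (1 : ℝ)) (f ω)) =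
          (f ⁻¹' {n}).indicator 1 := rfl
      rw [this, integral_indicator₀ (hf.nullMeasurable (measurableSet_singleton n))]
      simp [measureReal_def]
      rfl
    simp only [hconv _ (hae _), hconv _ hlimae]
    have hmi : Measurable (({n} : Set ℕ).indicator fun _ => (1 : ℝ)) := measurable_from_nat
    refine tendsto_integral_of_dominated_convergence (fun _ => 1)
      (fun k => (hmi.comp_aemeasurable (hae k)).aestronglyMeasurable) (integrable_const _)
      (fun k => ae_of_all _ fun ω => ?_) ?_
    · refine (norm_indicator_le_norm_self _ _).trans (by simp)
    · filter_upwards [hev] with ω h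
      exact tendsto_const_nhds.congr' (h.mono fun k hk => by simp only [hk])
  have hl2 : Tendsto (fun k => ∫ ω, stateProb P N n (gridAbove k (T ω)) ∂P) atTop
      (𝓝 (∫ ω, stateProb P N n (T ω) ∂P)) := by
    refine tendsto_integral_of_dominated_convergence (fun _ => 1)
      (fun k => ((hq n).measurable.comp_aemeasurable (measurable_coe_nnreal_real.comp_aemeasurable
        ((measurable_gridAbove k).comp_aemeasurable hT))).aestronglyMeasurable)
      (integrable_const _) (fun k => ae_of_all _ fun ω => abs_stateProb_le_one _ _)
      (ae_of_all _ fun ω => ?_)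
    exact ((hq n).tendsto _).comp ((NNReal.continuous_coe.tendsto _).comp
      ((tendsto_gridAbove (T ω)).mono_right nhdsWithin_le_nhds))
  simp only [hk] at hl1
  exact tendsto_nhds_unique hl1 hl2

/-- A convoluted fractional Poisson process is a convoluted Poisson process at an independent time
whose laws form an inverse stable family. -/
lemma IsCFPP.identDistrib_timeChange {lam : ℤ → ℝ} {α : ℝ} {Ω' : Type*} [MeasurableSpace Ω']
    {P' : Measure Ω'} [IsProbabilityMeasure P'] {Nα : ℝ≥0 → Ω' → ℕ} (hNα : IsCFPP lam α P' Nα)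
    (hN : IsCPP lam P N) (hlam : IsIntensitySeq lam) (hα0 : 0 < α) (hα1 : α ≤ 1)
    {m : ℝ → Measure ℝ} (hm : IsInverseStableFamily α m) {t : ℝ≥0} (ht : 0 < t)
    (hT : HasLaw (fun ω => (T ω : ℝ)) (m t) P) (hind : IndepFun (fun ω s => N s ω) T P) :
    IdentDistrib (Nα t) (fun ω => N (T ω) ω) P' P := by
  have hTm : AEMeasurable T P := by
    have := measurable_real_toNNReal.comp_aemeasurable hT.aemeasurable
    simpa [Function.comp_def] using this
  obtain ⟨h1, h2⟩ := stateProb_timeChange hN.cfpp.measurable hN.rightContinuous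
    hN.cfpp.continuous_stateProb hTm hind
  refine ⟨(hNα.measurable t).aemeasurable, h1, Measure.ext_of_singleton fun n => ?_⟩
  rw [Measure.map_apply (hNα.measurable t) (measurableSet_singleton n),
    Measure.map_apply_of_aemeasurable h1 (measurableSet_singleton n),
    ← measureReal_eq_measureReal_iff]
  have h3 := hNα.stateProb_eq_integral hN.cfpp hlam hα0 hα1 hm n (NNReal.coe_pos.2 ht)
  rw [← hT.map_eq, integral_map hT.aemeasurable
    (hN.cfpp.continuous_stateProb n).aestronglyMeasurable] at h3
  refine Eq.trans ?_ (h3.trans (h2 n).symm)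
  rw [stateProb, Real.toNNReal_coe]
  congr 1
  ext ω
  simp

end TimeChange

/-! ### Two contour integrals -/

/-- Cauchy's theorem on the strip `0 ≤ Im w ≤ θ`, for a function with exponential decay at both
ends. -/
lemma integral_eq_integral_strip_shift {G : ℂ → ℂ} {θ c K R₀ : ℝ} (hθ : 0 ≤ θ) (hc : 0 < c)
    (hG : DifferentiableOn ℂ G {w | w.im ∈ Icc 0 θ})
    (hb : ∀ y η : ℝ, η ∈ Icc 0 θ → R₀ ≤ |y| →
      ‖G (y + η * Complex.I)‖ ≤ K * Real.exp (-(c * |y|))) :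
    Integrable (fun y : ℝ => G (y + θ * Complex.I)) ∧
      ∫ y : ℝ, G (y + θ * Complex.I) = ∫ y : ℝ, G y := by
  have hline : ∀ η ∈ Icc 0 θ, Continuous fun y : ℝ => G (y + η * Complex.I) := fun η hη =>
    hG.continuousOn.comp_continuous (by fun_prop) fun y => by simpa using hη
  have hint : ∀ η ∈ Icc 0 θ, Integrable fun y : ℝ => G (y + η * Complex.I) := by
    intro η hη
    obtain ⟨M, hM⟩ := (isCompact_Icc (a := -R₀) (b := R₀)).exists_bound_of_continuousOn
      (hline η hη).continuousOn
    refine Integrable.mono' (((integrable_exp_neg_mul_abs hc).const_mul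
      (|M| * Real.exp (c * |R₀|) + |K|))) (hline η hη).aestronglyMeasurable
      (ae_of_all _ fun y => ?_)
    have hpos := Real.exp_pos (-(c * |y|))
    rcases le_total R₀ |y| with h | h
    · refine (hb y η hη h).trans (mul_le_mul_of_nonneg_right ?_ hpos.le)
      have := le_abs_self K
      have : 0 ≤ |M| * Real.exp (c * |R₀|) := by positivity
      linarith
    · have h1 := (hM y (abs_le.1 h)).trans (le_abs_self M)
      have h2 : 1 ≤ Real.exp (c * |R₀|) * Real.exp (-(c * |y|)) := by
        rw [← Real.exp_add]
        refine Real.one_le_exp ?_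
        have := mul_le_mul_of_nonneg_left (h.trans (le_abs_self R₀)) hc.le
        linarith
      calc _ ≤ |M| := h1
        _ ≤ |M| * (Real.exp (c * |R₀|) * Real.exp (-(c * |y|))) :=
          le_mul_of_one_le_right (abs_nonneg M) h2
        _ ≤ _ := by
          have : 0 ≤ |K| * Real.exp (-(c * |y|)) := by positivity
          linarith
  have hθm : θ ∈ Icc 0 θ := ⟨hθ, le_rfl⟩
  have h0m : (0 : ℝ) ∈ Icc 0 θ := ⟨le_rfl, hθ⟩
  refine ⟨hint θ hθm, ?_⟩
  have hnat : Tendsto (fun n : ℕ => (n : ℝ)) atTop atTop := tendsto_natCast_atTop_atTop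
  have hl : ∀ η ∈ Icc 0 θ, Tendsto (fun n : ℕ => ∫ y in (-(n : ℝ))..n, G (y + η * Complex.I)) atTop
      (𝓝 (∫ y : ℝ, G (y + η * Complex.I))) := fun η hη =>
    intervalIntegral_tendsto_integral (hint η hη) (tendsto_neg_atTop_atBot.comp hnat) hnat
  -- the contributions of the two vertical sides of the rectangle vanish in the limit
  have hvert : ∀ e : ℕ → ℝ, (∀ n, |e n| = n) →
      Tendsto (fun n : ℕ => ∫ y : ℝ in 0..θ, G ((e n : ℂ) + y * Complex.I)) atTop (𝓝 0) := by
    intro e he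
    have hz : Tendsto (fun n : ℕ => K * Real.exp (-(c * n)) * |θ - 0|) atTop (𝓝 0) := by
      have h1 : Tendsto (fun n : ℕ => Real.exp (-(c * n))) atTop (𝓝 0) :=
        Real.tendsto_exp_neg_atTop_nhds_zero.comp (hnat.const_mul_atTop hc)
      simpa using (h1.const_mul K).mul_const |θ - 0|
    refine squeeze_zero_norm' ?_ hz
    filter_upwards [hnat.eventually_ge_atTop R₀] with n hn
    refine intervalIntegral.norm_integral_le_of_norm_le_const fun y hy => ?_
    rw [uIoc_of_le hθ] at hy
    have := hb (e n) y ⟨hy.1.le, hy.2⟩ (by rw [he n]; exact hn)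
    rwa [he n] at this
  have hrect : ∀ n : ℕ, (∫ y in (-(n : ℝ))..n, G (y + (0 : ℝ) * Complex.I)) -
      (∫ y in (-(n : ℝ))..n, G (y + θ * Complex.I)) +
      Complex.I • (∫ y : ℝ in 0..θ, G (((n : ℝ) : ℂ) + y * Complex.I)) -
      Complex.I • (∫ y : ℝ in 0..θ, G (((-(n : ℝ) : ℝ) : ℂ) + y * Complex.I)) = 0 := by
    intro n
    have := Complex.integral_boundary_rect_eq_zero_of_differentiableOn G
      ⟨-(n : ℝ), 0⟩ ⟨n, θ⟩ (hG.mono fun w hw => by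
        have := hw.2
        simpa [uIcc_of_le hθ] using this)
    exact this
  have hlim := (((hl 0 h0m).sub (hl θ hθm)).add
    ((hvert (fun n => (n : ℝ)) (by simp)).const_smul Complex.I)).sub
    ((hvert (fun n => -(n : ℝ)) (by simp)).const_smul Complex.I)
  simp only [hrect] at hlim
  have h0 := tendsto_nhds_unique hlim tendsto_const_nhds
  simp only [smul_zero, add_zero, sub_zero, Complex.ofReal_zero, zero_mul] at h0
  exact (sub_eq_zero.1 h0).symm

/-- The integral of `2 s z / (s² - z²) dw`, `z = e^w`, along a horizontal line `Im w = θ` with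
`0 < θ < π`: a primitive is `log ((s + z) / (s - z))`, which runs from `0` to `π i` inside the upper
half plane. -/
lemma integral_two_mul_exp_div {s θ : ℝ} (hs : 0 < s) (h0 : 0 < θ) (hπ : θ < Real.pi)
    (hi : Integrable fun y : ℝ => 2 * s * Complex.exp (y + θ * Complex.I) /
      ((s - Complex.exp (y + θ * Complex.I)) * (s + Complex.exp (y + θ * Complex.I)))) :
    ∫ y : ℝ, 2 * s * Complex.exp (y + θ * Complex.I) /
      ((s - Complex.exp (y + θ * Complex.I)) * (s + Complex.exp (y + θ * Complex.I))) =
      Real.pi * Complex.I := by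
  set z : ℝ → ℂ := fun y => Complex.exp (y + θ * Complex.I) with hz
  have hsin : 0 < Real.sin θ := Real.sin_pos_of_pos_of_lt_pi h0 hπ
  have him : ∀ y, 0 < (z y).im := by
    intro y
    rw [hz]
    simp only [Complex.exp_im]
    simpa using mul_pos (Real.exp_pos y) hsin
  have hne1 : ∀ y, (s : ℂ) - z y ≠ 0 := fun y h => by
    have := congrArg Complex.im h
    simp at this
    exact (him y).ne' this
  have hne2 : ∀ y, (s : ℂ) + z y ≠ 0 := fun y h => by
    have := congrArg Complex.im h
    simp at this
    exact (him y).ne' this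
  -- the quotient stays in the upper half plane, away from the branch cut of the logarithm
  have hqim : ∀ y, 0 < (((s : ℂ) + z y) / (s - z y)).im := by
    intro y
    have hn : 0 < Complex.normSq ((s : ℂ) - z y) := Complex.normSq_pos.2 (hne1 y)
    rw [Complex.div_im, ← sub_div]
    refine div_pos ?_ hn
    simp
    nlinarith [him y]
  have hzd : ∀ y : ℝ, HasDerivAt z (z y) y := by
    intro y
    have h1 : HasDerivAt (fun y : ℝ => (y : ℂ) + θ * Complex.I) 1 y :=
      (Complex.ofRealCLM.hasDerivAt (x := y)).add_const _
    simpa using h1.cexp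
  have hderiv : ∀ y : ℝ, HasDerivAt (fun y => Complex.log (((s : ℂ) + z y) / (s - z y)))
      (2 * s * z y / ((s - z y) * (s + z y))) y := by
    intro y
    have h2 := ((hzd y).const_add (s : ℂ)).div ((hzd y).const_sub (s : ℂ)) (hne1 y)
    have h3 := h2.clog_real (Or.inr (hqim y).ne')
    convert! h3 using 1
    have a := hne1 y
    have b := hne2 y
    simp only [Pi.div_apply]
    field_simp
    ring
  have hbot : Tendsto (fun y => Complex.log (((s : ℂ) + z y) / (s - z y))) atBot (𝓝 0) := by
    have hz0 : Tendsto z atBot (𝓝 0) := by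
      refine tendsto_zero_iff_norm_tendsto_zero.2 ?_
      have : (fun y => ‖z y‖) = Real.exp := by
        funext y; rw [hz]; simp [Complex.norm_exp]
      rw [this]
      exact Real.tendsto_exp_atBot
    have hsC : (s : ℂ) ≠ 0 := by exact_mod_cast hs.ne'
    have h1 : Tendsto (fun y => ((s : ℂ) + z y) / (s - z y)) atBot (𝓝 1) := by
      have : Tendsto (fun y => ((s : ℂ) + z y) / (s - z y)) atBot (𝓝 ((s + 0) / (s - 0))) :=
        (hz0.const_add (s : ℂ)).div (hz0.const_sub (s : ℂ)) (by simpa using hsC)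
      simpa [hsC] using this
    have := h1.clog (by simp)
    simpa using this
  have htop : Tendsto (fun y => Complex.log (((s : ℂ) + z y) / (s - z y))) atTop
      (𝓝 (Real.pi * Complex.I)) := by
    have hz0 : Tendsto (fun y => (z y)⁻¹) atTop (𝓝 0) := by
      refine tendsto_zero_iff_norm_tendsto_zero.2 ?_
      have : (fun y => ‖(z y)⁻¹‖) = fun y => Real.exp (-y) := by
        funext y; rw [hz]; simp [Complex.norm_exp, Real.exp_neg]
      rw [this]
      exact Real.tendsto_exp_neg_atTop_nhds_zero
    have h1 : Tendsto (fun y => ((s : ℂ) + z y) / (s - z y)) atTop (𝓝 (-1)) := by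
      have := ((hz0.const_mul (s : ℂ)).add_const 1).div ((hz0.const_mul (s : ℂ)).sub_const 1)
        (by simp)
      simp only [mul_zero, zero_add, zero_sub] at this
      rw [one_div, inv_neg, inv_one] at this
      refine this.congr fun y => ?_
      have hzy : z y ≠ 0 := Complex.exp_ne_zero _
      simp only [Pi.div_apply]
      rw [← div_eq_mul_inv, div_add_one hzy, div_sub_one hzy, div_div_div_cancel_right₀ hzy]
    have h2 : Tendsto (fun y => ((s : ℂ) + z y) / (s - z y)) atTop
        (𝓝[{w : ℂ | 0 ≤ w.im}] (-1)) :=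
      tendsto_nhdsWithin_iff.2 ⟨h1, Eventually.of_forall fun y => (hqim y).le⟩
    have h3 := (Complex.continuousWithinAt_log_of_re_neg_of_im_zero (z := -1) (by simp)
      (by simp)).tendsto.comp h2
    rw [Complex.log_neg_one] at h3
    exact h3
  have := integral_of_hasDerivAt_of_tendsto hderiv hi hbot htop
  rw [this, sub_zero]

/-! ### A residue computation -/

/-- The residue computation behind the inverse Laplace transform of `s^(α-1) e^{-x s^α}`, in the
coordinate `w = log z`. The pole at `w = log s` is removed by subtracting a multiple of
`2 s z / (s² - z²)`; what is left is holomorphic on the strip, decays at both ends and is real on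
the real axis, so it contributes nothing to the imaginary part. -/
lemma im_integral_exp_div {α θ x s : ℝ} (hα0 : 0 < α) (hα1 : α < 1) (hθ0 : 0 < θ)
    (hθπ : θ < Real.pi) (hαθ : α * θ < Real.pi / 2) (hx : 0 < x) (hs : 0 < s)
    (hi : Integrable fun y : ℝ => Complex.exp (α * (y + θ * Complex.I)) *
      Complex.exp (-(x * Complex.exp (α * (y + θ * Complex.I)))) /
        (s - Complex.exp (y + θ * Complex.I))) :
    (∫ y : ℝ, Complex.exp (α * (y + θ * Complex.I)) *
      Complex.exp (-(x * Complex.exp (α * (y + θ * Complex.I)))) /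
        (s - Complex.exp (y + θ * Complex.I))).im =
      Real.pi * (s ^ (α - 1) * Real.exp (-(x * s ^ α))) := by
  set M : ℂ → ℂ := fun w => Complex.exp (α * w) * Complex.exp (-(x * Complex.exp (α * w))) with hM
  set M₀ : ℝ := s ^ α * Real.exp (-(x * s ^ α)) with hM₀
  have hM₀pos : 0 < M₀ := by rw [hM₀]; positivity
  set Q : ℂ → ℂ := fun w => M w - 2 * M₀ * Complex.exp w / (s + Complex.exp w) with hQ
  set E : ℂ → ℂ := fun w => s - Complex.exp w with hE
  set w₀ : ℂ := (Real.log s : ℂ) with hw₀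
  set S : Set ℂ := {w | w.im ∈ Ioo (-Real.pi) Real.pi} with hS
  have hsC : (s : ℂ) ≠ 0 := by exact_mod_cast hs.ne'
  have hexp₀ : Complex.exp w₀ = s := by
    rw [hw₀, ← Complex.ofReal_exp, Real.exp_log hs]
  have hpi := Real.pi_pos
  have hSo : IsOpen S := isOpen_Ioo.preimage Complex.continuous_im
  have hw₀S : w₀ ∈ S := by
    simp only [hS, hw₀, mem_ofPred_eq, Complex.ofReal_im]
    exact ⟨by linarith, hpi⟩
  have hplus : ∀ w ∈ S, (s : ℂ) + Complex.exp w ≠ 0 := by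
    intro w hw h
    have h1 : Complex.exp w = Complex.exp (w₀ + Real.pi * Complex.I) := by
      rw [Complex.exp_add, hexp₀, Complex.exp_pi_mul_I]
      linear_combination h
    have h2 := Complex.exp_inj_of_neg_pi_lt_of_le_pi hw.1 hw.2.le
      (by simp [hw₀]; linarith) (by simp [hw₀]) h1
    have h3 := hw.2
    rw [h2] at h3
    simp [hw₀] at h3
  have hEne : ∀ w ∈ S, w ≠ w₀ → E w ≠ 0 := by
    intro w hw hne h
    refine hne (Complex.exp_inj_of_neg_pi_lt_of_le_pi hw.1 hw.2.le hw₀S.1 hw₀S.2.le ?_)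
    rw [hexp₀]
    exact (sub_eq_zero.1 h).symm
  have hE₀ : E w₀ = 0 := by simp only [hE, hexp₀, sub_self]
  have hαw₀ : Complex.exp (α * w₀) = ((s ^ α : ℝ) : ℂ) := by
    rw [hw₀, ← Complex.ofReal_mul, ← Complex.ofReal_exp, mul_comm α, ← Real.rpow_def_of_pos hs]
  have hQ₀ : Q w₀ = 0 := by
    simp only [hQ, hM, hexp₀, hαw₀, hM₀]
    push_cast
    field_simp
    ring
  have hQd : DifferentiableOn ℂ Q S := by
    refine DifferentiableOn.sub (by fun_prop) (DifferentiableOn.div (by fun_prop) (by fun_prop) ?_)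
    exact hplus
  have hEd : DifferentiableOn ℂ E S := by fun_prop
  have hEderiv : deriv E w₀ = -s := by
    exact ((Complex.hasDerivAt_exp w₀).const_sub (s : ℂ)).deriv.trans (by rw [hexp₀])
  have hnhds : S ∈ 𝓝 w₀ := hSo.mem_nhds hw₀S
  -- `Q / E` with its removable singularity at `w₀` filled in
  set Δ : ℂ → ℂ := fun w => dslope Q w₀ w / dslope E w₀ w with hΔ
  have hΔne : ∀ w, w ≠ w₀ → Δ w = Q w / E w := by
    intro w hw
    have h1 : w - w₀ ≠ 0 := sub_ne_zero.2 hw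
    simp only [hΔ]
    rw [dslope_of_ne _ hw, dslope_of_ne _ hw, slope_def_field, slope_def_field, hQ₀, hE₀, sub_zero,
      sub_zero, div_div_div_cancel_right₀ h1]
  have hΔd : DifferentiableOn ℂ Δ S := by
    refine ((Complex.differentiableOn_dslope hnhds).2 hQd).div
      ((Complex.differentiableOn_dslope hnhds).2 hEd) fun w hw => ?_
    by_cases h : w = w₀
    · rw [h, dslope_same, hEderiv]
      exact neg_ne_zero.2 hsC
    · rw [dslope_of_ne _ h, slope_def_field, hE₀, sub_zero]
      exact div_ne_zero (hEne w hw h) (sub_ne_zero.2 h)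
  have hstrip : {w : ℂ | w.im ∈ Icc 0 θ} ⊆ S := fun w hw =>
    ⟨by linarith [hw.1], hw.2.trans_lt hθπ⟩
  set B := Real.cos (α * θ) with hB
  have hBpos : 0 < B := Real.cos_pos_of_mem_Ioo ⟨by nlinarith, hαθ⟩
  have hnormexp : ∀ y η : ℝ, ‖Complex.exp (y + η * Complex.I)‖ = Real.exp y := by
    intro y η
    simp [Complex.norm_exp]
  have hMnorm : ∀ y η : ℝ, η ∈ Icc 0 θ → ‖M (y + η * Complex.I)‖ ≤
      Real.exp (α * y) * Real.exp (-(x * (Real.exp (α * y) * B))) := by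
    intro y η hη
    have e1 : (α : ℂ) * (y + η * Complex.I) = ((α * y : ℝ) : ℂ) + ((α * η : ℝ) : ℂ) * Complex.I := by
      push_cast; ring
    simp only [hM]
    rw [norm_mul, e1, hnormexp, Complex.norm_exp]
    refine mul_le_mul_of_nonneg_left (Real.exp_le_exp.2 ?_) (Real.exp_pos _).le
    have e2 : (-((x : ℂ) * Complex.exp (((α * y : ℝ) : ℂ) + ((α * η : ℝ) : ℂ) * Complex.I))).re =
        -(x * (Real.exp (α * y) * Real.cos (α * η))) := by
      rw [Complex.neg_re, Complex.re_ofReal_mul, Complex.exp_re]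
      simp
    rw [e2]
    have hcos : B ≤ Real.cos (α * η) :=
      Real.cos_le_cos_of_nonneg_of_le_pi (mul_nonneg hα0.le hη.1) (by linarith)
        (mul_le_mul_of_nonneg_left hη.2 hα0.le)
    have := mul_le_mul_of_nonneg_left (mul_le_mul_of_nonneg_left hcos (Real.exp_pos (α * y)).le)
      hx.le
    linarith
  have hbound : ∀ y η : ℝ, η ∈ Icc 0 θ → |Real.log s| + Real.log 2 ≤ |y| →
      ‖Δ (y + η * Complex.I)‖ ≤
        (2 * (1 / (x * B) + 4 * M₀) + 2 / s * (1 + 4 * M₀ / s)) * Real.exp (-(α * |y|)) := by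
    intro y η hη hy
    have hlog2 : 0 < Real.log 2 := Real.log_pos one_lt_two
    have hey := Real.exp_pos y
    set z := Complex.exp (y + η * Complex.I) with hz
    have hzn : ‖z‖ = Real.exp y := hnormexp y η
    have hwne : (y + η * Complex.I : ℂ) ≠ w₀ := by
      intro h
      have h1 := congrArg Complex.re h
      simp [hw₀] at h1
      rw [h1] at hy
      linarith
    rw [hΔne _ hwne, norm_div]
    have hs1 : ‖(s : ℂ)‖ = s := by rw [Complex.norm_real, Real.norm_of_nonneg hs.le]
    have hQn : ‖Q (y + η * Complex.I)‖ ≤ ‖M (y + η * Complex.I)‖ +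
        2 * M₀ * Real.exp y / ‖(s : ℂ) + z‖ := by
      refine (norm_sub_le _ _).trans (add_le_add_right (le_of_eq ?_) _)
      rw [norm_div, norm_mul, norm_mul, hzn, Complex.norm_real, Real.norm_of_nonneg hM₀pos.le,
        Complex.norm_ofNat]
    have hA1 : 0 ≤ 2 / s * (1 + 4 * M₀ / s) := by positivity
    have hA2 : 0 ≤ 2 * (1 / (x * B) + 4 * M₀) := by positivity
    have hMle := hMnorm y η hη
    -- to the right `|s ± z| ≥ e^y / 2` and `e^{-x e^{α y} B}` absorbs `e^{α y}`; to the left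
    -- `|s ± z| ≥ s / 2` and `Q` is of order `e^{α y}`
    rcases le_total 0 y with hy0 | hy0
    · rw [abs_of_nonneg hy0] at hy ⊢
      have h2s : 2 * s ≤ Real.exp y := by
        rw [← Real.exp_log (by positivity : 0 < 2 * s), Real.log_mul two_ne_zero hs.ne']
        exact Real.exp_le_exp.2 (by linarith [le_abs_self (Real.log s)])
      have hd1 : Real.exp y / 2 ≤ ‖(s : ℂ) + z‖ := by
        have := norm_sub_le ((s : ℂ) + z) s
        rw [add_sub_cancel_left, hzn, hs1] at this
        linarith
      have hd2 : Real.exp y / 2 ≤ ‖E (y + η * Complex.I)‖ := by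
        have := norm_sub_norm_le z s
        rw [hzn, hs1, norm_sub_rev] at this
        change _ ≤ ‖(s : ℂ) - z‖
        linarith
      have hM1 : ‖M (y + η * Complex.I)‖ ≤ 1 / (x * B) := by
        refine hMle.trans ?_
        rw [le_div_iff₀ (by positivity), Real.exp_neg (x * _)]
        have h3 := Real.add_one_le_exp (x * (Real.exp (α * y) * B))
        have h4 : 0 < Real.exp (x * (Real.exp (α * y) * B)) := Real.exp_pos _
        rw [← div_eq_mul_inv, div_mul_eq_mul_div, div_le_one h4]
        linarith
      have hC1 : 2 * M₀ * Real.exp y / ‖(s : ℂ) + z‖ ≤ 4 * M₀ := by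
        rw [div_le_iff₀ (by linarith)]
        have := mul_le_mul_of_nonneg_left hd1 (by positivity : 0 ≤ 4 * M₀)
        linarith
      calc _ ≤ (1 / (x * B) + 4 * M₀) / (Real.exp y / 2) :=
            div_le_div₀ (by positivity) (by linarith) (by positivity) hd2
        _ = 2 * (1 / (x * B) + 4 * M₀) * Real.exp (-y) := by
          rw [Real.exp_neg]; field_simp
        _ ≤ 2 * (1 / (x * B) + 4 * M₀) * Real.exp (-(α * y)) :=
          mul_le_mul_of_nonneg_left (Real.exp_le_exp.2 (by nlinarith)) hA2
        _ ≤ _ := mul_le_mul_of_nonneg_right (by linarith) (Real.exp_pos _).le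
    · rw [abs_of_nonpos hy0] at hy ⊢
      have h2s : Real.exp y ≤ s / 2 := by
        rw [← Real.exp_log (by positivity : 0 < s / 2), Real.log_div hs.ne' two_ne_zero]
        exact Real.exp_le_exp.2 (by linarith [neg_abs_le (Real.log s)])
      have hd1 : s / 2 ≤ ‖(s : ℂ) + z‖ := by
        have := norm_sub_le ((s : ℂ) + z) z
        rw [add_sub_cancel_right, hzn, hs1] at this
        linarith
      have hd2 : s / 2 ≤ ‖E (y + η * Complex.I)‖ := by
        have := norm_sub_norm_le (s : ℂ) z
        rw [hzn, hs1] at this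
        change _ ≤ ‖(s : ℂ) - z‖
        linarith
      have hey2 : Real.exp y ≤ Real.exp (α * y) := Real.exp_le_exp.2 (by nlinarith)
      have hM1 : ‖M (y + η * Complex.I)‖ ≤ Real.exp (α * y) := by
        refine hMle.trans (mul_le_of_le_one_right (Real.exp_pos _).le ?_)
        refine Real.exp_le_one_iff.2 ?_
        have : 0 ≤ x * (Real.exp (α * y) * B) := by positivity
        linarith
      have hC1 : 2 * M₀ * Real.exp y / ‖(s : ℂ) + z‖ ≤ 4 * M₀ / s * Real.exp (α * y) := by
        calc _ ≤ 2 * M₀ * Real.exp (α * y) / (s / 2) :=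
              div_le_div₀ (by positivity) (mul_le_mul_of_nonneg_left hey2 (by positivity))
                (by positivity) hd1
          _ = _ := by field_simp; ring
      calc _ ≤ (Real.exp (α * y) + 4 * M₀ / s * Real.exp (α * y)) / (s / 2) :=
            div_le_div₀ (by positivity) (by linarith) (by positivity) hd2
        _ = 2 / s * (1 + 4 * M₀ / s) * Real.exp (-(α * -y)) := by
          rw [mul_neg, neg_neg]; field_simp
        _ ≤ _ := mul_le_mul_of_nonneg_right (by linarith) (Real.exp_pos _).le
  obtain ⟨hΔi, hΔeq⟩ := integral_eq_integral_strip_shift hθ0.le hα0 (hΔd.mono hstrip) hbound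
  have hline : ∀ y : ℝ, Δ (y + θ * Complex.I) = M (y + θ * Complex.I) /
      (s - Complex.exp (y + θ * Complex.I)) - (M₀ / s : ℂ) *
      (2 * s * Complex.exp (y + θ * Complex.I) /
      ((s - Complex.exp (y + θ * Complex.I)) * (s + Complex.exp (y + θ * Complex.I)))) := by
    intro y
    have hmem : (y + θ * Complex.I : ℂ) ∈ S := hstrip (by simpa using hθ0.le)
    have hwne : (y + θ * Complex.I : ℂ) ≠ w₀ := by
      intro h
      have h1 := congrArg Complex.im h
      simp [hw₀] at h1
      exact hθ0.ne' h1
    have h1 := hplus _ hmem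
    have h2 := hEne _ hmem hwne
    rw [hΔne _ hwne]
    simp only [hQ, hE] at h2 ⊢
    field_simp
  have hk : (M₀ / s : ℂ) ≠ 0 := div_ne_zero (by exact_mod_cast hM₀pos.ne') hsC
  have hCi : Integrable fun y : ℝ => 2 * s * Complex.exp (y + θ * Complex.I) /
      ((s - Complex.exp (y + θ * Complex.I)) * (s + Complex.exp (y + θ * Complex.I))) := by
    have := ((hi.sub hΔi).const_mul (M₀ / s : ℂ)⁻¹)
    refine this.congr (ae_of_all _ fun y => ?_)
    simp only [Pi.sub_apply, hline y, hM]
    rw [sub_sub_cancel, inv_mul_cancel_left₀ hk]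
  -- on the real axis `Δ` is real, so its integral does not contribute to the imaginary part
  have hreal : ∃ R : ℝ, ∫ y : ℝ, Δ y = R := by
    refine ⟨∫ y : ℝ, (Real.exp (α * y) * Real.exp (-(x * Real.exp (α * y))) -
      2 * M₀ * Real.exp y / (s + Real.exp y)) / (s - Real.exp y), ?_⟩
    rw [← integral_complex_ofReal]
    refine integral_congr_ae ?_
    have hne : ∀ᵐ y ∂(volume : Measure ℝ), y ≠ Real.log s := by simp [ae_iff, measure_singleton]
    filter_upwards [hne] with y hy
    rw [hΔne _ (by rw [hw₀]; exact_mod_cast hy)]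
    simp only [hQ, hM, hE]
    push_cast
    rfl
  obtain ⟨R, hR⟩ := hreal
  have hN : ∀ y : ℝ, M (y + θ * Complex.I) / (s - Complex.exp (y + θ * Complex.I)) =
      Δ (y + θ * Complex.I) + (M₀ / s : ℂ) * (2 * s * Complex.exp (y + θ * Complex.I) /
      ((s - Complex.exp (y + θ * Complex.I)) * (s + Complex.exp (y + θ * Complex.I)))) := by
    intro y
    rw [hline y, sub_add_cancel]
  have hfinal : ∫ y : ℝ, M (y + θ * Complex.I) / (s - Complex.exp (y + θ * Complex.I)) =
      R + (M₀ / s : ℂ) * (Real.pi * Complex.I) := by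
    simp only [hN]
    rw [integral_add hΔi (hCi.const_mul _), integral_const_mul, hΔeq, hR,
      integral_two_mul_exp_div hs hθ0 hθπ hCi]
  refine (congrArg Complex.im hfinal).trans ?_
  have : (R : ℂ) + (M₀ / s : ℂ) * (Real.pi * Complex.I) =
      (R : ℂ) + ((M₀ / s * Real.pi : ℝ) : ℂ) * Complex.I := by push_cast; ring
  rw [this]
  simp only [Complex.add_im, Complex.ofReal_im, Complex.im_ofReal_mul, Complex.I_im, zero_add,
    mul_one]
  rw [hM₀, Real.rpow_sub hs, Real.rpow_one]
  ring

/-! ### The inverse Laplace transform as an integral along a ray -/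

/-- The integrand `z^{α-1} e^{tz - |x| z^α} dz / dr` on the ray `z = r e^{iθ}`, that is
`r^{α-1} e^{iαθ} exp (t r e^{iθ} - |x| r^α e^{iαθ})`. -/
noncomputable def rayIntegrand (α θ x t r : ℝ) : ℂ :=
  ((r ^ (α - 1) : ℝ) : ℂ) * (Complex.exp (((α * θ : ℝ) : ℂ) * Complex.I) *
    Complex.exp ((t * r : ℝ) * Complex.exp (θ * Complex.I) -
      (|x| * r ^ α : ℝ) * Complex.exp (((α * θ : ℝ) : ℂ) * Complex.I)))

/-- The density on `(0, ∞)` of the folded solution, extended evenly in `x`. The integrals of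
`z^{α-1} e^{tz - |x| z^α}` along the rays `r e^{±iθ}` are complex conjugates of each other, so the
contour integral reduces to an imaginary part. -/
noncomputable def rayDensity (α θ x t : ℝ) : ℝ :=
  Real.pi⁻¹ * (∫ r in Ioi (0 : ℝ), rayIntegrand α θ x t r).im

/-- An angle for which both `e^{t z}` and `e^{-x z^α}` decay along the ray `arg z = θ`. -/
structure IsAdmissibleAngle (α θ : ℝ) : Prop where
  pos : 0 < α
  lt_one : α < 1
  pi_div_two_lt : Real.pi / 2 < θ
  lt_pi : θ < Real.pi
  mul_lt : α * θ < Real.pi / 2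

lemma exists_isAdmissibleAngle {α : ℝ} (h0 : 0 < α) (h1 : α < 1) : ∃ θ, IsAdmissibleAngle α θ := by
  have hpi := Real.pi_pos
  have h2 : Real.pi / 2 < min Real.pi (Real.pi / 2 / α) := by
    refine lt_min (by linarith) ?_
    rw [lt_div_iff₀ h0]
    nlinarith
  obtain ⟨θ, hθ1, hθ2⟩ := exists_between h2
  refine ⟨θ, h0, h1, hθ1, hθ2.trans_le (min_le_left _ _), ?_⟩
  have := hθ2.trans_le (min_le_right _ _)
  rw [lt_div_iff₀ h0] at this
  linarith

lemma rayDensity_abs (α θ x t : ℝ) : rayDensity α θ |x| t = rayDensity α θ x t := by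
  simp only [rayDensity, rayIntegrand, abs_abs]

lemma integrableOn_rpow_mul_exp {α c : ℝ} (h0 : 0 < α) (hc : 0 < c) :
    IntegrableOn (fun r : ℝ => r ^ (α - 1) * Real.exp (-(c * r))) (Ioi 0) := by
  refine Integrable.of_integral_ne_zero ?_
  rw [Real.integral_rpow_mul_exp_neg_mul_Ioi h0 hc]
  have := Real.Gamma_pos_of_pos h0
  positivity

lemma integrableOn_rpow_mul_exp_rpow {α c : ℝ} (h0 : 0 < α) (hc : 0 < c) :
    IntegrableOn (fun r : ℝ => r ^ (α - 1) * Real.exp (-c * r ^ α)) (Ioi 0) := by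
  refine Integrable.of_integral_ne_zero ?_
  rw [integral_rpow_mul_exp_neg_mul_rpow h0 (by linarith) hc]
  have := Real.Gamma_pos_of_pos (show 0 < (α - 1 + 1) / α by
    rw [sub_add_cancel]; exact div_pos h0 h0)
  positivity

lemma measurable_rayIntegrand (α θ x : ℝ) :
    Measurable fun p : ℝ × ℝ => rayIntegrand α θ x p.1 p.2 := by
  unfold rayIntegrand
  fun_prop

namespace IsAdmissibleAngle

variable {α θ : ℝ}

lemma cos_neg (h : IsAdmissibleAngle α θ) : 0 < -Real.cos θ :=
  neg_pos.2 (Real.cos_neg_of_pi_div_two_lt_of_lt h.pi_div_two_lt (by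
    have := h.lt_pi; have := Real.pi_pos; linarith))

lemma cos_mul_pos (h : IsAdmissibleAngle α θ) : 0 < Real.cos (α * θ) := by
  refine Real.cos_pos_of_mem_Ioo ⟨?_, h.mul_lt⟩
  have := mul_pos h.pos (lt_trans (by positivity) h.pi_div_two_lt : 0 < θ)
  have := Real.pi_pos
  linarith

lemma norm_rayIntegrand (x t : ℝ) {r : ℝ} (hr : 0 < r) : ‖rayIntegrand α θ x t r‖ =
    r ^ (α - 1) * Real.exp (t * r * Real.cos θ - |x| * r ^ α * Real.cos (α * θ)) := by
  rw [rayIntegrand, norm_mul, norm_mul, Complex.norm_exp_ofReal_mul_I, one_mul, Complex.norm_exp,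
    Complex.norm_real, Real.norm_of_nonneg (by positivity), Complex.sub_re, Complex.re_ofReal_mul,
    Complex.re_ofReal_mul, Complex.exp_ofReal_mul_I_re, Complex.exp_ofReal_mul_I_re]

lemma norm_rayIntegrand_le (h : IsAdmissibleAngle α θ) (x : ℝ) {t t₀ r : ℝ} (ht : t₀ ≤ t)
    (hr : 0 < r) :
    ‖rayIntegrand α θ x t r‖ ≤ r ^ (α - 1) * Real.exp (-(t₀ * -Real.cos θ * r)) := by
  rw [norm_rayIntegrand x t hr]
  refine mul_le_mul_of_nonneg_left (Real.exp_le_exp.2 ?_) (by positivity)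
  have h1 : 0 ≤ |x| * r ^ α * Real.cos (α * θ) := by
    have := h.cos_mul_pos; positivity
  have h2 := mul_le_mul_of_nonneg_right ht (mul_pos hr h.cos_neg).le
  linarith

lemma continuousAt_rayDensity (h : IsAdmissibleAngle α θ) (x₀ : ℝ) {t₀ : ℝ} (ht : 0 < t₀) :
    ContinuousAt (fun z : ℝ × ℝ => rayDensity α θ z.1 z.2) (x₀, t₀) := by
  refine continuousAt_const.mul (Complex.continuous_im.continuousAt.comp ?_)
  refine continuousAt_of_dominated
    (bound := fun r => r ^ (α - 1) * Real.exp (-(t₀ / 2 * -Real.cos θ * r)))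
    (Eventually.of_forall fun z => ?_) ?_
    (integrableOn_rpow_mul_exp h.pos (mul_pos (half_pos ht) h.cos_neg)) (ae_of_all _ fun r => ?_)
  · exact ((measurable_rayIntegrand α θ z.1).comp measurable_prodMk_left).aestronglyMeasurable
  · have : ∀ᶠ z : ℝ × ℝ in 𝓝 (x₀, t₀), t₀ / 2 < z.2 :=
      continuousAt_snd.eventually (lt_mem_nhds (half_lt_self ht))
    filter_upwards [this] with z hz
    filter_upwards [ae_restrict_mem measurableSet_Ioi] with r hr
    exact h.norm_rayIntegrand_le z.1 hz.le hr
  · unfold rayIntegrand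
    fun_prop

lemma continuous_rayDensity_left (h : IsAdmissibleAngle α θ) {t : ℝ} (ht : 0 < t) :
    Continuous fun x => rayDensity α θ x t :=
  continuous_iff_continuousAt.2 fun x =>
    (h.continuousAt_rayDensity x ht).comp (f := fun x => (x, t)) (by fun_prop)

lemma abs_rayDensity_le (h : IsAdmissibleAngle α θ) (x : ℝ) {t : ℝ} (ht : 0 < t) :
    |rayDensity α θ x t| ≤
      Real.pi⁻¹ * ((1 / -Real.cos θ) ^ α * Real.Gamma α) * t ^ (-α) := by
  have hA := h.cos_neg
  have h1 : ‖∫ r in Ioi (0 : ℝ), rayIntegrand α θ x t r‖ ≤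
      (1 / (t * -Real.cos θ)) ^ α * Real.Gamma α := by
    rw [← Real.integral_rpow_mul_exp_neg_mul_Ioi h.pos (mul_pos ht hA)]
    refine norm_integral_le_of_norm_le (integrableOn_rpow_mul_exp h.pos (mul_pos ht hA)) ?_
    filter_upwards [ae_restrict_mem measurableSet_Ioi] with r hr
    exact h.norm_rayIntegrand_le x le_rfl hr
  have h2 : (1 / (t * -Real.cos θ)) ^ α = t ^ (-α) * (1 / -Real.cos θ) ^ α := by
    rw [Real.rpow_neg ht.le, ← Real.inv_rpow ht.le, ← Real.mul_rpow (by positivity) (by positivity)]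
    congr 1
    field_simp
  rw [rayDensity, abs_mul, abs_of_pos (inv_pos.2 Real.pi_pos), mul_assoc]
  refine mul_le_mul_of_nonneg_left ?_ (inv_pos.2 Real.pi_pos).le
  refine (Complex.abs_im_le_norm _).trans (h1.trans (le_of_eq ?_))
  rw [h2]
  ring

end IsAdmissibleAngle

lemma integral_Ioi_eq_integral_exp (g : ℝ → ℂ) :
    ∫ r in Ioi (0 : ℝ), g r = ∫ y : ℝ, (Real.exp y : ℂ) * g (Real.exp y) := by
  have := integral_image_eq_integral_abs_deriv_smul MeasurableSet.univ
    (fun x _ => (Real.hasDerivAt_exp x).hasDerivWithinAt) Real.exp_injective.injOn g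
  rw [image_univ, Real.range_exp, Measure.restrict_univ] at this
  rw [this]
  simp only [abs_of_pos (Real.exp_pos _), Complex.real_smul]

lemma integrable_exp_mul_comp_exp {g : ℝ → ℂ} (hg : IntegrableOn g (Ioi 0)) :
    Integrable fun y : ℝ => (Real.exp y : ℂ) * g (Real.exp y) := by
  have := (integrableOn_image_iff_integrableOn_abs_deriv_smul MeasurableSet.univ
    (fun x _ => (Real.hasDerivAt_exp x).hasDerivWithinAt) Real.exp_injective.injOn g).1
    (by rwa [image_univ, Real.range_exp])
  rw [integrableOn_univ] at this
  simpa only [abs_of_pos (Real.exp_pos _), Complex.real_smul] using this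

namespace IsAdmissibleAngle

variable {α θ : ℝ}

/-- The contour integral inverts the Laplace transform: integrating in time first gives the Cauchy
kernel `1 / (s - z)`, and the remaining integral is a residue. -/
lemma laplace_rayDensity (h : IsAdmissibleAngle α θ) {x : ℝ} (hx : x ≠ 0) {s : ℝ} (hs : 0 < s) :
    IntegrableOn (fun t => Real.exp (-(s * t)) * rayDensity α θ x t) (Ioi 0) ∧
      laplace (rayDensity α θ x) s = s ^ (α - 1) * Real.exp (-(|x| * s ^ α)) := by
  have hx' : 0 < |x| := abs_pos.2 hx
  have hpi := Real.pi_pos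
  have hA := h.cos_neg
  have hB := h.cos_mul_pos
  set F : ℝ → ℝ → ℂ := fun t r => (Real.exp (-(s * t)) : ℂ) * rayIntegrand α θ x t r with hF
  have hFm : Measurable (Function.uncurry F) :=
    (by fun_prop : Measurable fun p : ℝ × ℝ => (Real.exp (-(s * p.1)) : ℂ)).mul
      (measurable_rayIntegrand α θ x)
  have hFi : Integrable (Function.uncurry F)
      ((volume.restrict (Ioi (0 : ℝ))).prod (volume.restrict (Ioi (0 : ℝ)))) := by
    have hdom := Integrable.mul_prod (integrableOn_exp_neg_mul_Ioi hs)
      (integrableOn_rpow_mul_exp_rpow h.pos (mul_pos hx' hB))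
    refine Integrable.mono' hdom hFm.aestronglyMeasurable ?_
    rw [Measure.prod_restrict]
    filter_upwards [ae_restrict_mem (measurableSet_Ioi.prod measurableSet_Ioi)] with p hp
    have ht : 0 < p.1 := hp.1
    have hr : 0 < p.2 := hp.2
    simp only [Function.uncurry, hF]
    rw [norm_mul, norm_rayIntegrand x p.1 hr, Complex.norm_real,
      Real.norm_of_nonneg (Real.exp_pos _).le]
    refine mul_le_mul_of_nonneg_left (mul_le_mul_of_nonneg_left (Real.exp_le_exp.2 ?_)
      (by positivity)) (Real.exp_pos _).le
    have := mul_pos (mul_pos ht hr) hA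
    linarith
  have hFt : ∀ t, (Real.exp (-(s * t)) : ℝ) * rayDensity α θ x t =
      Real.pi⁻¹ * (∫ r in Ioi (0 : ℝ), F t r).im := by
    intro t
    rw [rayDensity, hF, integral_const_mul, Complex.im_ofReal_mul]
    ring
  have hTi : Integrable (fun t => ∫ r in Ioi (0 : ℝ), F t r) (volume.restrict (Ioi 0)) :=
    hFi.integral_prod_left
  refine ⟨?_, ?_⟩
  · simp only [hFt]
    exact (Complex.imCLM.integrable_comp hTi).const_mul _
  set g : ℝ → ℂ := fun r => ((r ^ (α - 1) : ℝ) : ℂ) * (Complex.exp (((α * θ : ℝ) : ℂ) * Complex.I) *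
    Complex.exp (-((|x| * r ^ α : ℝ) * Complex.exp (((α * θ : ℝ) : ℂ) * Complex.I)))) /
      (s - r * Complex.exp (θ * Complex.I)) with hg
  have hinner : ∀ r ∈ Ioi (0 : ℝ), ∫ t in Ioi (0 : ℝ), F t r = g r := by
    intro r hr
    have hr : 0 < r := hr
    set c : ℂ := s - r * Complex.exp (θ * Complex.I) with hc
    have hre : (-c).re < 0 := by
      rw [hc, Complex.neg_re, Complex.sub_re, Complex.re_ofReal_mul, Complex.exp_ofReal_mul_I_re,
        Complex.ofReal_re]
      have := mul_pos hr hA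
      linarith
    have h1 := integral_exp_mul_complex_Ioi hre 0
    rw [Complex.ofReal_zero, mul_zero, Complex.exp_zero, neg_div_neg_eq] at h1
    have e : ∀ t : ℝ, F t r = ((r ^ (α - 1) : ℝ) : ℂ) *
        (Complex.exp (((α * θ : ℝ) : ℂ) * Complex.I) *
        Complex.exp (-((|x| * r ^ α : ℝ) * Complex.exp (((α * θ : ℝ) : ℂ) * Complex.I)))) *
        Complex.exp (-c * t) := by
      intro t
      simp only [hF, rayIntegrand, hc]
      have hsplit : Complex.exp ((t * r : ℝ) * Complex.exp (θ * Complex.I) -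
          (|x| * r ^ α : ℝ) * Complex.exp (((α * θ : ℝ) : ℂ) * Complex.I)) *
          (Real.exp (-(s * t)) : ℂ) =
          Complex.exp (-((|x| * r ^ α : ℝ) * Complex.exp (((α * θ : ℝ) : ℂ) * Complex.I))) *
            Complex.exp (-(s - r * Complex.exp (θ * Complex.I)) * t) := by
        rw [Complex.ofReal_exp, ← Complex.exp_add, ← Complex.exp_add]
        congr 1
        push_cast
        ring
      linear_combination ((r ^ (α - 1) : ℝ) : ℂ) *
        Complex.exp (((α * θ : ℝ) : ℂ) * Complex.I) * hsplit
    simp only [e]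
    rw [integral_const_mul, h1, hg]
    simp only [mul_one_div]
    rfl
  have hgi : IntegrableOn g (Ioi 0) := by
    have := hFi.integral_prod_right
    refine IntegrableOn.congr_fun this (fun r hr => hinner r hr) measurableSet_Ioi
  have hswap : ∫ t in Ioi (0 : ℝ), ∫ r in Ioi (0 : ℝ), F t r = ∫ r in Ioi (0 : ℝ), g r := by
    rw [integral_integral_swap hFi]
    exact setIntegral_congr_fun measurableSet_Ioi hinner
  have hexp : ∀ y : ℝ, (Real.exp y : ℂ) * g (Real.exp y) =
      Complex.exp (α * (y + θ * Complex.I)) *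
      Complex.exp (-((|x| : ℝ) * Complex.exp (α * (y + θ * Complex.I)))) /
        (s - Complex.exp (y + θ * Complex.I)) := by
    intro y
    have p1 : Real.exp y * Real.exp y ^ (α - 1) = Real.exp (α * y) := by
      rw [← Real.exp_mul, ← Real.exp_add]; ring_nf
    have p2 : Real.exp y ^ α = Real.exp (α * y) := by rw [← Real.exp_mul, mul_comm]
    have e1 : Complex.exp (α * (y + θ * Complex.I)) =
        (Real.exp (α * y) : ℂ) * Complex.exp (((α * θ : ℝ) : ℂ) * Complex.I) := by
      rw [Complex.ofReal_exp, ← Complex.exp_add]; push_cast; ring_nf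
    have e2 : Complex.exp (y + θ * Complex.I) =
        (Real.exp y : ℂ) * Complex.exp (θ * Complex.I) := by
      rw [Complex.ofReal_exp, ← Complex.exp_add]
    rw [e1, e2, hg]
    simp only
    rw [p2, ← p1]
    push_cast
    ring_nf
  have hi := integrable_exp_mul_comp_exp hgi
  simp only [hexp] at hi
  have hres := im_integral_exp_div h.pos h.lt_one (by linarith [h.pi_div_two_lt]) h.lt_pi h.mul_lt
    hx' hs hi
  rw [laplace]
  simp only [hFt]
  rw [integral_const_mul]
  have him := Complex.imCLM.integral_comp_comm hTi
  simp only [Complex.imCLM_apply] at him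
  rw [him, hswap, integral_Ioi_eq_integral_exp]
  simp only [hexp]
  rw [hres, inv_mul_cancel_left₀ hpi.ne']

end IsAdmissibleAngle

/-! ### The density of the folded solution -/

lemma measurable_rayDensity (α θ : ℝ) {X : Type*} [MeasurableSpace X] {x t : X → ℝ}
    (hx : Measurable x) (ht : Measurable t) : Measurable fun p => rayDensity α θ (x p) (t p) := by
  have h : Measurable fun q : X × ℝ => rayIntegrand α θ (x q.1) (t q.1) q.2 := by
    unfold rayIntegrand
    fun_prop
  have h2 := (StronglyMeasurable.integral_prod_right (ν := volume.restrict (Ioi (0 : ℝ)))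
    (f := fun p r => rayIntegrand α θ (x p) (t p) r) h.stronglyMeasurable).measurable
  exact measurable_const.mul (Complex.measurable_im.comp h2)

namespace IsAdmissibleAngle

variable {α θ : ℝ}

/-- The Laplace transform of `rayDensity` may be integrated in `x` against a test function. -/
lemma laplace_integral_mul_rayDensity (h : IsAdmissibleAngle α θ) {φ : ℝ → ℝ} (hφ : Integrable φ)
    {s : ℝ} (hs : 0 < s) :
    IntegrableOn (fun t => Real.exp (-(s * t)) * ∫ x, φ x * rayDensity α θ x t) (Ioi 0) ∧
      laplace (fun t => ∫ x, φ x * rayDensity α θ x t) s =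
        ∫ x, φ x * (s ^ (α - 1) * Real.exp (-(|x| * s ^ α))) := by
  set C := Real.pi⁻¹ * ((1 / -Real.cos θ) ^ α * Real.Gamma α) with hC
  set F : ℝ → ℝ → ℝ := fun t x => Real.exp (-(s * t)) * (φ x * rayDensity α θ x t) with hF
  -- `|rayDensity| ≤ C t^{-α}`, which is integrable at `0` since `α < 1`
  have hpow : IntegrableOn (fun t : ℝ => C * (t ^ (-α) * Real.exp (-(s * t)))) (Ioi 0) := by
    have := integrableOn_rpow_mul_exp (α := 1 - α) (by linarith [h.lt_one]) hs
    rw [show (1 - α - 1 : ℝ) = -α by ring] at this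
    exact this.const_mul C
  have hFi : Integrable (Function.uncurry F)
      ((volume.restrict (Ioi (0 : ℝ))).prod (volume : Measure ℝ)) := by
    have hdom := Integrable.mul_prod hpow hφ.norm
    have hm1 : Measurable fun p : ℝ × ℝ => Real.exp (-(s * p.1)) := by fun_prop
    have hm2 : Measurable fun p : ℝ × ℝ => rayDensity α θ p.2 p.1 :=
      measurable_rayDensity α θ measurable_snd measurable_fst
    have hm3 : AEStronglyMeasurable (fun p : ℝ × ℝ => φ p.2)
        ((volume.restrict (Ioi (0 : ℝ))).prod volume) := hφ.aestronglyMeasurable.comp_snd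
    have hm : AEStronglyMeasurable (Function.uncurry F)
        ((volume.restrict (Ioi (0 : ℝ))).prod volume) :=
      hm1.aestronglyMeasurable.mul (hm3.mul hm2.aestronglyMeasurable)
    refine Integrable.mono' hdom hm ?_
    have hpos : ∀ᵐ p ∂((volume.restrict (Ioi (0 : ℝ))).prod (volume : Measure ℝ)), 0 < p.1 :=
      Measure.quasiMeasurePreserving_fst.ae (ae_restrict_mem measurableSet_Ioi)
    filter_upwards [hpos] with p hp
    simp only [Function.uncurry, hF, norm_mul, Real.norm_of_nonneg (Real.exp_pos _).le]
    have h1 := h.abs_rayDensity_le p.2 hp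
    rw [← hC, ← Real.norm_eq_abs] at h1
    have h2 := mul_le_mul_of_nonneg_left h1
      (mul_nonneg (Real.exp_pos (-(s * p.1))).le (norm_nonneg (φ p.2)))
    linarith
  have hFt : ∀ t, Real.exp (-(s * t)) * ∫ x, φ x * rayDensity α θ x t = ∫ x, F t x := fun t => by
    rw [hF, integral_const_mul]
  refine ⟨?_, ?_⟩
  · simp only [hFt]
    exact hFi.integral_prod_left
  · rw [laplace]
    simp only [hFt]
    rw [integral_integral_swap hFi]
    refine integral_congr_ae ?_
    filter_upwards [Measure.ae_ne volume (0 : ℝ)] with x hx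
    rw [← (h.laplace_rayDensity hx hs).2, laplace, ← integral_const_mul]
    refine integral_congr_ae (ae_of_all _ fun t => ?_)
    simp only [hF]
    ring

lemma continuousAt_integral_mul_rayDensity (h : IsAdmissibleAngle α θ) {φ : ℝ → ℝ}
    (hφ : Integrable φ) {t₀ : ℝ} (ht : 0 < t₀) :
    ContinuousAt (fun t => ∫ x, φ x * rayDensity α θ x t) t₀ := by
  set C := Real.pi⁻¹ * ((1 / -Real.cos θ) ^ α * Real.Gamma α) with hC
  have hC0 : 0 ≤ C := by
    have := Real.Gamma_pos_of_pos h.pos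
    have := h.cos_neg
    have := Real.pi_pos
    positivity
  have hnear : ∀ᶠ t in 𝓝 t₀, t₀ / 2 < t := lt_mem_nhds (half_lt_self ht)
  refine continuousAt_of_dominated (bound := fun x => ‖φ x‖ * (C * (t₀ / 2) ^ (-α))) ?_ ?_
    (hφ.norm.mul_const _) (ae_of_all _ fun x => ?_)
  · exact Eventually.of_forall fun t => hφ.aestronglyMeasurable.mul
      (measurable_rayDensity α θ measurable_id measurable_const).aestronglyMeasurable
  · filter_upwards [hnear] with t ht'
    refine ae_of_all _ fun x => ?_
    rw [norm_mul]
    refine mul_le_mul_of_nonneg_left ((h.abs_rayDensity_le x ((half_pos ht).trans ht')).trans ?_)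
      (norm_nonneg _)
    exact mul_le_mul_of_nonneg_left
      (Real.rpow_le_rpow_of_nonpos (half_pos ht) ht'.le (by linarith [h.pos])) hC0
  · exact continuousAt_const.mul
      ((h.continuousAt_rayDensity x ht).comp (f := fun t => (x, t)) (by fun_prop))

end IsAdmissibleAngle

/-- Finiteness of `ν` is not assumed: that it is finite on compact sets follows from the
comparison with `μ`. -/
lemma MeasureTheory.Measure.ext_of_lintegral_testFunction {μ ν : Measure ℝ} [IsFiniteMeasure μ]
    (h : ∀ φ : ℝ → ℝ, ContDiff ℝ (⊤ : ℕ∞) φ → HasCompactSupport φ → (∀ x, 0 ≤ φ x) →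
      ∫⁻ x, ENNReal.ofReal (φ x) ∂μ = ∫⁻ x, ENNReal.ofReal (φ x) ∂ν) : μ = ν := by
  have key : ∀ ρ τ : Measure ℝ, (∀ φ : ℝ → ℝ, ContDiff ℝ (⊤ : ℕ∞) φ → HasCompactSupport φ →
      (∀ x, 0 ≤ φ x) → ∫⁻ x, ENNReal.ofReal (φ x) ∂ρ = ∫⁻ x, ENNReal.ofReal (φ x) ∂τ) →
      ∀ K G : Set ℝ, IsCompact K → IsOpen G → K ⊆ G → ρ K ≤ τ G := by
    intro ρ τ hρτ K G hK hG hKG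
    obtain ⟨φ, hφ, hφc, h1, h0, h01⟩ := exists_testFunction_one_on_compact hK hG hKG
    calc ρ K = ∫⁻ x, K.indicator 1 x ∂ρ := (lintegral_indicator_one hK.measurableSet).symm
      _ ≤ ∫⁻ x, ENNReal.ofReal (φ x) ∂ρ := lintegral_mono fun x => by
          by_cases hx : x ∈ K <;> simp [hx, h1]
      _ = ∫⁻ x, ENNReal.ofReal (φ x) ∂τ := hρτ φ hφ hφc fun x => (h01 x).1
      _ ≤ ∫⁻ x, G.indicator 1 x ∂τ := lintegral_mono fun x => by
          by_cases hx : x ∈ G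
          · simpa [hx] using (h01 x).2
          · simp [hx, h0 x hx]
      _ = τ G := lintegral_indicator_one hG.measurableSet
  have hνK : ∀ K : Set ℝ, IsCompact K → ν K < ⊤ := fun K hK =>
    (key ν μ (fun φ a b c => (h φ a b c).symm) K univ hK isOpen_univ (subset_univ _)).trans_lt
      (measure_lt_top μ _)
  have : IsFiniteMeasureOnCompacts ν := ⟨fun {K} hK => hνK K hK⟩
  have hle : ∀ ρ τ : Measure ℝ, ρ.Regular →
      (∀ φ : ℝ → ℝ, ContDiff ℝ (⊤ : ℕ∞) φ → HasCompactSupport φ →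
      (∀ x, 0 ≤ φ x) → ∫⁻ x, ENNReal.ofReal (φ x) ∂ρ = ∫⁻ x, ENNReal.ofReal (φ x) ∂τ) →
      ∀ G : Set ℝ, IsOpen G → ρ G ≤ τ G := by
    intro ρ τ _ hρτ G hG
    rw [hG.measure_eq_iSup_isCompact]
    exact iSup₂_le fun K hKG => iSup_le fun hK => key ρ τ hρτ K G hK hG hKG
  have hopen : ∀ G : Set ℝ, IsOpen G → μ G = ν G := fun G hG =>
    le_antisymm (hle μ ν inferInstance h G hG)
      (hle ν μ inferInstance (fun φ a b c => (h φ a b c).symm) G hG)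
  exact ext_of_generate_finite _ BorelSpace.measurable_eq isPiSystem_isOpen
    (fun G hG => hopen G hG) (hopen univ isOpen_univ)

namespace IsFracDiffusionSolution

variable {α θ : ℝ} {u : ℝ≥0 → Measure ℝ}

/-- Both sides are continuous in `t` and have the Laplace transform given by the two-sided
exponential law. -/
lemma integral_testFunction_eq (hu : IsFracDiffusionSolution α u) (h : IsAdmissibleAngle α θ)
    {φ : ℝ → ℝ} (hφ : ContDiff ℝ (⊤ : ℕ∞) φ) (hφc : HasCompactSupport φ) {t : ℝ} (ht : 0 < t) :
    ∫ x, φ x ∂(u t.toNNReal) = ∫ x, φ x * (1 / 2 * rayDensity α θ x t) := by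
  have hp : ∀ t : ℝ, IsProbabilityMeasure (u t.toNNReal) := fun t => hu.isProb _
  have hφi : Integrable (fun x => 1 / 2 * φ x) :=
    (hφ.continuous.integrable_of_hasCompactSupport hφc).const_mul _
  obtain ⟨C, hC⟩ := hφ.continuous.bounded_above_of_compact_support hφc
  have hmeas := hφ.continuous.measurable
  have key := eq_of_laplace_eq (f := fun t => ∫ x, φ x ∂(u t.toNNReal))
    (g := fun t => ∫ x, 1 / 2 * φ x * rayDensity α θ x t)
    (laplaceIntegrable_integral hu.measurable hp hmeas hC)
    (fun s hs => (h.laplace_integral_mul_rayDensity hφi hs).1) (fun s hs => ?_) ht.le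
    (hu.continuous_integral_testFunction hφ hφc).continuousWithinAt
    (h.continuousAt_integral_mul_rayDensity hφi ht).continuousWithinAt
  · refine key.trans (integral_congr_ae (ae_of_all _ fun x => ?_))
    simp only
    ring
  · rw [(h.laplace_integral_mul_rayDensity hφi hs).2, ← integral_laplaceMix hu.measurable hp hs
      hmeas hC, hu.laplaceMix_eq h.pos h.lt_one.le hs, bilateralExp]
    have := integral_withDensity_eq_integral_smul (μ := (volume : Measure ℝ))
      (f := fun x => (s ^ (α - 1) / 2 * Real.exp (-(s ^ α * |x|))).toNNReal) (by fun_prop) φ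
    refine Eq.trans this (integral_congr_ae (ae_of_all _ fun x => ?_))
    simp only [NNReal.smul_def, smul_eq_mul]
    rw [Real.coe_toNNReal _ (by positivity), mul_comm (s ^ α)]
    ring

/-- `rayDensity` is continuous in `x` and has nonnegative integrals against nonnegative test
functions. -/
lemma rayDensity_nonneg (hu : IsFracDiffusionSolution α u) (h : IsAdmissibleAngle α θ) (x : ℝ)
    {t : ℝ} (ht : 0 < t) : 0 ≤ rayDensity α θ x t := by
  by_contra! hneg
  have hcont := h.continuous_rayDensity_left ht
  obtain ⟨φ, hφ, hφc, h1, h0, h01⟩ := exists_testFunction_one_on_compact (isCompact_singleton (x := x))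
    (isOpen_lt hcont continuous_const : IsOpen {y | rayDensity α θ y t < 0})
    (singleton_subset_iff.2 hneg)
  have hpos : 0 < ∫ y, φ y * -(1 / 2 * rayDensity α θ y t) := by
    refine Continuous.integral_pos_of_hasCompactSupport_nonneg_nonzero (x := x) (by
      have := hφ.continuous; fun_prop) hφc.mul_right (fun y => ?_) ?_
    · by_cases hy : rayDensity α θ y t < 0
      · exact mul_nonneg (h01 y).1 (by linarith)
      · simp [h0 y hy]
    · rw [h1 x rfl]
      linarith
  have hint := hu.integral_testFunction_eq h hφ hφc ht
  have hge : 0 ≤ ∫ y, φ y ∂(u t.toNNReal) := integral_nonneg fun y => (h01 y).1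
  simp only [mul_neg, integral_neg] at hpos
  linarith

lemma eq_withDensity_rayDensity (hu : IsFracDiffusionSolution α u) (h : IsAdmissibleAngle α θ)
    {t : ℝ} (ht : 0 < t) :
    u t.toNNReal = volume.withDensity fun x => ENNReal.ofReal (1 / 2 * rayDensity α θ x t) := by
  have := hu.isProb t.toNNReal
  have hcont := h.continuous_rayDensity_left ht
  refine Measure.ext_of_lintegral_testFunction fun φ hφ hφc hφ0 => ?_
  have hφ' := hφ.continuous
  have hρ : ∀ x, 0 ≤ 1 / 2 * rayDensity α θ x t := fun x => by
    have := hu.rayDensity_nonneg h x ht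
    linarith
  obtain ⟨C, hC⟩ := hφ'.bounded_above_of_compact_support hφc
  rw [lintegral_withDensity_eq_lintegral_mul _ (by fun_prop) (by fun_prop),
    ← ofReal_integral_eq_lintegral_ofReal (Integrable.of_bound hφ'.aestronglyMeasurable C
      (ae_of_all _ hC)) (ae_of_all _ hφ0), hu.integral_testFunction_eq h hφ hφc ht,
    ofReal_integral_eq_lintegral_ofReal ?_ (ae_of_all _ fun x => mul_nonneg (hφ0 x) (hρ x))]
  · refine lintegral_congr fun x => ?_
    rw [Pi.mul_apply, ← ENNReal.ofReal_mul (hρ x), mul_comm]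
  · exact Continuous.integrable_of_hasCompactSupport (by fun_prop) hφc.mul_right

lemma foldedLaw_eq_withDensity (hu : IsFracDiffusionSolution α u) (h : IsAdmissibleAngle α θ)
    {t : ℝ} (ht : 0 < t) :
    foldedLaw (u t.toNNReal) =
      (volume.restrict (Ioi 0)).withDensity fun x => ENNReal.ofReal (rayDensity α θ x t) := by
  have hcont := h.continuous_rayDensity_left ht
  have := map_abs_withDensity_comp_abs
    (g := fun y => ENNReal.ofReal (1 / 2 * rayDensity α θ y t)) (by fun_prop)
  simp only [rayDensity_abs] at this
  rw [foldedLaw, hu.eq_withDensity_rayDensity h ht, this]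
  congr 1
  funext x
  rw [← ENNReal.ofReal_ofNat, ← ENNReal.ofReal_mul (by norm_num)]
  congr 1
  ring

end IsFracDiffusionSolution

/-! ### The time-changed process and the folded solution -/

theorem mainTheorem7 {Ω Ω' : Type*} [MeasurableSpace Ω] [MeasurableSpace Ω']
    (P : Measure Ω) [IsProbabilityMeasure P] (P' : Measure Ω') [IsProbabilityMeasure P']
    (α : ℝ) (hα0 : 0 < α) (hα1 : α ≤ 1) :
    -- the CFPP is the CPP time-changed by an independent `T_{2α}`
    (∀ (lam : ℤ → ℝ) (Nα : ℝ≥0 → Ω' → ℕ) (Nc : ℝ≥0 → Ω → ℕ) (T : ℝ≥0 → Ω → ℝ≥0),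
      IsIntensitySeq lam → IsCFPP lam α P' Nα → IsCPP lam P Nc → IsFoldedDiffusionTime α P T →
      IndepFun (fun ω (s : ℝ≥0) => Nc s ω) (fun ω (t : Ioi (0 : ℝ≥0)) => T t ω) P →
      ∀ t : ℝ≥0, 0 < t → IdentDistrib (Nα t) (fun ω => Nc (T t ω) ω) P' P) ∧
    -- the Laplace transform in time of the folded solution, as an identity of measures in `x`
    (∀ u : ℝ≥0 → Measure ℝ, IsFracDiffusionSolution α u →
      ∀ s : ℝ, 0 < s → ∀ A : Set ℝ, MeasurableSet A →
        ∫⁻ t in Ioi (0 : ℝ), ENNReal.ofReal (Real.exp (-(s * t))) * foldedLaw (u t.toNNReal) A =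
          ∫⁻ x in A ∩ Ioi 0, ENNReal.ofReal (s ^ (α - 1) * Real.exp (-(x * s ^ α)))) ∧
    -- for `α < 1`, the folded solution is a density, and the identity holds for every `x > 0`
    (α < 1 → ∀ u : ℝ≥0 → Measure ℝ, IsFracDiffusionSolution α u →
      ∃ f : ℝ → ℝ → ℝ,
        ContinuousOn (fun z : ℝ × ℝ => f z.1 z.2) (Ioi 0 ×ˢ Ioi 0) ∧
        (∀ x t : ℝ, 0 < x → 0 < t → 0 ≤ f x t) ∧
        (∀ t : ℝ≥0, 0 < t → foldedLaw (u t) =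
          (volume.restrict (Ioi 0)).withDensity (fun x => ENNReal.ofReal (f x t))) ∧
        ∀ x s : ℝ, 0 < x → 0 < s →
          IntegrableOn (fun t => Real.exp (-(s * t)) * f x t) (Ioi 0) ∧
          ∫ t in Ioi (0 : ℝ), Real.exp (-(s * t)) * f x t =
            s ^ (α - 1) * Real.exp (-(x * s ^ α))) ∧
    -- the inverse `α`-stable subordinator has the same one-dimensional laws as `T_{2α}`
    (∀ (u : ℝ≥0 → Measure ℝ) (H : ℝ≥0 → Ω → ℝ≥0),
      IsFracDiffusionSolution α u → IsInverseStableSubordinator α P H →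
      ∀ t : ℝ≥0, 0 < t → HasLaw (fun ω => (H t ω : ℝ)) (foldedLaw (u t)) P) ∧
    -- the CFPP is the CPP time-changed by an independent inverse `α`-stable subordinator
    (∀ (lam : ℤ → ℝ) (Nα : ℝ≥0 → Ω' → ℕ) (Nc : ℝ≥0 → Ω → ℕ) (H : ℝ≥0 → Ω → ℝ≥0),
      IsIntensitySeq lam → IsCFPP lam α P' Nα → IsCPP lam P Nc →
      IsInverseStableSubordinator α P H →
      IndepFun (fun ω (s : ℝ≥0) => Nc s ω) (fun ω (t : Ioi (0 : ℝ≥0)) => H t ω) P →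
      ∀ t : ℝ≥0, 0 < t → IdentDistrib (Nα t) (fun ω => Nc (H t ω) ω) P' P) := by
  refine ⟨fun lam Nα Nc T hlam hNα hNc hT hind t ht => ?_,
    fun u hu s hs A hA => hu.lintegral_exp_mul_foldedLaw hα0 hα1 hs hA, fun hα u hu => ?_,
    fun u H hu hH t ht => ?_, fun lam Nα Nc H hlam hNα hNc hH hind t ht => ?_⟩
  · obtain ⟨u, hu, hlaw⟩ := hT
    have hl := hlaw t ht
    rw [← Real.toNNReal_coe (r := t)] at hl
    exact IsCFPP.identDistrib_timeChange hNα hNc hlam hα0 hα1 (hu.isInverseStableFamily hα0 hα1) ht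
      (by simpa using hl) (hind.comp (ψ := fun f : Ioi (0 : ℝ≥0) → ℝ≥0 => f ⟨t, ht⟩) measurable_id
        (measurable_pi_apply _))
  · obtain ⟨θ, h⟩ := exists_isAdmissibleAngle hα0 hα
    refine ⟨rayDensity α θ, fun z hz => (h.continuousAt_rayDensity z.1 hz.2).continuousWithinAt,
      fun x t _ ht => hu.rayDensity_nonneg h x ht, fun t ht => ?_, fun x s hx hs => ?_⟩
    · simpa using hu.foldedLaw_eq_withDensity h (t := (t : ℝ)) ht
    · have := h.laplace_rayDensity hx.ne' hs
      rwa [abs_of_pos hx] at this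
  · obtain ⟨m, hm, hlaw⟩ := hH.exists_family
    have e := hm.eq (hu.isInverseStableFamily hα0 hα1) (t := (t : ℝ)) ht
    rw [Real.toNNReal_coe] at e
    exact e ▸ hlaw t
  · obtain ⟨m, hm, hlaw⟩ := hH.exists_family
    exact IsCFPP.identDistrib_timeChange hNα hNc hlam hα0 hα1 hm ht (hlaw t)
      (hind.comp (ψ := fun f : Ioi (0 : ℝ≥0) → ℝ≥0 => f ⟨t, ht⟩) measurable_id
        (measurable_pi_apply _))
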